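/- Let $g\ge 2$ and let $\Sigma_g$ be a closed oriented surface of genus $g$, that is, a topological space homeomorphic to the quotient of a $4g$-gon by the identification of its sides along the word $x_1z_1x_1^{-1}z_1^{-1}\cdots x_gz_gx_g^{-1}z_g^{-1}$. Let $T^2=\mathbb{R}/\mathbb{Z}\times\mathbb{R}/\mathbb{Z}$, with fundamental class $[T^2]=[\mathbb{R}/\mathbb{Z}]\otimes[\mathbb{R}/\mathbb{Z}]\in H_2(T^2)$, and let $M=\Sigma_g\times T^2$. All homology is singular homology with integer coefficients. For $u\in H_1(\Sigma_g)$ and $v\in H_1(T^2)$ let $u\otimes v\in H_2(M)$ denote their homology cross product, and let $F=[\{p\}\times T^2]\in H_2(M)$ be the image of $[T^2]$ under $x\mapsto(p,x)$, where $p\in\Sigma_g$ is any point. Then for every continuous map $\phi:T^2\to M$ there are $u\in H_1(\Sigma_g)$, $v\in H_1(T^2)$ and $n\in\mathbb{Z}$ such that $$\phi_*[T^2]=u\otimes v+n(-F)\in H_2(M).$$ -/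

import Mathlib

noncomputable section

open CategoryTheory Limits MonoidalCategory Simplicial

namespace SingularCross

/-- The coefficient group `ℤ`. -/
abbrev ZZ : AddCommGrpCat.{0} := AddCommGrpCat.of ℤ

/-- The group of simplicial `n`-chains. -/
abbrev Chain (A : SSet.{0}) (n : ℕ) : AddCommGrpCat.{0} := (A.chainComplex ZZ).X n

/-- The boundary map. -/
abbrev bd (A : SSet.{0}) (n : ℕ) : Chain A (n + 1) →+ Chain A n :=
  ((A.chainComplex ZZ).d (n + 1) n).hom

/-- The `n`-chain given by one `n`-simplex. -/
def single {A : SSet.{0}} {n : ℕ} (x : A _⦋n⦌) : Chain A n :=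
  (A.ιChainComplex (R := ZZ) x).hom (1 : ℤ)

theorem chain_ext {A : SSet.{0}} {n : ℕ} {N : Type} [AddCommGroup N]
    {f g : Chain A n →+ N} (h : ∀ x : A _⦋n⦌, f (single x) = g (single x)) : f = g := by
  have : AddCommGrpCat.ofHom f = AddCommGrpCat.ofHom g := by
    refine SSet.chainComplex_hom_ext fun x => ?_
    refine AddCommGrpCat.hom_ext (AddMonoidHom.ext_int ?_)
    exact h x
  exact congrArg AddCommGrpCat.Hom.hom this

/-- The homomorphism on chains that has prescribed values on the simplices. -/
def chainLift {A : SSet.{0}} {n : ℕ} {N : Type} [AddCommGroup N]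
    (f : A _⦋n⦌ → N) : Chain A n →+ N :=
  (Cofan.IsColimit.desc (A.isColimitChainComplexXCofan ZZ n)
    (fun x => (AddCommGrpCat.ofHom (zmultiplesHom N (f x)) : ZZ ⟶ AddCommGrpCat.of N))).hom

@[simp]
theorem chainLift_single {A : SSet.{0}} {n : ℕ} {N : Type} [AddCommGroup N]
    (f : A _⦋n⦌ → N) (x : A _⦋n⦌) : chainLift f (single x) = f x := by
  have h := Cofan.IsColimit.fac (A.isColimitChainComplexXCofan ZZ n)
    (fun x => (AddCommGrpCat.ofHom (zmultiplesHom N (f x)) : ZZ ⟶ AddCommGrpCat.of N)) x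
  have h2 := congrArg (fun k => k.hom (1 : ℤ)) h
  refine Eq.trans h2 ?_
  exact one_zsmul (f x)

/-- The faces of a simplex. -/
def dl {A : SSet.{0}} {n : ℕ} (i : Fin (n + 2)) (x : A _⦋n + 1⦌) : A _⦋n⦌ := A.δ i x

/-- The degeneracies of a simplex. -/
def sg {A : SSet.{0}} {n : ℕ} (i : Fin (n + 1)) (x : A _⦋n⦌) : A _⦋n + 1⦌ := A.σ i x

theorem bd_single {A : SSet.{0}} {n : ℕ} (x : A _⦋n + 1⦌) :
    bd A n (single x) = ∑ i : Fin (n + 2), (-1 : ℤ) ^ i.val • single (dl i x) := by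
  have h := congrArg (fun k => k.hom (1 : ℤ)) (A.ιChainComplex_d (R := ZZ) x)
  refine Eq.trans h ?_
  let ev : ((ZZ ⟶ Chain A n) →+ Chain A n) :=
    { toFun := fun k => k.hom (1 : ℤ), map_zero' := rfl, map_add' := fun _ _ => rfl }
  refine (map_sum ev _ _).trans (Finset.sum_congr rfl fun i _ => ?_)
  refine Eq.trans ?_ (map_zsmul ev ((-1 : ℤ) ^ i.val) (A.ιChainComplex (A.δ i x)))
  rfl

theorem bd_bd {A : SSet.{0}} {n : ℕ} (w : Chain A (n + 2)) : bd A n (bd A (n + 1) w) = 0 :=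
  congrArg (fun k => k.hom w) ((A.chainComplex ZZ).d_comp_d (n + 2) (n + 1) n)

/-- The group of `(n + 1)`-cycles. -/
abbrev Cyc (A : SSet.{0}) (n : ℕ) : AddSubgroup (Chain A (n + 1)) := (bd A n).ker

/-- The boundary map, with values in the cycles. -/
def bdCyc (A : SSet.{0}) (n : ℕ) : Chain A (n + 2) →+ Cyc A n :=
  (bd A (n + 1)).codRestrict (Cyc A n) bd_bd

/-- Homology with integral coefficients of a simplicial set. -/
abbrev Hlg (A : SSet.{0}) (n : ℕ) : AddCommGrpCat.{0} := A.homology ZZ n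

/-- The inclusion of `Cyc A n` in the categorical object of cycles. -/
def toCyc (A : SSet.{0}) (n : ℕ) :
    AddCommGrpCat.of (Cyc A n) ⟶ (A.chainComplex ZZ).cycles (n + 1) :=
  (A.chainComplex ZZ).liftCycles (A := AddCommGrpCat.of (Cyc A n))
    (AddCommGrpCat.ofHom (Cyc A n).subtype) n (by simp) (by ext x; exact x.2)

/-- The categorical cycles, as elements of `Cyc A n`. -/
def ofCyc (A : SSet.{0}) (n : ℕ) :
    (A.chainComplex ZZ).cycles (n + 1) ⟶ AddCommGrpCat.of (Cyc A n) :=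
  AddCommGrpCat.ofHom (AddMonoidHom.codRestrict
    ((A.chainComplex ZZ).iCycles (n + 1)).hom (Cyc A n) (fun c =>
      congrArg (fun k : (A.chainComplex ZZ).cycles (n + 1) ⟶ Chain A n => k.hom c)
        ((A.chainComplex ZZ).iCycles_d (n + 1) n)))

theorem toCyc_i (A : SSet.{0}) (n : ℕ) :
    toCyc A n ≫ (A.chainComplex ZZ).iCycles (n + 1) = AddCommGrpCat.ofHom (Cyc A n).subtype :=
  HomologicalComplex.liftCycles_i ..

theorem toCyc_ofCyc (A : SSet.{0}) (n : ℕ) : toCyc A n ≫ ofCyc A n = 𝟙 _ := by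
  refine AddCommGrpCat.hom_ext (AddMonoidHom.ext fun x => Subtype.ext ?_)
  exact congrArg (fun k => k.hom x) (toCyc_i A n)

theorem ofCyc_toCyc (A : SSet.{0}) (n : ℕ) : ofCyc A n ≫ toCyc A n = 𝟙 _ := by
  rw [← cancel_mono ((A.chainComplex ZZ).iCycles (n + 1)), Category.assoc, toCyc_i]
  rfl

/-- The homology class of a cycle. -/
def cls (A : SSet.{0}) (n : ℕ) : Cyc A n →+ Hlg A (n + 1) :=
  (toCyc A n ≫ (A.chainComplex ZZ).homologyπ (n + 1)).hom

theorem cls_surjective (A : SSet.{0}) (n : ℕ) : Function.Surjective (cls A n) := by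
  have : IsIso (toCyc A n) := ⟨ofCyc A n, toCyc_ofCyc A n, ofCyc_toCyc A n⟩
  exact (AddCommGrpCat.epi_iff_surjective
    (toCyc A n ≫ (A.chainComplex ZZ).homologyπ (n + 1))).1 (epi_comp _ _)

theorem bdCyc_toCyc (A : SSet.{0}) (n : ℕ) :
    AddCommGrpCat.ofHom (bdCyc A n) ≫ toCyc A n = (A.chainComplex ZZ).toCycles (n + 2) (n + 1) := by
  rw [← cancel_mono ((A.chainComplex ZZ).iCycles (n + 1)), Category.assoc, toCyc_i,
    HomologicalComplex.toCycles_i]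
  rfl

theorem cls_bd (A : SSet.{0}) (n : ℕ) (w : Chain A (n + 2)) : cls A n (bdCyc A n w) = 0 := by
  have h : AddCommGrpCat.ofHom (bdCyc A n) ≫ toCyc A n ≫ (A.chainComplex ZZ).homologyπ (n + 1)
      = 0 := by
    rw [← Category.assoc, bdCyc_toCyc, HomologicalComplex.toCycles_comp_homologyπ]
  exact congrArg (fun k => k.hom w) h

/-- A homomorphism on cycles that vanishes on boundaries descends to homology. -/
def descH (A : SSet.{0}) (n : ℕ) {N : Type} [AddCommGroup N] (k : Cyc A n →+ N)
    (hk : ∀ w : Chain A (n + 2), k (bdCyc A n w) = 0) :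
    Hlg A (n + 1) →+ N :=
  (((A.chainComplex ZZ).homologyIsCokernel (n + 2) (n + 1) (by simp)).desc
    (CokernelCofork.ofπ (Z := AddCommGrpCat.of N) (ofCyc A n ≫ AddCommGrpCat.ofHom k)
      (by
        rw [← bdCyc_toCyc, Category.assoc, ← Category.assoc (toCyc A n), toCyc_ofCyc,
          Category.id_comp]
        ext w
        exact hk w))).hom

@[simp]
theorem descH_cls (A : SSet.{0}) (n : ℕ) {N : Type} [AddCommGroup N] (k : Cyc A n →+ N)
    (hk : ∀ w : Chain A (n + 2), k (bdCyc A n w) = 0) (c : Cyc A n) :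
    descH A n k hk (cls A n c) = k c := by
  have h1 : (A.chainComplex ZZ).homologyπ (n + 1) ≫ AddCommGrpCat.ofHom (descH A n k hk) =
      ofCyc A n ≫ AddCommGrpCat.ofHom k :=
    Cofork.IsColimit.π_desc
      ((A.chainComplex ZZ).homologyIsCokernel (n + 2) (n + 1) (by simp))
  have h2 := congrArg (fun q => q.hom ((toCyc A n).hom c)) h1
  refine Eq.trans h2 (congrArg k ?_)
  exact congrArg (fun q => q.hom c) (toCyc_ofCyc A n)

theorem bd0 {A : SSet.{0}} (x : A _⦋1⦌) : bd A 0 (single x) = single (dl 0 x) - single (dl 1 x) := by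
  rw [bd_single, Fin.sum_univ_two]
  simp [sub_eq_add_neg]

theorem bd1 {A : SSet.{0}} (x : A _⦋2⦌) :
    bd A 1 (single x) = single (dl 0 x) - single (dl 1 x) + single (dl 2 x) := by
  rw [bd_single, Fin.sum_univ_three]
  simp [sub_eq_add_neg]

theorem bd2 {A : SSet.{0}} (x : A _⦋3⦌) :
    bd A 2 (single x) =
      single (dl 0 x) - single (dl 1 x) + single (dl 2 x) - single (dl 3 x) := by
  rw [bd_single, Fin.sum_univ_four]
  simp [sub_eq_add_neg, pow_succ]

section faces

variable {A : SSet.{0}}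

theorem f1_00 (x : A _⦋0⦌) : dl 0 (sg 0 x) = x := A.δ_comp_σ_self_apply (0 : Fin 1) x
theorem f1_10 (x : A _⦋0⦌) : dl 1 (sg 0 x) = x := A.δ_comp_σ_succ_apply (0 : Fin 1) x

theorem f2_00 (x : A _⦋1⦌) : dl 0 (sg 0 x) = x := SSet.δ_comp_σ_self_apply (0 : Fin 2) x
theorem f2_10 (x : A _⦋1⦌) : dl 1 (sg 0 x) = x := SSet.δ_comp_σ_succ_apply (0 : Fin 2) x
theorem f2_11 (x : A _⦋1⦌) : dl 1 (sg 1 x) = x := SSet.δ_comp_σ_self_apply (1 : Fin 2) x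
theorem f2_21 (x : A _⦋1⦌) : dl 2 (sg 1 x) = x := SSet.δ_comp_σ_succ_apply (1 : Fin 2) x
theorem f2_20 (x : A _⦋1⦌) : dl 2 (sg 0 x) = sg 0 (dl 1 x) :=
  SSet.δ_comp_σ_of_gt_apply (i := (1 : Fin 2)) (j := (0 : Fin 1)) (by decide) x
theorem f2_01 (x : A _⦋1⦌) : dl 0 (sg 1 x) = sg 0 (dl 0 x) :=
  SSet.δ_comp_σ_of_le_apply (i := (0 : Fin 2)) (j := (0 : Fin 1)) (by decide) x

theorem f3_00 (x : A _⦋2⦌) : dl 0 (sg 0 x) = x := SSet.δ_comp_σ_self_apply (0 : Fin 3) x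
theorem f3_10 (x : A _⦋2⦌) : dl 1 (sg 0 x) = x := SSet.δ_comp_σ_succ_apply (0 : Fin 3) x
theorem f3_11 (x : A _⦋2⦌) : dl 1 (sg 1 x) = x := SSet.δ_comp_σ_self_apply (1 : Fin 3) x
theorem f3_21 (x : A _⦋2⦌) : dl 2 (sg 1 x) = x := SSet.δ_comp_σ_succ_apply (1 : Fin 3) x
theorem f3_22 (x : A _⦋2⦌) : dl 2 (sg 2 x) = x := SSet.δ_comp_σ_self_apply (2 : Fin 3) x
theorem f3_32 (x : A _⦋2⦌) : dl 3 (sg 2 x) = x := SSet.δ_comp_σ_succ_apply (2 : Fin 3) x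
theorem f3_20 (x : A _⦋2⦌) : dl 2 (sg 0 x) = sg 0 (dl 1 x) :=
  SSet.δ_comp_σ_of_gt_apply (i := (1 : Fin 3)) (j := (0 : Fin 2)) (by decide) x
theorem f3_30 (x : A _⦋2⦌) : dl 3 (sg 0 x) = sg 0 (dl 2 x) :=
  SSet.δ_comp_σ_of_gt_apply (i := (2 : Fin 3)) (j := (0 : Fin 2)) (by decide) x
theorem f3_31 (x : A _⦋2⦌) : dl 3 (sg 1 x) = sg 1 (dl 2 x) :=
  SSet.δ_comp_σ_of_gt_apply (i := (2 : Fin 3)) (j := (1 : Fin 2)) (by decide) x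
theorem f3_01 (x : A _⦋2⦌) : dl 0 (sg 1 x) = sg 0 (dl 0 x) :=
  SSet.δ_comp_σ_of_le_apply (i := (0 : Fin 3)) (j := (0 : Fin 2)) (by decide) x
theorem f3_02 (x : A _⦋2⦌) : dl 0 (sg 2 x) = sg 1 (dl 0 x) :=
  SSet.δ_comp_σ_of_le_apply (i := (0 : Fin 3)) (j := (1 : Fin 2)) (by decide) x
theorem f3_12 (x : A _⦋2⦌) : dl 1 (sg 2 x) = sg 1 (dl 1 x) :=
  SSet.δ_comp_σ_of_le_apply (i := (1 : Fin 3)) (j := (1 : Fin 2)) (by decide) x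

end faces

/-- A simplex of a product of simplicial sets. -/
def pr {A B : SSet.{0}} {n : ℕ} (x : A _⦋n⦌) (y : B _⦋n⦌) : (A ⊗ B : SSet.{0}) _⦋n⦌ := (x, y)

theorem dl_pr {A B : SSet.{0}} {n : ℕ} (x : A _⦋n + 1⦌) (y : B _⦋n + 1⦌) (i : Fin (n + 2)) :
    dl i (pr x y) = pr (dl i x) (dl i y) := rfl

section products

variable (A B : SSet.{0})

/-- The cross product of a `1`-chain and a `1`-chain, given by the two `(1, 1)`-shuffles:
`x × y = (s₁ x, s₀ y) - (s₀ x, s₁ y)`, the standard triangulation of a square. -/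
def cross11 : Chain A 1 →+ Chain B 1 →+ Chain (A ⊗ B) 2 :=
  chainLift fun x => chainLift fun y =>
    single (pr (sg 1 x) (sg 0 y)) - single (pr (sg 0 x) (sg 1 y))

/-- The cross product of a `0`-chain and a `1`-chain. -/
def cross01 : Chain A 0 →+ Chain B 1 →+ Chain (A ⊗ B) 1 :=
  chainLift fun x => chainLift fun y => single (pr (sg 0 x) y)

/-- The cross product of a `1`-chain and a `0`-chain. -/
def cross10 : Chain A 1 →+ Chain B 0 →+ Chain (A ⊗ B) 1 :=
  chainLift fun x => chainLift fun y => single (pr x (sg 0 y))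

/-- The cross product of a `0`-chain and a `2`-chain. -/
def cross02 : Chain A 0 →+ Chain B 2 →+ Chain (A ⊗ B) 2 :=
  chainLift fun x => chainLift fun y => single (pr (sg 1 (sg 0 x)) y)

/-- The cross product of a `2`-chain and a `0`-chain. -/
def cross20 : Chain A 2 →+ Chain B 0 →+ Chain (A ⊗ B) 2 :=
  chainLift fun x => chainLift fun y => single (pr x (sg 1 (sg 0 y)))

/-- The cross product of a `2`-chain and a `1`-chain. -/
def cross21 : Chain A 2 →+ Chain B 1 →+ Chain (A ⊗ B) 3 :=
  chainLift fun x => chainLift fun y =>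
    single (pr (sg 2 x) (sg 1 (sg 0 y))) - single (pr (sg 1 x) (sg 2 (sg 0 y)))
      + single (pr (sg 0 x) (sg 2 (sg 1 y)))

/-- The cross product of a `1`-chain and a `2`-chain. -/
def cross12 : Chain A 1 →+ Chain B 2 →+ Chain (A ⊗ B) 3 :=
  chainLift fun x => chainLift fun y =>
    single (pr (sg 2 (sg 1 x)) (sg 0 y)) - single (pr (sg 2 (sg 0 x)) (sg 1 y))
      + single (pr (sg 1 (sg 0 x)) (sg 2 y))

variable {A B}

theorem bd_cross11 (a : Chain A 1) (b : Chain B 1) :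
    bd (A ⊗ B) 1 (cross11 A B a b) =
      cross01 A B (bd A 0 a) b - cross10 A B a (bd B 0 b) := by
  have h : (cross11 A B).compr₂ (bd (A ⊗ B) 1) =
      (cross01 A B).comp (bd A 0) - (cross10 A B).compl₂ (bd B 0) := by
    refine chain_ext fun x => chain_ext fun y => ?_
    simp only [AddMonoidHom.compr₂_apply, AddMonoidHom.sub_apply, AddMonoidHom.comp_apply,
      AddMonoidHom.compl₂_apply, cross11, cross01, cross10, chainLift_single, map_sub,
      bd0, bd1, dl_pr, f2_00, f2_10, f2_11, f2_21, f2_20, f2_01]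
    abel
  exact DFunLike.congr_fun (DFunLike.congr_fun h a) b

theorem bd_cross21 (a : Chain A 2) (b : Chain B 1) :
    bd (A ⊗ B) 2 (cross21 A B a b) =
      cross11 A B (bd A 1 a) b + cross20 A B a (bd B 0 b) := by
  have h : (cross21 A B).compr₂ (bd (A ⊗ B) 2) =
      (cross11 A B).comp (bd A 1) + (cross20 A B).compl₂ (bd B 0) := by
    refine chain_ext fun x => chain_ext fun y => ?_
    simp only [AddMonoidHom.compr₂_apply, AddMonoidHom.sub_apply, AddMonoidHom.comp_apply,
      AddMonoidHom.compl₂_apply, cross11, cross21, cross20, chainLift_single, map_sub, map_add,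
      AddMonoidHom.add_apply, bd0, bd1, bd2, dl_pr, f2_00, f2_10, f2_11, f2_20, f2_01,
      f3_00, f3_10, f3_11, f3_21, f3_22, f3_32, f3_20, f3_30, f3_31, f3_01, f3_02, f3_12]
    abel
  exact DFunLike.congr_fun (DFunLike.congr_fun h a) b

theorem bd_cross12 (a : Chain A 1) (b : Chain B 2) :
    bd (A ⊗ B) 2 (cross12 A B a b) =
      cross02 A B (bd A 0 a) b - cross11 A B a (bd B 1 b) := by
  have h : (cross12 A B).compr₂ (bd (A ⊗ B) 2) =
      (cross02 A B).comp (bd A 0) - (cross11 A B).compl₂ (bd B 1) := by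
    refine chain_ext fun x => chain_ext fun y => ?_
    simp only [AddMonoidHom.compr₂_apply, AddMonoidHom.sub_apply, AddMonoidHom.comp_apply,
      AddMonoidHom.compl₂_apply, cross11, cross12, cross02, chainLift_single, map_sub, map_add,
      bd0, bd1, bd2, dl_pr, f2_00, f2_10, f2_11, f2_20, f2_01,
      f3_00, f3_10, f3_11, f3_21, f3_22, f3_32, f3_20, f3_30, f3_31, f3_01, f3_02, f3_12]
    abel
  exact DFunLike.congr_fun (DFunLike.congr_fun h a) b

variable (A B) in
/-- The cross product of a `1`-cycle and a `1`-cycle. -/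
def crossCyc : Cyc A 0 →+ Cyc B 0 →+ Cyc (A ⊗ B) 1 :=
  AddMonoidHom.mk' (fun a => AddMonoidHom.mk'
    (fun b => ⟨cross11 A B a b, by
      have ha : bd A 0 a = 0 := a.2
      have hb : bd B 0 b = 0 := b.2
      rw [AddMonoidHom.mem_ker, bd_cross11, ha, hb]; simp⟩)
    (fun b b' => Subtype.ext (by simp)))
    (fun a a' => AddMonoidHom.ext fun b => Subtype.ext (by simp))

theorem cls_crossCyc_left (w : Chain A 2) (b : Cyc B 0) :
    cls (A ⊗ B) 1 (crossCyc A B (bdCyc A 0 w) b) = 0 := by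
  refine Eq.trans (congrArg _ (Subtype.ext ?_)) (cls_bd (A ⊗ B) 1 (cross21 A B w b))
  have hb : bd B 0 b = 0 := b.2
  refine Eq.trans ?_ (bd_cross21 w b.1).symm
  rw [hb, map_zero, add_zero]
  rfl

theorem cls_crossCyc_right (a : Cyc A 0) (w : Chain B 2) :
    cls (A ⊗ B) 1 (crossCyc A B a (bdCyc B 0 w)) = 0 := by
  refine Eq.trans (congrArg _ (Subtype.ext ?_)) (cls_bd (A ⊗ B) 1 (-(cross12 A B a w)))
  have ha : bd A 0 a = 0 := a.2
  refine Eq.trans ?_ ((map_neg _ _).trans (congrArg _ (bd_cross12 a.1 w))).symm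
  rw [ha, map_zero, AddMonoidHom.zero_apply, zero_sub, neg_neg]
  rfl

variable (A B) in
/-- The homology cross product `H₁(A) × H₁(B) → H₂(A × B)`: it sends the classes of two cycles to
the class of their cross product. -/
def crossH : Hlg A 1 →+ Hlg B 1 →+ Hlg (A ⊗ B) 2 :=
  descH A 0
    (AddMonoidHom.flip (descH B 0 ((crossCyc A B).compr₂ (cls (A ⊗ B) 1)).flip
      (fun w => AddMonoidHom.ext fun a => cls_crossCyc_right a w)))
    (fun w => AddMonoidHom.ext fun y => by
      obtain ⟨b, rfl⟩ := cls_surjective B 0 y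
      rw [AddMonoidHom.flip_apply, descH_cls]
      exact cls_crossCyc_left w b)

theorem crossH_cls (a : Cyc A 0) (b : Cyc B 0) :
    crossH A B (cls A 0 a) (cls B 0 b) = cls (A ⊗ B) 1 (crossCyc A B a b) := by
  rw [crossH, descH_cls, AddMonoidHom.flip_apply, descH_cls]
  rfl

end products

end SingularCross

open SingularCross

/-- The `n`-th singular homology group of a topological space, with integral coefficients. -/
abbrev singH (n : ℕ) (X : Type) [TopologicalSpace X] : AddCommGrpCat.{0} :=
  ((AlgebraicTopology.singularHomologyFunctor AddCommGrpCat.{0} n).obj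
    (AddCommGrpCat.of ℤ)).obj (TopCat.of X)

/-- The homomorphism that a continuous map induces on the `n`-th singular homology. -/
def singMap (n : ℕ) {X Y : Type} [TopologicalSpace X] [TopologicalSpace Y] (f : C(X, Y)) :
    singH n X →+ singH n Y :=
  (((AlgebraicTopology.singularHomologyFunctor AddCommGrpCat.{0} n).obj
    (AddCommGrpCat.of ℤ)).map (TopCat.ofHom f)).hom

/-- The canonical bijection between pairs of singular simplices of `X` and of `Y` and singular
simplices of `X × Y`. -/
def singProd (X Y : Type) [TopologicalSpace X] [TopologicalSpace Y] :
    (TopCat.toSSet.obj (TopCat.of X) ⊗ TopCat.toSSet.obj (TopCat.of Y) : SSet.{0}) ⟶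
      TopCat.toSSet.obj (TopCat.of (X × Y)) where
  app n := ↾fun p => ⟨TopCat.ofHom (ContinuousMap.prodMk p.1.down.hom p.2.down.hom)⟩
  naturality n m f := by
    ext x
    rfl

/-- The homology cross product `H₁(X) × H₁(Y) → H₂(X × Y)`, `(u, v) ↦ u ⊗ v`, which is
the degree `(1, 1)` part of the map in the Künneth formula. -/
def homCross {X Y : Type} [TopologicalSpace X] [TopologicalSpace Y] :
    singH 1 X →+ singH 1 Y →+ singH 2 (X × Y) :=
  (crossH (TopCat.toSSet.obj (TopCat.of X)) (TopCat.toSSet.obj (TopCat.of Y))).compr₂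
    (SSet.homologyMap (singProd X Y) (AddCommGrpCat.of ℤ) 2).hom

/-- The singular `1`-simplex `(x₀, x₁) ↦ x₁ mod 1` of the circle `ℝ/ℤ`, which is the loop that
runs once around it. -/
def circleSimplex : (TopCat.toSSet.obj (TopCat.of UnitAddCircle) : SSet.{0}) _⦋1⦌ :=
  ⟨TopCat.ofHom ⟨fun x : ULift (stdSimplex ℝ (Fin 2)) => ((x.down 1 : ℝ) : UnitAddCircle),
    (AddCircle.continuous_mk' 1).comp
      ((continuous_apply 1).comp (continuous_subtype_val.comp continuous_uliftDown))⟩⟩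

theorem circleSimplex_faces : dl 0 circleSimplex = dl 1 circleSimplex := by
  have h (i : Fin 2) (x : stdSimplex ℝ (Fin 1)) :
      stdSimplex.map (SimplexCategory.δ i).toOrderHom x =
        stdSimplex.vertex ((SimplexCategory.δ i).toOrderHom 0) := by
    rw [← stdSimplex.map_vertex]
    exact congrArg _ (Subsingleton.elim _ _)
  have h0 (x : stdSimplex ℝ (Fin 1)) :
      stdSimplex.map (SimplexCategory.δ (0 : Fin 2)).toOrderHom x 1 = 1 := by
    rw [h]
    exact Pi.single_eq_same (M := fun _ : Fin 2 => ℝ) 1 1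
  have h1 (x : stdSimplex ℝ (Fin 1)) :
      stdSimplex.map (SimplexCategory.δ (1 : Fin 2)).toOrderHom x 1 = 0 := by
    rw [h]
    exact Pi.single_eq_of_ne (M := fun _ : Fin 2 => ℝ) (i := 0)
      (show (1 : Fin 2) ≠ 0 by decide) 1
  refine ULift.ext _ _ (TopCat.hom_ext (ContinuousMap.ext fun x => ?_))
  refine (congrArg (fun r : ℝ => (r : UnitAddCircle)) (h0 x.down)).trans
    (Eq.trans ?_ (congrArg (fun r : ℝ => (r : UnitAddCircle)) (h1 x.down)).symm)
  exact (AddCircle.coe_period 1).trans rfl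

theorem circleSimplex_mem :
    single circleSimplex ∈ Cyc (TopCat.toSSet.obj (TopCat.of UnitAddCircle)) 0 := by
  rw [AddMonoidHom.mem_ker, bd0, circleSimplex_faces, sub_self]

/-- The fundamental class of the circle `ℝ/ℤ`. -/
def circleClass : singH 1 UnitAddCircle :=
  cls (TopCat.toSSet.obj (TopCat.of UnitAddCircle)) 0 ⟨single circleSimplex, circleSimplex_mem⟩

/-- The torus `T² = ℝ/ℤ × ℝ/ℤ`. -/
abbrev Torus : Type := UnitAddCircle × UnitAddCircle

/-- The fundamental class `[T²] = [S¹] ⊗ [S¹]` of the torus. -/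
def torusClass : singH 2 Torus := homCross circleClass circleClass

/-- The class `F = [{p} × T²]` in `H₂(S × T²)`. -/
def fiberClass {S : Type} [TopologicalSpace S] (p : S) : singH 2 (S × Torus) :=
  singMap 2 ((ContinuousMap.const Torus p).prodMk (ContinuousMap.id Torus)) torusClass

/-- The point `exp (2πiθ / (4g))` of the unit circle. The circle is seen as a polygon with `4g`
sides: the `k`-th side consists of the points with `k ≤ θ ≤ k + 1`. -/
def polygonPoint (g : ℕ) (θ : ℝ) : ℂ :=
  Complex.exp (2 * Real.pi * Complex.I * ((θ / (4 * g) : ℝ) : ℂ))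

/-- The identification of the sides of the `4g`-gon, read along the boundary as
`x₁ z₁ x₁⁻¹ z₁⁻¹ ⋯ x_g z_g x_g⁻¹ z_g⁻¹`: for `k = 4j` and `k = 4j + 1` with `j < g`, the `k`-th side
is glued to the `(k + 2)`-nd one, with reversed direction. -/
def SideRel (g : ℕ) (z w : Metric.closedBall (0 : ℂ) 1) : Prop :=
  ∃ j < g, ∃ i < 2, ∃ s ∈ Set.Icc (0 : ℝ) 1,
    (z : ℂ) = polygonPoint g ((4 * j + i : ℕ) + s) ∧
    (w : ℂ) = polygonPoint g ((4 * j + i : ℕ) + 3 - s)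

/-- The standard closed orientable surface of genus `g` (for `g ≥ 1`): the quotient of the closed
disc by the identification of the sides of the `4g`-gon, with the quotient topology. -/
abbrev GenusSurface (g : ℕ) : Type := Quot (SideRel g)

end

/-! Write `φ = (f, h)` with `f : T² → Σ` and `h : T² → T²`. Both coordinates of the torus can be
doubled, one copy being fed to `f` and the other to `h`. The diagonal loop of `S¹ × S¹` is
homologous to the sum of its two axes, so bilinearity of the cross product splits `φ_*[T²]` into
four terms: `f` alone, `h` alone, and `α ⊗ h_*b - β ⊗ h_*a`. Here `a`, `b` are the two standard
loops of the torus and `α = f_*a`, `β = f_*b` (`singMap_prodMk_torusClass`). The term of `h` alone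
is a multiple of the fibre class, because self-maps of the torus multiply `[T²]` by an integer. It
remains to show that the term of `f` alone vanishes and that `α` and `β` are multiples of one class
`u`; then the mixed terms combine into a single `u ⊗ v`.

Both facts come from cup products. Every side of the polygon has a coordinate map `Σ → S¹`, of
degree one on that side and null on the others. Let `A`, `B` be the vectors of winding numbers of
`α`, `β` in these coordinates. If `f_*[T²] = d [Σ]`, then evaluating cup products of coordinates on
both sides shows that the minors of `(A, B)` are `d` times the entries of the standard symplectic
form. Since `g ≥ 2`, there are two disjoint handles, and the Plücker relation for `2 × 2` minors
gives `d² = 0` (`singMap_torusClass_eq_zero`). Now all minors vanish, and integral vectors with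
vanishing minors are multiples of a common one (`exists_common_multiple`).

Of the homology of `Σ` only generation is needed: `H₂` is generated by the class of the polygon and
`H₁` by the sides. This is proved on chains, by small simplices for the cover by an inner disc and a
neighbourhood of the sides (`excise_one`, `excise_two`) and by retracting the latter onto a wedge of
circles (`carried_one`, `carried_two`). The homology of the circle comes from its covering by the
line. Independence of the generators is detected by winding numbers and their cup products. -/

noncomputable section

open CategoryTheory Limits MonoidalCategory Simplicial SingularCross

/-! ### Singular chains, induced maps and homology classes -/

namespace SingChain

/-- The standard topological `n`-simplex. -/
abbrev Spx (n : ℕ) : Type := stdSimplex ℝ (Fin (n + 1))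

/-- The group of singular `n`-chains of a topological space. -/
abbrev SChain (X : Type) [TopologicalSpace X] (n : ℕ) : AddCommGrpCat.{0} :=
  Chain (TopCat.toSSet.obj (TopCat.of X)) n

/-- The group of singular `(n + 1)`-cycles of a topological space. -/
abbrev SCyc (X : Type) [TopologicalSpace X] (n : ℕ) : AddSubgroup (SChain X (n + 1)) :=
  Cyc (TopCat.toSSet.obj (TopCat.of X)) n

/-- The boundary of singular chains. -/
abbrev sbd (X : Type) [TopologicalSpace X] (n : ℕ) : SChain X (n + 1) →+ SChain X n :=
  bd (TopCat.toSSet.obj (TopCat.of X)) n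

/-- The homology class of a singular cycle. -/
def scls (X : Type) [TopologicalSpace X] (n : ℕ) : SCyc X n →+ singH (n + 1) X :=
  cls (TopCat.toSSet.obj (TopCat.of X)) n

section simplicial

variable {A B : SSet.{0}} (F : A ⟶ B)

/-- The map on simplicial chains induced by a map of simplicial sets. -/
def chainMap (n : ℕ) : Chain A n →+ Chain B n := ((SSet.chainComplexMap F ZZ).f n).hom

theorem chainMap_single {n : ℕ} (x : A _⦋n⦌) :
    chainMap F n (single x) = single (F.app _ x) :=
  congrArg (fun k => k.hom (1 : ℤ)) (SSet.ι_chainComplexMap_f (R := ZZ) (X := A) (Y := B) (f := F) x)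

theorem homologyMap_cls {n : ℕ} (c : Cyc A n) (c' : Cyc B n)
    (h : chainMap F (n + 1) c = c') :
    (SSet.homologyMap F ZZ (n + 1)).hom (cls A n c) = cls B n c' := by
  -- A cycle is encoded as a morphism from `ℤ`, so that the claim becomes an identity of morphisms
  -- and follows from naturality of `homologyπ`.
  let φ : AddCommGrpCat.of ℤ ⟶ AddCommGrpCat.of (Cyc A n) :=
    AddCommGrpCat.ofHom (zmultiplesHom _ c)
  let ψ : AddCommGrpCat.of ℤ ⟶ AddCommGrpCat.of (Cyc B n) :=
    AddCommGrpCat.ofHom (zmultiplesHom _ c')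
  have h1 : φ ≫ toCyc A n ≫ HomologicalComplex.cyclesMap (SSet.chainComplexMap F ZZ) (n + 1) =
      ψ ≫ toCyc B n := by
    rw [← cancel_mono ((B.chainComplex ZZ).iCycles (n + 1)), Category.assoc, Category.assoc,
      Category.assoc, toCyc_i, HomologicalComplex.cyclesMap_i, ← Category.assoc (toCyc A n), toCyc_i]
    refine AddCommGrpCat.hom_ext (AddMonoidHom.ext_int ?_)
    change chainMap F (n + 1) ((1 : ℤ) • c : Cyc A n) = ((1 : ℤ) • c' : Cyc B n)
    rw [one_zsmul, one_zsmul, h]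
  have h2 : φ ≫ (toCyc A n ≫ (A.chainComplex ZZ).homologyπ (n + 1)) ≫
      SSet.homologyMap F ZZ (n + 1) =
      ψ ≫ toCyc B n ≫ (B.chainComplex ZZ).homologyπ (n + 1) := by
    rw [← Category.assoc ψ, ← h1, SSet.homologyMap]
    simp only [Category.assoc, HomologicalComplex.homologyπ_naturality]
  have h3 := congrArg (fun k => k.hom (1 : ℤ)) h2
  change (SSet.homologyMap F ZZ (n + 1)).hom (cls A n ((1 : ℤ) • c)) = cls B n ((1 : ℤ) • c') at h3
  rwa [one_zsmul, one_zsmul] at h3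

end simplicial

variable {X Y Z : Type} [TopologicalSpace X] [TopologicalSpace Y] [TopologicalSpace Z]

/-- A continuous map from the standard simplex, as an element of the singular set. -/
def smp {n : ℕ} (σ : C(Spx n, X)) : (TopCat.toSSet.obj (TopCat.of X) : SSet.{0}) _⦋n⦌ :=
  ⟨TopCat.ofHom ⟨fun x : ULift (Spx n) => σ x.down, σ.continuous.comp continuous_uliftDown⟩⟩

/-- The continuous map underlying an element of the singular set. -/
def unsmp {n : ℕ} (x : (TopCat.toSSet.obj (TopCat.of X) : SSet.{0}) _⦋n⦌) : C(Spx n, X) :=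
  ⟨fun t => x.down.hom (ULift.up t), x.down.hom.continuous.comp continuous_uliftUp⟩

@[simp] theorem unsmp_smp {n : ℕ} (σ : C(Spx n, X)) : unsmp (smp σ) = σ := rfl

/-- The chain given by a singular simplex. -/
def sgl {n : ℕ} (σ : C(Spx n, X)) : SChain X n := single (smp σ)

theorem schain_ext {n : ℕ} {N : Type} [AddCommGroup N] {f g : SChain X n →+ N}
    (h : ∀ σ : C(Spx n, X), f (sgl σ) = g (sgl σ)) : f = g :=
  chain_ext fun x => h (unsmp x)

/-- The homomorphism on singular chains with prescribed values on simplices. -/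
def slift {n : ℕ} {N : Type} [AddCommGroup N] (f : C(Spx n, X) → N) : SChain X n →+ N :=
  chainLift fun x => f (unsmp x)

@[simp] theorem slift_sgl {n : ℕ} {N : Type} [AddCommGroup N] (f : C(Spx n, X) → N)
    (σ : C(Spx n, X)) : slift f (sgl σ) = f σ := by
  rw [slift, sgl, chainLift_single, unsmp_smp]

theorem schain_induction {n : ℕ} {p : SChain X n → Prop} (h0 : p 0)
    (hs : ∀ σ, p (sgl σ)) (ha : ∀ a b, p a → p b → p (a + b)) (hn : ∀ a, p a → p (-a))
    (c : SChain X n) : p c := by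
  let P : AddSubgroup (SChain X n) :=
    { carrier := {c | p c}, zero_mem' := h0, add_mem' := fun {a b} => ha a b,
      neg_mem' := fun {a} => hn a }
  -- The quotient map by the subgroup of good chains kills every simplex, hence is zero.
  have : (QuotientAddGroup.mk' P) = 0 := schain_ext fun σ => by
    rw [AddMonoidHom.zero_apply]
    exact (QuotientAddGroup.eq_zero_iff _).2 (hs σ)
  exact (QuotientAddGroup.eq_zero_iff c).1 (DFunLike.congr_fun this c)

/-- The inclusion of a face of the standard simplex. -/
def face {n : ℕ} (i : Fin (n + 2)) : C(Spx n, Spx (n + 1)) :=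
  ⟨stdSimplex.map (SimplexCategory.δ i).toOrderHom, stdSimplex.continuous_map _⟩

theorem dl_smp {n : ℕ} (i : Fin (n + 2)) (σ : C(Spx (n + 1), X)) :
    dl i (smp σ) = smp (σ.comp (face i)) := rfl

/-- The collapse of the standard simplex that corresponds to a degeneracy. -/
def degen {n : ℕ} (i : Fin (n + 1)) : C(Spx (n + 1), Spx n) :=
  ⟨stdSimplex.map (SimplexCategory.σ i).toOrderHom, stdSimplex.continuous_map _⟩

theorem sg_smp {n : ℕ} (i : Fin (n + 1)) (σ : C(Spx n, X)) :
    sg i (smp σ) = smp (σ.comp (degen i)) := rfl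

theorem sbd_sgl {n : ℕ} (σ : C(Spx (n + 1), X)) :
    sbd X n (sgl σ) = ∑ i : Fin (n + 2), (-1 : ℤ) ^ i.val • sgl (σ.comp (face i)) :=
  bd_single _

theorem sbd0 (σ : C(Spx 1, X)) :
    sbd X 0 (sgl σ) = sgl (σ.comp (face 0)) - sgl (σ.comp (face 1)) := bd0 _

theorem sbd1 (σ : C(Spx 2, X)) :
    sbd X 1 (sgl σ) = sgl (σ.comp (face 0)) - sgl (σ.comp (face 1)) + sgl (σ.comp (face 2)) :=
  bd1 _

theorem sbd2 (σ : C(Spx 3, X)) :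
    sbd X 2 (sgl σ) = sgl (σ.comp (face 0)) - sgl (σ.comp (face 1)) + sgl (σ.comp (face 2))
      - sgl (σ.comp (face 3)) := bd2 _

/-- The map on singular chains induced by a continuous map. -/
def push (n : ℕ) (f : C(X, Y)) : SChain X n →+ SChain Y n := slift fun σ => sgl (f.comp σ)

@[simp] theorem push_sgl {n : ℕ} (f : C(X, Y)) (σ : C(Spx n, X)) :
    push n f (sgl σ) = sgl (f.comp σ) := slift_sgl _ _

theorem push_push {n : ℕ} (g : C(Y, Z)) (f : C(X, Y)) (c : SChain X n) :
    push n g (push n f c) = push n (g.comp f) c := by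
  have : (push n g).comp (push n f) = push n (g.comp f) := schain_ext fun σ => by
    simp [ContinuousMap.comp_assoc]
  exact DFunLike.congr_fun this c

theorem push_id {n : ℕ} (c : SChain X n) : push n (ContinuousMap.id X) c = c := by
  have : push n (ContinuousMap.id X) = AddMonoidHom.id _ := schain_ext fun σ => by simp
  exact DFunLike.congr_fun this c

theorem sbd_push {n : ℕ} (f : C(X, Y)) (c : SChain X (n + 1)) :
    sbd Y n (push (n + 1) f c) = push n f (sbd X n c) := by
  have : (sbd Y n).comp (push (n + 1) f) = (push n f).comp (sbd X n) := schain_ext fun σ => by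
    simp only [AddMonoidHom.comp_apply, push_sgl, sbd_sgl, map_sum, map_zsmul]
    rfl
  exact DFunLike.congr_fun this c

/-- The map on singular cycles induced by a continuous map. -/
def pushCyc (n : ℕ) (f : C(X, Y)) : SCyc X n →+ SCyc Y n :=
  ((push (n + 1) f).comp (SCyc X n).subtype).codRestrict (SCyc Y n) fun c => by
    have : sbd X n c = 0 := c.2
    rw [AddMonoidHom.mem_ker]
    refine (sbd_push f _).trans ?_
    exact (congrArg _ this).trans (map_zero _)

@[simp] theorem coe_pushCyc {n : ℕ} (f : C(X, Y)) (c : SCyc X n) :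
    (pushCyc n f c : SChain Y (n + 1)) = push (n + 1) f c := rfl

theorem singMap_scls {n : ℕ} (f : C(X, Y)) (c : SCyc X n) :
    singMap (n + 1) f (scls X n c) = scls Y n (pushCyc n f c) := by
  refine homologyMap_cls (TopCat.toSSet.map (TopCat.ofHom f)) c (pushCyc n f c) ?_
  refine DFunLike.congr_fun (schain_ext (f := chainMap (TopCat.toSSet.map (TopCat.ofHom f)) (n + 1))
    (g := push (n + 1) f) fun σ => ?_) c.1
  rw [push_sgl]
  exact chainMap_single _ _

/-- For the nontrivial direction, the projection of the cycles modulo boundaries descends to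
homology, so it kills any cycle whose class is zero. -/
theorem scls_eq_zero_iff {n : ℕ} {c : SCyc X n} :
    scls X n c = 0 ↔ ∃ w, sbd X (n + 1) w = c := by
  constructor
  · intro h
    let R := (bdCyc (TopCat.toSSet.obj (TopCat.of X)) n).range
    have key := descH_cls (TopCat.toSSet.obj (TopCat.of X)) n (QuotientAddGroup.mk' R)
      (fun w => (QuotientAddGroup.eq_zero_iff _).2 ⟨w, rfl⟩) c
    have h0 : cls (TopCat.toSSet.obj (TopCat.of X)) n c = 0 := h
    rw [h0, map_zero] at key
    obtain ⟨w, hw⟩ := (QuotientAddGroup.eq_zero_iff c).1 key.symm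
    exact ⟨w, congrArg Subtype.val hw⟩
  · rintro ⟨w, hw⟩
    rw [show c = bdCyc _ n w from Subtype.ext hw.symm]
    exact cls_bd _ n w

theorem singMap_comp {n : ℕ} (g : C(Y, Z)) (f : C(X, Y)) (x : singH n X) :
    singMap n g (singMap n f x) = singMap n (g.comp f) x := by
  have := ((AlgebraicTopology.singularHomologyFunctor AddCommGrpCat.{0} n).obj
    (AddCommGrpCat.of ℤ)).map_comp (TopCat.ofHom f) (TopCat.ofHom g)
  exact (congrArg (fun k => k.hom x) this).symm

theorem singMap_id {n : ℕ} (x : singH n X) : singMap n (ContinuousMap.id X) x = x := by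
  have := ((AlgebraicTopology.singularHomologyFunctor AddCommGrpCat.{0} n).obj
    (AddCommGrpCat.of ℤ)).map_id (TopCat.of X)
  exact (congrArg (fun k => k.hom x) this)

theorem singMap_homotopic {n : ℕ} {f g : C(X, Y)} (h : f.Homotopic g) :
    singMap n f = singMap n g := by
  obtain ⟨H⟩ := h
  exact congrArg AddCommGrpCat.Hom.hom (TopCat.Homotopy.congr_homologyMap_singularChainComplexFunctor
    (f := TopCat.ofHom f) (g := TopCat.ofHom g) H (AddCommGrpCat.of ℤ) n)

theorem scls_surjective (n : ℕ) : Function.Surjective (scls X n) := cls_surjective _ n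

theorem singH_eq_zero_of_subsingleton [Subsingleton X] {n : ℕ} (x : singH (n + 1) X) : x = 0 := by
  have h := AlgebraicTopology.isZero_singularHomologyFunctor_of_totallyDisconnectedSpace
    AddCommGrpCat.{0} (n + 1) (AddCommGrpCat.of ℤ) (TopCat.of X) (Nat.succ_ne_zero n)
  exact congrArg (fun k => k.hom x) (h.eq_of_src (𝟙 _) 0)

theorem singMap_const {n : ℕ} (y : Y) (x : singH (n + 1) X) :
    singMap (n + 1) (ContinuousMap.const X y) x = 0 := by
  have : ContinuousMap.const X y = (ContinuousMap.const Unit y).comp (ContinuousMap.const X ()) :=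
    rfl
  rw [this, ← singMap_comp, singH_eq_zero_of_subsingleton (singMap _ _ x), map_zero]

theorem singH_eq_zero_of_contractible [ContractibleSpace X] {n : ℕ} (x : singH (n + 1) X) :
    x = 0 := by
  obtain ⟨y, hy⟩ := id_nullhomotopic X
  rw [← singMap_id x, singMap_homotopic hy, singMap_const]

/-- Cycles of positive degree in a contractible space are boundaries. -/
theorem exists_sbd_eq [ContractibleSpace X] {n : ℕ} {c : SChain X (n + 1)}
    (hc : sbd X n c = 0) : ∃ w, sbd X (n + 1) w = c :=
  scls_eq_zero_iff.1 (singH_eq_zero_of_contractible (scls X n ⟨c, hc⟩))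

/-- Homotopic maps send cycles to homologous cycles. -/
theorem exists_sbd_eq_push_sub {n : ℕ} {f g : C(X, Y)} (h : f.Homotopic g)
    {c : SChain X (n + 1)} (hc : sbd X n c = 0) :
    ∃ w, sbd Y (n + 1) w = push (n + 1) f c - push (n + 1) g c := by
  have := DFunLike.congr_fun (singMap_homotopic (n := n + 1) h) (scls X n ⟨c, hc⟩)
  rw [singMap_scls, singMap_scls, ← sub_eq_zero, ← map_sub] at this
  exact scls_eq_zero_iff.1 this

end SingChain

/-! ### Cross products and the class of a torus in a product -/

namespace SingChain

variable {X Y Z X' Y' : Type} [TopologicalSpace X] [TopologicalSpace Y] [TopologicalSpace Z]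
  [TopologicalSpace X'] [TopologicalSpace Y']

/-- The cross product of singular `1`-chains. -/
def scross (X Y : Type) [TopologicalSpace X] [TopologicalSpace Y] :
    SChain X 1 →+ SChain Y 1 →+ SChain (X × Y) 2 :=
  slift fun σ => slift fun τ =>
    sgl ((σ.comp (degen 1)).prodMk (τ.comp (degen 0))) -
      sgl ((σ.comp (degen 0)).prodMk (τ.comp (degen 1)))

theorem scross_sgl (σ : C(Spx 1, X)) (τ : C(Spx 1, Y)) :
    scross X Y (sgl σ) (sgl τ) =
      sgl ((σ.comp (degen 1)).prodMk (τ.comp (degen 0))) -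
      sgl ((σ.comp (degen 0)).prodMk (τ.comp (degen 1))) := by
  simp [scross]

theorem chainMap_singProd (a : SChain X 1) (b : SChain Y 1) :
    chainMap (singProd X Y) 2 (cross11 _ _ a b) = scross X Y a b := by
  have : (cross11 (TopCat.toSSet.obj (TopCat.of X)) (TopCat.toSSet.obj (TopCat.of Y))).compr₂
      (chainMap (singProd X Y) 2) = scross X Y :=
    schain_ext fun σ => schain_ext fun τ => by
      rw [scross_sgl, AddMonoidHom.compr₂_apply, cross11, sgl, sgl, chainLift_single,
        chainLift_single, map_sub, chainMap_single, chainMap_single]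
      rfl
  exact DFunLike.congr_fun (DFunLike.congr_fun this a) b

theorem sbd_scross (a : SCyc X 0) (b : SCyc Y 0) : sbd (X × Y) 1 (scross X Y a b) = 0 := by
  have h : ((crossCyc _ _ a b : Cyc _ 1) : Chain _ 2) = cross11 _ _ a.1 b.1 := rfl
  have h0 : bd _ 1 (cross11 _ _ a.1 b.1) = 0 := (crossCyc _ _ a b).2
  have h1 : ∀ w, bd _ 1 (chainMap (singProd X Y) 2 w) = chainMap (singProd X Y) 1 (bd _ 1 w) :=
    fun w => congrArg (fun k => k.hom w)
      ((SSet.chainComplexMap (singProd X Y) ZZ).comm 2 1)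
  rw [← chainMap_singProd]
  exact (h1 _).trans ((congrArg _ h0).trans (map_zero _))

theorem homCross_scls (a : SCyc X 0) (b : SCyc Y 0) :
    homCross (scls X 0 a) (scls Y 0 b) =
      scls (X × Y) 1 ⟨scross X Y a b, sbd_scross a b⟩ := by
  have h := crossH_cls a b
  refine (congrArg (SSet.homologyMap (singProd X Y) (AddCommGrpCat.of ℤ) 2).hom h).trans ?_
  exact homologyMap_cls (singProd X Y) _ _ (chainMap_singProd a.1 b.1)

theorem push_scross (f : C(X, X')) (g : C(Y, Y')) (a : SChain X 1) (b : SChain Y 1) :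
    push 2 (f.prodMap g) (scross X Y a b) = scross X' Y' (push 1 f a) (push 1 g b) := by
  have : (scross X Y).compr₂ (push 2 (f.prodMap g)) =
      ((scross X' Y').comp (push 1 f)).compl₂ (push 1 g) :=
    schain_ext fun σ => schain_ext fun τ => by
      simp only [AddMonoidHom.compr₂_apply, AddMonoidHom.compl₂_apply, AddMonoidHom.comp_apply,
        push_sgl, scross_sgl, map_sub]
      rfl
  exact DFunLike.congr_fun (DFunLike.congr_fun this a) b

theorem singMap_homCross (f : C(X, X')) (g : C(Y, Y')) (u : singH 1 X) (v : singH 1 Y) :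
    singMap 2 (f.prodMap g) (homCross u v) = homCross (singMap 1 f u) (singMap 1 g v) := by
  obtain ⟨a, rfl⟩ := scls_surjective 0 u
  obtain ⟨b, rfl⟩ := scls_surjective 0 v
  rw [singMap_scls, singMap_scls, homCross_scls, homCross_scls, singMap_scls]
  exact congrArg _ (Subtype.ext (push_scross f g a b))

/-- The loop that runs once around the circle, as a map from the standard `1`-simplex. -/
def circ : C(Spx 1, UnitAddCircle) := unsmp circleSimplex

theorem circ_apply (x : Spx 1) : circ x = ((x 1 : ℝ) : UnitAddCircle) := rfl

theorem circ_cyc : sbd UnitAddCircle 0 (sgl circ) = 0 := circleSimplex_mem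

theorem circleClass_eq : circleClass = scls UnitAddCircle 0 ⟨sgl circ, circ_cyc⟩ := rfl

theorem torus_cyc : sbd Torus 1 (scross _ _ (sgl circ) (sgl circ)) = 0 :=
  sbd_scross ⟨sgl circ, circ_cyc⟩ ⟨sgl circ, circ_cyc⟩

theorem torusClass_eq :
    torusClass = scls Torus 1 ⟨scross _ _ (sgl circ) (sgl circ), torus_cyc⟩ := by
  rw [torusClass, circleClass_eq, homCross_scls]

/-- Swapping the factors exchanges the two triangles of the square, which carry opposite signs. -/
theorem singMap_swap_torusClass :
    singMap 2 (ContinuousMap.prodSwap : C(Torus, Torus)) torusClass = -torusClass := by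
  rw [torusClass_eq, singMap_scls, ← map_neg]
  refine congrArg _ (Subtype.ext ?_)
  change push 2 _ (scross _ _ (sgl circ) (sgl circ)) = -scross _ _ (sgl circ) (sgl circ)
  rw [scross_sgl, map_sub, push_sgl, push_sgl, neg_sub]
  rfl

/-- The class of a loop `S¹ → X`. -/
def loopClass (γ : C(UnitAddCircle, X)) : singH 1 X := singMap 1 γ circleClass

theorem face_vertex {n : ℕ} (i : Fin (n + 2)) (j : Fin (n + 1)) :
    face i (stdSimplex.vertex j) = stdSimplex.vertex (S := ℝ) (i.succAbove j) :=
  stdSimplex.map_vertex _ _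

/-- Every point of the standard `0`-simplex is its vertex. -/
theorem spx0_eq (x : Spx 0) : x = stdSimplex.vertex 0 := Subsingleton.elim _ _

theorem vertex_self {n : ℕ} (i : Fin (n + 1)) : (stdSimplex.vertex i : Spx n) i = 1 := by
  simp [stdSimplex.vertex_coe]

theorem vertex_of_ne {n : ℕ} {i j : Fin (n + 1)} (h : j ≠ i) :
    (stdSimplex.vertex i : Spx n) j = 0 := by
  simp [stdSimplex.vertex_coe, h]

theorem circ_vertex (i : Fin 2) : circ (stdSimplex.vertex i) = 0 := by
  rw [circ_apply]
  fin_cases i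
  · exact (congrArg _ (vertex_of_ne (by decide))).trans rfl
  · exact (congrArg _ (vertex_self 1)).trans (AddCircle.coe_period 1)

theorem circ_const_face (i : Fin 2) : circ.comp (face i) = ContinuousMap.const _ 0 := by
  ext x
  rw [ContinuousMap.comp_apply, spx0_eq x, face_vertex, circ_vertex]
  rfl

/-- One triangle of the square suffices: its face 1 is the diagonal, and its faces 2 and 0 are the
first and the second axis. -/
theorem loopClass_diag :
    loopClass ((ContinuousMap.id UnitAddCircle).prodMk (ContinuousMap.id UnitAddCircle)) =
      loopClass ((ContinuousMap.id UnitAddCircle).prodMk (ContinuousMap.const _ 0)) +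
      loopClass ((ContinuousMap.const UnitAddCircle 0).prodMk (ContinuousMap.id UnitAddCircle)) := by
  simp only [loopClass, circleClass_eq, singMap_scls]
  rw [← sub_eq_zero, ← map_add, ← map_sub, ← neg_eq_zero, ← map_neg]
  refine scls_eq_zero_iff.2
    ⟨sgl ((circ.comp (degen 1)).prodMk (circ.comp (degen 0))), ?_⟩
  rw [sbd1]
  have e0 := congrArg unsmp (f2_01 (smp circ))
  have e1 := congrArg unsmp (f2_11 (smp circ))
  have e2 := congrArg unsmp (f2_21 (smp circ))
  have d0 := congrArg unsmp (f2_00 (smp circ))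
  have d1 := congrArg unsmp (f2_10 (smp circ))
  have d2 := congrArg unsmp (f2_20 (smp circ))
  simp only [sg_smp, dl_smp, unsmp_smp, circ_const_face] at e0 e1 e2 d0 d1 d2
  change sgl (((circ.comp (degen 1)).comp (face 0)).prodMk ((circ.comp (degen 0)).comp (face 0))) -
    sgl (((circ.comp (degen 1)).comp (face 1)).prodMk ((circ.comp (degen 0)).comp (face 1))) +
    sgl (((circ.comp (degen 1)).comp (face 2)).prodMk ((circ.comp (degen 0)).comp (face 2))) = 
    -(push 1 _ (sgl circ) - (push 1 _ (sgl circ) + push 1 _ (sgl circ)))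
  simp only [e0, e1, e2, d0, d1, d2, push_sgl]
  rw [neg_sub, sub_add_eq_add_sub, add_comm]
  rfl

/-- The map on the left is `Φ` after the product of two diagonal loops. Hence its class is the image
under `Φ` of a cross product, which expands by `loopClass_diag` in each factor. -/
theorem singMap_prodMap_diag {M : Type} [TopologicalSpace M]
    (Φ : C((UnitAddCircle × UnitAddCircle) × (UnitAddCircle × UnitAddCircle), M)) :
    singMap 2 ⟨fun x : Torus => Φ ((x.1, x.1), (x.2, x.2)), by fun_prop⟩ torusClass =
      (singMap 2 ⟨fun x : Torus => Φ ((x.1, 0), (x.2, 0)), by fun_prop⟩ torusClass +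
      singMap 2 ⟨fun x : Torus => Φ ((x.1, 0), (0, x.2)), by fun_prop⟩ torusClass) +
      (singMap 2 ⟨fun x : Torus => Φ ((0, x.1), (x.2, 0)), by fun_prop⟩ torusClass +
      singMap 2 ⟨fun x : Torus => Φ ((0, x.1), (0, x.2)), by fun_prop⟩ torusClass) := by
  have key (i j : C(UnitAddCircle, UnitAddCircle × UnitAddCircle)) :
      singMap 2 (Φ.comp (i.prodMap j)) torusClass =
        singMap 2 Φ (homCross (loopClass i) (loopClass j)) := by
    rw [loopClass, loopClass, ← singMap_homCross, singMap_comp]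
    rfl
  refine (key (.prodMk (.id _) (.id _)) (.prodMk (.id _) (.id _))).trans ?_
  rw [loopClass_diag]
  simp only [map_add, AddMonoidHom.add_apply, ← key]
  rw [add_add_add_comm]
  rfl

/-- The image of `[T²]` under a map to a product of two spaces. -/
theorem singMap_prodMk_torusClass (f : C(Torus, X)) (h : C(Torus, Y)) :
    singMap 2 (f.prodMk h) torusClass =
      (singMap 2 (f.prodMk (.const _ (h 0))) torusClass +
        homCross (loopClass (f.comp ⟨fun s => (s, 0), by fun_prop⟩))
          (loopClass (h.comp ⟨fun s => (0, s), by fun_prop⟩))) +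
      (-homCross (loopClass (f.comp ⟨fun s => (0, s), by fun_prop⟩))
          (loopClass (h.comp ⟨fun s => (s, 0), by fun_prop⟩)) +
        singMap 2 (.prodMk (.const _ (f 0)) h) torusClass) := by
  -- The doubled coordinates are distributed so that `f` sees the first copies and `h` the second
  -- ones. In the third of the four terms `f` depends on the second coordinate and `h` on the first,
  -- so the coordinates must be swapped, which produces the minus sign.
  refine (singMap_prodMap_diag ⟨fun x => (f (x.1.1, x.2.1), h (x.1.2, x.2.2)),
    by fun_prop⟩).trans ?_
  congr 2
  · rw [loopClass, loopClass, ← singMap_homCross]; rfl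
  · rw [loopClass, loopClass, ← singMap_homCross, ← map_neg]
    change _ = singMap 2 _ (-torusClass)
    rw [← singMap_swap_torusClass, singMap_comp]
    rfl

end SingChain

/-! ### Winding numbers and their cup products -/

namespace SingChain

variable {X Y Z : Type} [TopologicalSpace X] [TopologicalSpace Y] [TopologicalSpace Z]

instance spx_contractible (n : ℕ) : ContractibleSpace (Spx n) :=
  (convex_stdSimplex ℝ (Fin (n + 1))).contractibleSpace ⟨_, (stdSimplex.vertex 0 : Spx n).2⟩

instance spx_locallyPathConnected (n : ℕ) : LocallyPathConnectedSpace (Spx n) :=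
  (convex_stdSimplex ℝ (Fin (n + 1))).locallyPathConnectedSpace

/-- The projection of the line to the circle. -/
def lineProj : C(ℝ, UnitAddCircle) := ⟨fun x => (x : UnitAddCircle), AddCircle.continuous_mk' 1⟩

@[simp] theorem lineProj_apply (x : ℝ) : lineProj x = (x : UnitAddCircle) := rfl

/-- The translation of the line by an integer. -/
def lineShift (k : ℤ) : C(ℝ, ℝ) := ⟨fun x => x + k, by fun_prop⟩

@[simp] theorem lineShift_apply (k : ℤ) (x : ℝ) : lineShift k x = x + k := rfl

theorem coe_eq_coe_iff (x y : ℝ) : (x : UnitAddCircle) = y ↔ ∃ k : ℤ, x = y + k := by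
  rw [← sub_eq_zero, ← AddCircle.coe_sub, AddCircle.coe_eq_zero_iff]
  refine exists_congr fun k => ?_
  rw [zsmul_eq_mul, mul_one, eq_sub_iff_add_eq, add_comm, eq_comm]

theorem lineProj_lineShift (k : ℤ) : lineProj.comp (lineShift k) = lineProj := by
  ext x
  exact (coe_eq_coe_iff _ _).2 ⟨k, rfl⟩

theorem exists_lift {n : ℕ} (f : C(Spx n, UnitAddCircle)) : ∃ F : C(Spx n, ℝ),
    lineProj.comp F = f := by
  obtain ⟨e, he⟩ := QuotientAddGroup.mk_surjective (f (stdSimplex.vertex 0))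
  obtain ⟨F, hF, -⟩ := (AddCircle.isCoveringMap_coe (1 : ℝ)).existsUnique_continuousMap_lifts f
    (stdSimplex.vertex 0) e he
  exact ⟨F, ContinuousMap.ext fun x => congrFun hF.2 x⟩

theorem lift_unique {n : ℕ} {F G : C(Spx n, ℝ)} (h : lineProj.comp F = lineProj.comp G) :
    ∃ k : ℤ, F = (lineShift k).comp G := by
  have h0 := DFunLike.congr_fun h (stdSimplex.vertex 0)
  obtain ⟨k, hk⟩ := (coe_eq_coe_iff _ _).1 h0
  refine ⟨k, ?_⟩
  obtain ⟨F', -, hF'⟩ := (AddCircle.isCoveringMap_coe (1 : ℝ)).existsUnique_continuousMap_lifts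
    (lineProj.comp F) (stdSimplex.vertex 0) (F (stdSimplex.vertex 0)) rfl
  rw [hF' F ⟨rfl, rfl⟩, hF' ((lineShift k).comp G) ⟨hk.symm, ?_⟩]
  rw [h, ← lineProj_lineShift k]
  rfl

/-- A lift to the line of a singular simplex of the circle. -/
def liftR {n : ℕ} (f : C(Spx n, UnitAddCircle)) : C(Spx n, ℝ) := (exists_lift f).choose

@[simp] theorem lineProj_liftR {n : ℕ} (f : C(Spx n, UnitAddCircle)) :
    lineProj.comp (liftR f) = f := (exists_lift f).choose_spec

/-! ### The winding cocycle -/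

/-- The winding cocycle of a map to the circle. -/
def wind (θ : C(X, UnitAddCircle)) : SChain X 1 →+ ℝ :=
  slift fun σ => liftR (θ.comp σ) (stdSimplex.vertex 1) - liftR (θ.comp σ) (stdSimplex.vertex 0)

/-- Two lifts differ by an integer, which cancels in the difference of the end values. -/
theorem wind_sgl (θ : C(X, UnitAddCircle)) {σ : C(Spx 1, X)} {F : C(Spx 1, ℝ)}
    (h : lineProj.comp F = θ.comp σ) :
    wind θ (sgl σ) = F (stdSimplex.vertex 1) - F (stdSimplex.vertex 0) := by
  obtain ⟨k, hk⟩ := lift_unique ((lineProj_liftR (θ.comp σ)).trans h.symm)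
  rw [wind, slift_sgl, hk]
  simp

theorem wind_push (θ : C(Y, UnitAddCircle)) (f : C(X, Y)) (c : SChain X 1) :
    wind θ (push 1 f c) = wind (θ.comp f) c := by
  have : (wind θ).comp (push 1 f) = wind (θ.comp f) := schain_ext fun σ => by
    simp [wind, ContinuousMap.comp_assoc]
  exact DFunLike.congr_fun this c

theorem wind_face (θ : C(X, UnitAddCircle)) {n : ℕ} {σ : C(Spx n, X)} {F : C(Spx n, ℝ)}
    (h : lineProj.comp F = θ.comp σ) (p : C(Spx 1, Spx n)) :
    wind θ (sgl (σ.comp p)) = F (p (stdSimplex.vertex 1)) - F (p (stdSimplex.vertex 0)) :=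
  wind_sgl θ (F := F.comp p) (by
    rw [← ContinuousMap.comp_assoc, h, ContinuousMap.comp_assoc])

theorem wind_sbd (θ : C(X, UnitAddCircle)) (w : SChain X 2) : wind θ (sbd X 1 w) = 0 := by
  have : (wind θ).comp (sbd X 1) = 0 := schain_ext fun σ => by
    have h := lineProj_liftR (θ.comp σ)
    simp only [AddMonoidHom.comp_apply, sbd1, map_add, map_sub, wind_face θ h, face_vertex]
    simp [Fin.succAbove]
  exact DFunLike.congr_fun this w

/-- The winding number, on homology. -/
def windH (θ : C(X, UnitAddCircle)) : singH 1 X →+ ℝ :=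
  descH (TopCat.toSSet.obj (TopCat.of X)) 0 ((wind θ).comp (SCyc X 0).subtype) (wind_sbd θ)

theorem windH_scls (θ : C(X, UnitAddCircle)) (c : SCyc X 0) : windH θ (scls X 0 c) = wind θ c :=
  descH_cls ..

theorem windH_singMap (θ : C(Y, UnitAddCircle)) (f : C(X, Y)) (x : singH 1 X) :
    windH θ (singMap 1 f x) = windH (θ.comp f) x := by
  obtain ⟨c, rfl⟩ := scls_surjective 0 x
  rw [singMap_scls, windH_scls, windH_scls, coe_pushCyc, wind_push]

/-- The cup product of two winding cocycles. -/
def cup (θ ζ : C(X, UnitAddCircle)) : SChain X 2 →+ ℝ :=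
  slift fun σ => wind θ (sgl (σ.comp (face 2))) * wind ζ (sgl (σ.comp (face 0)))

theorem cup_push (θ ζ : C(Y, UnitAddCircle)) (f : C(X, Y)) (c : SChain X 2) :
    cup θ ζ (push 2 f c) = cup (θ.comp f) (ζ.comp f) c := by
  have : (cup θ ζ).comp (push 2 f) = cup (θ.comp f) (ζ.comp f) := schain_ext fun σ => by
    simp only [AddMonoidHom.comp_apply, push_sgl, cup, slift_sgl, ← wind_push,
      ContinuousMap.comp_assoc]
  exact DFunLike.congr_fun this c

/-- On one tetrahedron all windings are increments of a single lift of each map, so this is the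
cocycle identity for a cup product of two coboundaries. -/
theorem cup_sbd (θ ζ : C(X, UnitAddCircle)) (w : SChain X 3) : cup θ ζ (sbd X 2 w) = 0 := by
  have : (cup θ ζ).comp (sbd X 2) = 0 := schain_ext fun σ => by
    have h := lineProj_liftR (θ.comp σ)
    have h' := lineProj_liftR (ζ.comp σ)
    simp only [AddMonoidHom.comp_apply, sbd2, map_add, map_sub, cup, slift_sgl,
      ContinuousMap.comp_assoc, wind_face θ h, wind_face ζ h', ContinuousMap.comp_apply,
      face_vertex]
    simp [Fin.succAbove]
    ring
  exact DFunLike.congr_fun this w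

/-- The cup product of two winding cocycles, on homology. -/
def cupH (θ ζ : C(X, UnitAddCircle)) : singH 2 X →+ ℝ :=
  descH (TopCat.toSSet.obj (TopCat.of X)) 1 ((cup θ ζ).comp (SCyc X 1).subtype) (cup_sbd θ ζ)

theorem cupH_scls (θ ζ : C(X, UnitAddCircle)) (c : SCyc X 1) :
    cupH θ ζ (scls X 1 c) = cup θ ζ c := descH_cls ..

theorem cupH_singMap (θ ζ : C(Y, UnitAddCircle)) (f : C(X, Y)) (x : singH 2 X) :
    cupH θ ζ (singMap 2 f x) = cupH (θ.comp f) (ζ.comp f) x := by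
  obtain ⟨c, rfl⟩ := scls_surjective 1 x
  rw [singMap_scls, cupH_scls, cupH_scls, coe_pushCyc, cup_push]

/-- For functions that lift to the line, the cup product is determined by the boundary. -/
theorem cup_of_lift (A B : C(X, ℝ)) (w : SChain X 2) :
    cup (lineProj.comp A) (lineProj.comp B) w =
      slift (fun σ : C(Spx 1, X) => A (σ (stdSimplex.vertex 0)) *
        (B (σ (stdSimplex.vertex 1)) - B (σ (stdSimplex.vertex 0)))) (sbd X 1 w) := by
  refine DFunLike.congr_fun (schain_ext (f := cup (lineProj.comp A) (lineProj.comp B))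
    (g := (slift (fun σ : C(Spx 1, X) => A (σ (stdSimplex.vertex 0)) *
        (B (σ (stdSimplex.vertex 1)) - B (σ (stdSimplex.vertex 0))))).comp (sbd X 1))
    fun σ => ?_) w
  have h : lineProj.comp (A.comp σ) = (lineProj.comp A).comp σ := rfl
  have h' : lineProj.comp (B.comp σ) = (lineProj.comp B).comp σ := rfl
  -- With `aᵢ`, `bᵢ` the values at the vertices, `(a₁ - a₀)(b₂ - b₁) = a₁(b₂ - b₁) - a₀(b₂ - b₀) +
  -- a₀(b₁ - b₀)`: that is, `δA ∪ δB` is the coboundary of `A ∪ δB`.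
  simp only [AddMonoidHom.comp_apply, sbd1, map_add, map_sub, cup, slift_sgl,
      wind_face _ h, wind_face _ h', ContinuousMap.comp_apply, face_vertex]
  simp [Fin.succAbove]
  ring

/-- In the positive triangle of the square the front edge runs along the first circle and the back
edge along the second; in the negative triangle the roles are exchanged. -/
theorem cupH_torusClass (θ ζ : C(Torus, UnitAddCircle)) :
    cupH θ ζ torusClass =
      windH (θ.comp ⟨fun s => (s, 0), by fun_prop⟩) circleClass *
        windH (ζ.comp ⟨fun s => (0, s), by fun_prop⟩) circleClass -
      windH (θ.comp ⟨fun s => (0, s), by fun_prop⟩) circleClass *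
        windH (ζ.comp ⟨fun s => (s, 0), by fun_prop⟩) circleClass := by
  simp only [circleClass_eq, torusClass_eq, windH_scls, cupH_scls]
  have e0 := congrArg unsmp (f2_01 (smp circ))
  have e2 := congrArg unsmp (f2_21 (smp circ))
  have d0 := congrArg unsmp (f2_00 (smp circ))
  have d2 := congrArg unsmp (f2_20 (smp circ))
  simp only [sg_smp, dl_smp, unsmp_smp, circ_const_face] at e0 e2 d0 d2
  rw [scross_sgl, map_sub, cup, slift_sgl, slift_sgl, ← wind_push, ← wind_push, ← wind_push,
    ← wind_push]
  change wind θ (sgl (((circ.comp (degen 1)).comp (face 2)).prodMk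
      ((circ.comp (degen 0)).comp (face 2)))) *
    wind ζ (sgl (((circ.comp (degen 1)).comp (face 0)).prodMk
      ((circ.comp (degen 0)).comp (face 0)))) -
    wind θ (sgl (((circ.comp (degen 0)).comp (face 2)).prodMk
      ((circ.comp (degen 1)).comp (face 2)))) *
    wind ζ (sgl (((circ.comp (degen 0)).comp (face 0)).prodMk
      ((circ.comp (degen 1)).comp (face 0)))) = _
  simp only [e0, e2, d0, d2, push_sgl]
  rfl

theorem windH_circleClass : windH (.id _) circleClass = 1 := by
  rw [circleClass_eq, windH_scls]
  refine (wind_sgl (.id _) (F := ⟨fun x => x 1, (continuous_apply 1).comp continuous_subtype_val⟩) ?_).trans ?_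
  · rfl
  · change (stdSimplex.vertex 1 : Spx 1) 1 - (stdSimplex.vertex 0 : Spx 1) 1 = (1 : ℝ)
    rw [vertex_self, vertex_of_ne (by decide), sub_zero]

end SingChain

/-! ### Augmentation, coefficients of chains, and the homology of the circle -/

namespace SingChain

variable {X Y Z : Type} [TopologicalSpace X] [TopologicalSpace Y] [TopologicalSpace Z]

/-- The augmentation of `0`-chains. -/
def aug : SChain X 0 →+ ℤ := slift fun _ => 1

@[simp] theorem aug_sgl (σ : C(Spx 0, X)) : aug (sgl σ) = 1 := slift_sgl _ _

theorem aug_sbd (w : SChain X 1) : aug (sbd X 0 w) = 0 := by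
  have : aug.comp (sbd X 0) = 0 := schain_ext fun σ => by
    simp [sbd0]
  exact DFunLike.congr_fun this w

theorem aug_push (f : C(X, Y)) (c : SChain X 0) : aug (push 0 f c) = aug c := by
  have : aug.comp (push 0 f) = aug := schain_ext fun σ => by simp
  exact DFunLike.congr_fun this c

/-- The singular `0`-simplex given by a point. -/
def pt (x : X) : C(Spx 0, X) := .const _ x

theorem eq_pt (σ : C(Spx 0, X)) : σ = pt (σ (stdSimplex.vertex 0)) := by
  ext x
  rw [spx0_eq x]
  rfl

theorem comp_face_eq_pt (σ : C(Spx 1, X)) (i : Fin 2) :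
    σ.comp (face i) = pt (σ (stdSimplex.vertex (i.succAbove 0))) := by
  rw [eq_pt (σ.comp (face i)), ContinuousMap.comp_apply, face_vertex]

theorem sbd0_pt (σ : C(Spx 1, X)) :
    sbd X 0 (sgl σ) = sgl (pt (σ (stdSimplex.vertex 1))) -
      sgl (pt (σ (stdSimplex.vertex 0))) := by
  rw [sbd0, comp_face_eq_pt, comp_face_eq_pt]
  rfl

/-- The singular `1`-simplex given by a path. -/
def pathSpx {x y : X} (γ : Path x y) : C(Spx 1, X) :=
  ⟨fun t => γ ⟨t 1, t.2.1 1, stdSimplex.le_one t 1⟩,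
    γ.continuous.comp (((continuous_apply 1).comp continuous_subtype_val).subtype_mk _)⟩

theorem sbd_pathSpx {x y : X} (γ : Path x y) :
    sbd X 0 (sgl (pathSpx γ)) = sgl (pt y) - sgl (pt x) := by
  rw [sbd0_pt]
  congr 3
  · exact (congrArg γ (Subtype.ext (vertex_self (n := 1) 1))).trans γ.target
  · exact (congrArg γ (Subtype.ext (vertex_of_ne (n := 1) (i := 0) (j := 1) (by decide)))).trans
      γ.source

theorem exists_sbd_eq_sub_aug [PathConnectedSpace X] (x : X) (c : SChain X 0) :
    ∃ w, sbd X 0 w = c - aug c • sgl (pt x) := by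
  refine ⟨slift (fun σ => sgl (pathSpx (PathConnectedSpace.somePath x
    (σ (stdSimplex.vertex 0))))) c, ?_⟩
  have : (sbd X 0).comp (slift (fun σ : C(Spx 0, X) => sgl (pathSpx (PathConnectedSpace.somePath x
    (σ (stdSimplex.vertex 0)))))) =
      AddMonoidHom.id _ - ((zmultiplesHom _ (sgl (pt x))).comp aug) := schain_ext fun σ => by
    simp only [AddMonoidHom.comp_apply, slift_sgl, sbd_pathSpx, AddMonoidHom.sub_apply, aug_sgl,
      AddMonoidHom.id_apply, ← eq_pt, zmultiplesHom_apply, one_smul]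
  exact DFunLike.congr_fun this c

/-- A `0`-chain of augmentation zero in a path connected space is a boundary. -/
theorem exists_sbd_eq_of_aug [PathConnectedSpace X] {c : SChain X 0} (h : aug c = 0) :
    ∃ w, sbd X 0 w = c := by
  obtain ⟨x⟩ := (inferInstance : Nonempty X)
  obtain ⟨w, hw⟩ := exists_sbd_eq_sub_aug x c
  exact ⟨w, by rw [hw, h, zero_smul, sub_zero]⟩

/-! ### Coefficients of chains -/

/-- A chain as a finitely supported function on simplices. -/
def toF {n : ℕ} : SChain X n →+ (C(Spx n, X) →₀ ℤ) := slift fun σ => Finsupp.single σ 1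

@[simp] theorem toF_sgl {n : ℕ} (σ : C(Spx n, X)) : toF (sgl σ) = Finsupp.single σ 1 :=
  slift_sgl _ _

theorem toF_injective {n : ℕ} : Function.Injective (toF : SChain X n →+ _) := by
  have : (Finsupp.liftAddHom (fun σ : C(Spx n, X) => zmultiplesHom _ (sgl σ))).comp toF =
      AddMonoidHom.id _ := schain_ext fun σ => by simp
  intro a b h
  have ha := DFunLike.congr_fun this a
  rw [AddMonoidHom.comp_apply, h] at ha
  exact ha.symm.trans (DFunLike.congr_fun this b)

theorem toF_push {n : ℕ} (f : C(X, Y)) (c : SChain X n) :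
    toF (push n f c) = Finsupp.mapDomain f.comp (toF c) := by
  have : toF.comp (push n f) = (Finsupp.mapDomain.addMonoidHom f.comp).comp toF :=
    schain_ext fun σ => by simp [Finsupp.mapDomain.addMonoidHom]
  exact DFunLike.congr_fun this c

/-! ### Homology of the circle -/

theorem lineShift_comp (k l : ℤ) : (lineShift k).comp (lineShift l) = lineShift (k + l) := by
  ext x
  simp [add_comm, add_left_comm]

/-- Integer translations move every simplex to infinitely many others, so a nonzero invariant chain
would have infinite support. -/
theorem eq_zero_of_push_lineShift {n : ℕ} {b : SChain ℝ n} (h : push n (lineShift 1) b = b) :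
    b = 0 := by
  have inj : Function.Injective
      ((lineShift 1).comp : C(Spx n, ℝ) → C(Spx n, ℝ)) := fun σ τ e => by
    ext x
    simpa using DFunLike.congr_fun e x
  have step (σ : C(Spx n, ℝ)) : toF b ((lineShift 1).comp σ) = toF b σ := by
    conv_lhs => rw [← h, toF_push]
    exact Finsupp.mapDomain_apply inj _ _
  have steps (σ : C(Spx n, ℝ)) (k : ℕ) : toF b ((lineShift k).comp σ) = toF b σ := by
    induction k with
    | zero => congr 1; ext x; simp
    | succ k ih =>
      have : (lineShift (k + 1 : ℕ)).comp σ = (lineShift 1).comp ((lineShift k).comp σ) := by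
        ext x
        simp [add_assoc]
      rw [this, step, ih]
  refine toF_injective (Finsupp.ext fun σ => ?_)
  rw [map_zero, Finsupp.zero_apply]
  by_contra hne
  refine Set.infinite_of_injective_forall_mem (f := fun k : ℕ => (lineShift k).comp σ) ?_
    (fun k => Finsupp.mem_support_iff.2 ((steps σ k).trans_ne hne)) (toF b).support.finite_toSet
  intro k l e
  have := DFunLike.congr_fun e (stdSimplex.vertex 0)
  simpa using this

/-- A lift of chains from the circle to the line. -/
def liftChain (n : ℕ) : SChain UnitAddCircle n →+ SChain ℝ n := slift fun σ => sgl (liftR σ)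

theorem push_liftChain {n : ℕ} (c : SChain UnitAddCircle n) :
    push n lineProj (liftChain n c) = c := by
  have : (push n lineProj).comp (liftChain n) = AddMonoidHom.id _ := schain_ext fun σ => by
    simp [liftChain]
  exact DFunLike.congr_fun this c

/-- A translation by `k` is a telescoping composite of unit translations, upwards or downwards. -/
theorem exists_shift_sub_eq {n : ℕ} (σ : C(Spx n, ℝ)) (k : ℤ) :
    ∃ b, sgl ((lineShift k).comp σ) - sgl σ = push n (lineShift 1) b - b := by
  induction k using Int.induction_on with
  | zero => exact ⟨0, by rw [show (lineShift 0).comp σ = σ by ext x; simp]; simp⟩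
  | succ k ih =>
    obtain ⟨b, hb⟩ := ih
    refine ⟨b + sgl ((lineShift k).comp σ), ?_⟩
    rw [map_add, push_sgl, ← ContinuousMap.comp_assoc, lineShift_comp, add_comm (1 : ℤ)]
    rw [add_sub_add_comm, ← hb]
    abel
  | pred k ih =>
    obtain ⟨b, hb⟩ := ih
    refine ⟨b - sgl ((lineShift (-k - 1)).comp σ), ?_⟩
    rw [map_sub, push_sgl, ← ContinuousMap.comp_assoc, lineShift_comp, add_sub_cancel]
    rw [sub_sub_sub_comm, ← hb]
    abel

/-- Chains of the circle are the coinvariants of chains of the line under translation by `1`. With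
`eq_zero_of_push_lineShift` and `push_liftChain` this gives a short exact sequence `0 → C(ℝ) → C(ℝ)
→ C(S¹) → 0` whose first map is `T - 1`, where `T` is that translation. -/
theorem exists_eq_of_push_lineProj {n : ℕ} {x : SChain ℝ n} (h : push n lineProj x = 0) :
    ∃ b, x = push n (lineShift 1) b - b := by
  have key (x : SChain ℝ n) :
      ∃ b, x - liftChain n (push n lineProj x) = push n (lineShift 1) b - b := by
    induction x using schain_induction with
    | h0 => exact ⟨0, by simp⟩
    | hs σ =>
      rw [push_sgl, liftChain, slift_sgl]
      obtain ⟨k, hk⟩ := lift_unique (F := σ) (G := liftR (lineProj.comp σ))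
        (lineProj_liftR _).symm
      obtain ⟨b, hb⟩ := exists_shift_sub_eq (liftR (lineProj.comp σ)) k
      exact ⟨b, by rw [← hb, ← hk]⟩
    | ha x y hx hy =>
      obtain ⟨b, hb⟩ := hx
      obtain ⟨d, hd⟩ := hy
      exact ⟨b + d, by rw [map_add, map_add, add_sub_add_comm, hb, hd, map_add]; abel⟩
    | hn x hx =>
      obtain ⟨b, hb⟩ := hx
      exact ⟨-b, by rw [map_neg, map_neg, map_neg, ← neg_sub', hb]; abel⟩
  obtain ⟨b, hb⟩ := key x
  exact ⟨b, by rw [← hb, h, map_zero, sub_zero]⟩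

theorem push_shift_sub {n : ℕ} (a : SChain ℝ n) :
    push n lineProj (push n (lineShift 1) a - a) = 0 := by
  rw [map_sub, push_push, lineProj_lineShift, sub_self]

/-- This is the connecting map of the exact sequence. The boundary of a lift of `c` is `T b - b`,
and `b` is homologous to `aug b` times the origin. Hence that boundary is `aug b` times the boundary
of the segment from `0` to `1`, up to the boundary of `T a - a`, which projects to zero. The
remaining cycle of the line bounds. -/
theorem exists_circle_one {c : SChain UnitAddCircle 1} (hc : sbd _ 0 c = 0) :
    ∃ (m : ℤ) (w : _), sbd _ 1 w = c - m • sgl circ := by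
  obtain ⟨b, hb⟩ := exists_eq_of_push_lineProj (x := sbd ℝ 0 (liftChain 1 c))
    (by rw [← sbd_push, push_liftChain, hc])
  obtain ⟨a, ha⟩ := exists_sbd_eq_sub_aug (0 : ℝ) b
  let seg : C(Spx 1, ℝ) := ⟨fun x => x 1, (continuous_apply 1).comp continuous_subtype_val⟩
  have hseg : sbd ℝ 0 (sgl seg) = sgl (pt (1 : ℝ)) - sgl (pt (0 : ℝ)) := by
    rw [sbd0_pt]
    exact congrArg₂ (fun x y : ℝ => sgl (pt x) - sgl (pt y)) (vertex_self (n := 1) 1)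
      (vertex_of_ne (n := 1) (i := 0) (j := 1) (by decide))
  have hz : sbd ℝ 0 (liftChain 1 c - (push 1 (lineShift 1) a - a) - aug b • sgl seg) = 0 := by
    rw [map_sub, map_sub, map_sub, hb, map_zsmul, hseg, sbd_push, ha, map_sub, map_zsmul, push_sgl,
      show (lineShift 1).comp (pt (0 : ℝ)) = pt 1 by ext x; simp [pt], smul_sub]
    abel
  obtain ⟨w, hw⟩ := exists_sbd_eq hz
  refine ⟨aug b, push 2 lineProj w, ?_⟩
  rw [sbd_push, hw, map_sub, map_sub, push_shift_sub, push_liftChain, sub_zero, map_zsmul, push_sgl]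
  rfl

/-- The same chase, in a degree where `b` itself is a cycle because `T - 1` is injective; so `b`
bounds in the line and no segment is needed. -/
theorem exists_circle_two {n : ℕ} {c : SChain UnitAddCircle (n + 2)} (hc : sbd _ (n + 1) c = 0) :
    ∃ w, sbd _ (n + 2) w = c := by
  obtain ⟨b, hb⟩ := exists_eq_of_push_lineProj (x := sbd ℝ (n + 1) (liftChain (n + 2) c))
    (by rw [← sbd_push, push_liftChain, hc])
  have h0 : sbd ℝ n b = 0 := by
    refine eq_zero_of_push_lineShift ?_
    rw [← sub_eq_zero, ← sbd_push, ← map_sub, ← hb]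
    exact bd_bd _
  obtain ⟨a, ha⟩ := exists_sbd_eq h0
  have hz : sbd ℝ (n + 1) (liftChain (n + 2) c - (push (n + 2) (lineShift 1) a - a)) = 0 := by
    rw [map_sub, map_sub, hb, sbd_push, ha, sub_self]
  obtain ⟨w, hw⟩ := exists_sbd_eq hz
  refine ⟨push _ lineProj w, ?_⟩
  rw [sbd_push, hw, map_sub, push_shift_sub, push_liftChain, sub_zero]

theorem circle_homology_one (x : singH 1 UnitAddCircle) : ∃ m : ℤ, x = m • circleClass := by
  obtain ⟨c, rfl⟩ := scls_surjective 0 x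
  obtain ⟨m, w, hw⟩ := exists_circle_one c.2
  refine ⟨m, ?_⟩
  rw [circleClass_eq, ← map_zsmul, ← sub_eq_zero, ← map_sub]
  exact scls_eq_zero_iff.2 ⟨w, hw⟩

theorem circle_homology_two (x : singH 2 UnitAddCircle) : x = 0 := by
  obtain ⟨c, rfl⟩ := scls_surjective 1 x
  exact scls_eq_zero_iff.2 (exists_circle_two (n := 0) c.2)

theorem loopClass_circle (γ : C(UnitAddCircle, UnitAddCircle)) :
    ∃ m : ℤ, loopClass γ = m • circleClass := circle_homology_one _

/-- The image of `[T²]` under a self-map of the torus is a multiple of `[T²]`. -/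
theorem singMap_torus_torus (h : C(Torus, Torus)) :
    ∃ k : ℤ, singMap 2 h torusClass = k • torusClass := by
  obtain ⟨m, hm⟩ := loopClass_circle ((ContinuousMap.fst.comp h).comp ⟨fun s => (s, 0), by fun_prop⟩)
  obtain ⟨n, hn⟩ := loopClass_circle ((ContinuousMap.fst.comp h).comp ⟨fun s => (0, s), by fun_prop⟩)
  obtain ⟨p, hp⟩ := loopClass_circle ((ContinuousMap.snd.comp h).comp ⟨fun s => (s, 0), by fun_prop⟩)
  obtain ⟨q, hq⟩ := loopClass_circle ((ContinuousMap.snd.comp h).comp ⟨fun s => (0, s), by fun_prop⟩)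
  refine ⟨m * q - n * p, ?_⟩
  refine (singMap_prodMk_torusClass (ContinuousMap.fst.comp h) (ContinuousMap.snd.comp h)).trans ?_
  rw [hm, hn, hp, hq]
  -- With one component constant, the map factors through a circle, where `H₂` vanishes. Only the
  -- mixed terms remain; they form the determinant of the winding matrix.
  have e1 (y : UnitAddCircle) : singMap 2 ((ContinuousMap.fst.comp h).prodMk (.const _ y))
      torusClass = 0 := by
    have : (ContinuousMap.fst.comp h).prodMk (.const _ y) =
      ((ContinuousMap.id UnitAddCircle).prodMk (.const _ y)).comp (ContinuousMap.fst.comp h) := rfl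
    rw [this, ← singMap_comp, circle_homology_two (singMap 2 _ torusClass), map_zero]
  have e2 (y : UnitAddCircle) : singMap 2 (.prodMk (.const _ y) (ContinuousMap.snd.comp h))
      torusClass = 0 := by
    have : ContinuousMap.prodMk (.const _ y) (ContinuousMap.snd.comp h) =
      (ContinuousMap.prodMk (.const _ y) (ContinuousMap.id UnitAddCircle)).comp
        (ContinuousMap.snd.comp h) := rfl
    rw [this, ← singMap_comp, circle_homology_two (singMap 2 _ torusClass), map_zero]
  rw [e1, e2, zero_add, add_zero]
  simp only [map_zsmul, AddMonoidHom.smul_apply]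
  rw [← torusClass, sub_smul, mul_smul, mul_smul, ← sub_eq_add_neg]
  rw [smul_comm p n, smul_comm q m]

end SingChain

/-! ### Small chains and subdivision -/

namespace SingChain

variable {X Y Z : Type} [TopologicalSpace X] [TopologicalSpace Y] [TopologicalSpace Z]

/-- The chains all of whose simplices lie in a member of a family of subsets. -/
def smallChain (n : ℕ) {ι : Type} (U : ι → Set X) : AddSubgroup (SChain X n) :=
  AddSubgroup.closure {c | ∃ (σ : C(Spx n, X)) (i : ι), Set.range σ ⊆ U i ∧ c = sgl σ}

/-- The operator on chains that replaces a simplex by a combination of subsimplices. -/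
def subdiv {n : ℕ} {κ : Type} [Fintype κ] (a : κ → C(Spx n, Spx n)) (ε : κ → ℤ) :
    SChain X n →+ SChain X n := slift fun σ => ∑ k, ε k • sgl (σ.comp (a k))

theorem subdiv_push {n : ℕ} {κ : Type} [Fintype κ] (a : κ → C(Spx n, Spx n)) (ε : κ → ℤ)
    (f : C(X, Y)) (c : SChain X n) : subdiv a ε (push n f c) = push n f (subdiv a ε c) := by
  have : (subdiv a ε).comp (push n f) = (push n f).comp (subdiv a ε) := schain_ext fun σ => by
    simp [subdiv, ContinuousMap.comp_assoc]
  exact DFunLike.congr_fun this c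

theorem iterate_subdiv_mem {n : ℕ} {κ : Type} [Fintype κ] {a : κ → C(Spx n, Spx n)} (ε : κ → ℤ)
    (ha : ∀ k, LipschitzWith (1 / 2) (a k)) (σ : C(Spx n, X)) (N : ℕ) :
    (subdiv a ε)^[N] (sgl σ) ∈ AddSubgroup.closure
      {c | ∃ τ : C(Spx n, Spx n), LipschitzWith ((1 / 2) ^ N) τ ∧ c = sgl (σ.comp τ)} := by
  induction N with
  | zero =>
    refine AddSubgroup.subset_closure ⟨.id _, ?_, rfl⟩
    rw [pow_zero]
    exact LipschitzWith.id
  | succ N ih =>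
    rw [Function.iterate_succ_apply']
    refine AddSubgroup.closure_induction (p := fun x _ => subdiv a ε x ∈ AddSubgroup.closure
      {c | ∃ τ : C(Spx n, Spx n), LipschitzWith ((1 / 2) ^ (N + 1)) τ ∧ c = sgl (σ.comp τ)})
      ?_ ?_ ?_ ?_ ih
    · rintro _ ⟨τ, hτ, rfl⟩
      rw [subdiv, slift_sgl]
      refine sum_mem fun k _ => zsmul_mem (AddSubgroup.subset_closure ?_) _
      refine ⟨τ.comp (a k), ?_, rfl⟩
      rw [pow_succ]
      exact hτ.comp (ha k)
    · rw [map_zero]; exact zero_mem _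
    · intro x y _ _ hx hy
      rw [map_add]; exact add_mem hx hy
    · intro x _ hx
      rw [map_neg]; exact neg_mem hx

theorem spx_dist_le {n : ℕ} (x y : Spx n) : dist x y ≤ 1 := by
  rw [Subtype.dist_eq]
  refine (dist_pi_le_iff zero_le_one).2 fun i => ?_
  rw [Real.dist_eq, abs_le]
  have h1 := stdSimplex.zero_le x i
  have h2 := stdSimplex.le_one x i
  have h3 := stdSimplex.zero_le y i
  have h4 := stdSimplex.le_one y i
  change -1 ≤ x i - y i ∧ x i - y i ≤ 1
  constructor <;> linarith

/-- After `N` steps the pieces have diameter at most `2⁻ᴺ` in the standard simplex, which falls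
below the Lebesgue number of the pulled back cover. The conclusion is about all large `N`, so that
it passes to sums. -/
theorem eventually_subdiv_mem {n : ℕ} {κ : Type} [Fintype κ] {a : κ → C(Spx n, Spx n)} (ε : κ → ℤ)
    (ha : ∀ k, LipschitzWith (1 / 2) (a k)) {ι : Type} {U : ι → Set X} (hU : ∀ i, IsOpen (U i))
    (hcov : ∀ x, ∃ i, x ∈ U i) (c : SChain X n) :
    ∀ᶠ N in Filter.atTop, (subdiv a ε)^[N] c ∈ smallChain n U := by
  induction c using schain_induction with
  | h0 => exact .of_forall fun N => by rw [iterate_map_zero]; exact zero_mem _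
  | hs σ =>
    obtain ⟨δ, hδ, h⟩ := lebesgue_number_lemma_of_metric (s := (Set.univ : Set (Spx n)))
      (c := fun i => σ ⁻¹' U i) isCompact_univ (fun i => (hU i).preimage σ.continuous)
      (fun x _ => Set.mem_iUnion.2 (hcov (σ x)))
    have hlim : ∀ᶠ N : ℕ in Filter.atTop, (1 / 2 : ℝ) ^ N < δ :=
      (tendsto_pow_atTop_nhds_zero_of_lt_one (by norm_num) (by norm_num)).eventually_lt_const hδ
    filter_upwards [hlim] with N hN
    refine (AddSubgroup.closure_le _).2 ?_ (iterate_subdiv_mem ε ha σ N)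
    rintro _ ⟨τ, hτ, rfl⟩
    obtain ⟨i, hi⟩ := h (τ (stdSimplex.vertex 0)) trivial
    refine AddSubgroup.subset_closure ⟨σ.comp τ, i, ?_, rfl⟩
    rintro _ ⟨x, rfl⟩
    refine hi (Metric.mem_ball.2 (lt_of_le_of_lt ((hτ.dist_le_mul _ _).trans ?_) hN))
    rw [NNReal.coe_pow]
    refine (mul_le_of_le_one_right (by positivity) (spx_dist_le _ _)).trans_eq ?_
    norm_num
  | ha x y hx hy =>
    filter_upwards [hx, hy] with N h1 h2
    rw [iterate_map_add]
    exact add_mem h1 h2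
  | hn x hx =>
    filter_upwards [hx] with N h1
    rw [iterate_map_neg]
    exact neg_mem h1

/-- Each iterate differs from `c` by a boundary, so it is again a cycle and the hypothesis, which
concerns cycles only, applies to it. -/
theorem exists_small_of_subdiv {n : ℕ} {κ : Type} [Fintype κ] {a : κ → C(Spx (n + 1), Spx (n + 1))}
    {ε : κ → ℤ} (ha : ∀ k, LipschitzWith (1 / 2) (a k))
    (h : ∀ c : SChain X (n + 1), sbd X n c = 0 → ∃ w, sbd X (n + 1) w = c - subdiv a ε c)
    {ι : Type} {U : ι → Set X} (hU : ∀ i, IsOpen (U i))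
    (hcov : ∀ x, ∃ i, x ∈ U i) {c : SChain X (n + 1)} (hc : sbd X n c = 0) :
    ∃ c' ∈ smallChain (n + 1) U, ∃ w, sbd X (n + 1) w = c - c' := by
  have key (N : ℕ) : ∃ w, sbd X (n + 1) w = c - (subdiv a ε)^[N] c := by
    induction N with
    | zero => exact ⟨0, by simp⟩
    | succ N ih =>
      obtain ⟨w, hw⟩ := ih
      obtain ⟨w', hw'⟩ := h ((subdiv a ε)^[N] c) (by
        rw [← sub_sub_cancel c ((subdiv a ε)^[N] c), ← hw, map_sub, hc, zero_sub, neg_eq_zero]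
        exact bd_bd _)
      refine ⟨w + w', ?_⟩
      rw [map_add, hw, hw', Function.iterate_succ_apply']
      abel
  obtain ⟨N, hN⟩ := (eventually_subdiv_mem ε ha hU hcov c).exists
  exact ⟨_, hN, key N⟩

/-! ### Edgewise subdivision -/

theorem face_succAbove {n : ℕ} (i : Fin (n + 2)) (x : Spx n) (j : Fin (n + 1)) :
    face i x (i.succAbove j) = x j := by
  change stdSimplex.map (i.succAbove) x (i.succAbove j) = x j
  rw [stdSimplex.map_coe, FunOnFinite.linearMap_apply_apply,
    Finset.sum_eq_single_of_mem j (by simp)]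
  intro k hk hkj
  exact absurd (Fin.succAbove_right_injective (Finset.mem_filter.1 hk).2) hkj

theorem face_self {n : ℕ} (i : Fin (n + 2)) (x : Spx n) : face i x i = 0 := by
  change stdSimplex.map (i.succAbove) x i = 0
  rw [stdSimplex.map_coe, FunOnFinite.linearMap_apply_apply]
  refine Finset.sum_eq_zero fun k hk => ?_
  exact absurd (Finset.mem_filter.1 hk).2 (Fin.succAbove_ne i k)

/-- The homothety of ratio `1 / 2` that fixes a vertex. -/
def corner {n : ℕ} (i : Fin (n + 1)) : C(Spx n, Spx n) :=
  ⟨fun x => ⟨(1 / 2 : ℝ) • x.1 + (1 / 2 : ℝ) • (stdSimplex.vertex i : Spx n).1,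
    convex_stdSimplex ℝ _ x.2 (stdSimplex.vertex i : Spx n).2 (by norm_num) (by norm_num)
      (by norm_num)⟩, by
    refine Continuous.subtype_mk (f := fun x : Spx n =>
      (1 / 2 : ℝ) • x.1 + (1 / 2 : ℝ) • (stdSimplex.vertex i : Spx n).1) ?_ _
    exact (continuous_subtype_val.const_smul (1 / 2 : ℝ)).add continuous_const⟩

theorem corner_apply {n : ℕ} (i j : Fin (n + 1)) (x : Spx n) :
    corner i x j = (x j + (stdSimplex.vertex i : Spx n) j) / 2 := by
  change (1 / 2 : ℝ) * x j + (1 / 2 : ℝ) * (stdSimplex.vertex i : Spx n) j = _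
  ring

theorem corner_lipschitz {n : ℕ} (i : Fin (n + 1)) : LipschitzWith (1 / 2) (corner i) := by
  refine LipschitzWith.of_dist_le_mul fun x y => ?_
  rw [Subtype.dist_eq, Subtype.dist_eq]
  refine (dist_pi_le_iff (by positivity)).2 fun j => ?_
  have h := dist_le_pi_dist x.1 y.1 j
  rw [Real.dist_eq] at h ⊢
  change |corner i x j - corner i y j| ≤ _
  rw [corner_apply, corner_apply, ← sub_div, add_sub_add_right_eq_sub, abs_div, abs_two]
  push_cast
  change |x j - y j| ≤ _ at h
  linarith

/-- The parametrization of the middle triangle of the edgewise subdivision. -/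
def middle : C(Spx 2, Spx 2) :=
  ⟨fun x => ⟨fun j => (1 - x j.rev) / 2, fun j => by
      have := stdSimplex.le_one x j.rev
      linarith, by
      have := stdSimplex.sum_eq_one x
      rw [Fin.sum_univ_three] at this ⊢
      change (1 - x 2) / 2 + (1 - x 1) / 2 + (1 - x 0) / 2 = 1
      linarith⟩, by
    refine Continuous.subtype_mk (continuous_pi fun j => ?_) _
    exact (continuous_const.sub ((continuous_apply j.rev).comp continuous_subtype_val)).div_const _⟩

theorem middle_apply (j : Fin 3) (x : Spx 2) : middle x j = (1 - x j.rev) / 2 := rfl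

theorem middle_lipschitz : LipschitzWith (1 / 2) middle := by
  refine LipschitzWith.of_dist_le_mul fun x y => ?_
  rw [Subtype.dist_eq, Subtype.dist_eq]
  refine (dist_pi_le_iff (by positivity)).2 fun j => ?_
  have h := dist_le_pi_dist x.1 y.1 j.rev
  rw [Real.dist_eq] at h ⊢
  change |middle x j - middle y j| ≤ _
  rw [middle_apply, middle_apply, ← sub_div, sub_sub_sub_cancel_left, abs_div, abs_two, abs_sub_comm]
  push_cast
  change |x j.rev - y j.rev| ≤ _ at h
  linarith

/-- The subdivision of singular `1`-chains. -/
abbrev subdivOne (X : Type) [TopologicalSpace X] : SChain X 1 →+ SChain X 1 :=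
  subdiv corner fun _ : Fin 2 => 1

/-- The four triangles of the edgewise subdivision of a triangle. -/
def triangles (k : Option (Fin 3)) : C(Spx 2, Spx 2) := k.elim middle corner

/-- The edgewise subdivision of singular `2`-chains. -/
abbrev subdivTwo (X : Type) [TopologicalSpace X] : SChain X 2 →+ SChain X 2 :=
  subdiv triangles fun k => k.elim (-1) 1

theorem subdivOne_sgl (σ : C(Spx 1, X)) :
    subdivOne X (sgl σ) = sgl (σ.comp (corner 0)) + sgl (σ.comp (corner 1)) := by
  simp [subdiv]

theorem subdivTwo_sgl (σ : C(Spx 2, X)) :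
    subdivTwo X (sgl σ) = sgl (σ.comp (corner 0)) + sgl (σ.comp (corner 1)) +
      sgl (σ.comp (corner 2)) - sgl (σ.comp middle) := by
  simp [subdiv, triangles, Fin.sum_univ_three]
  abel

theorem face_zero_apply (x : Spx 1) : face 0 x 0 = 0 ∧ face 0 x 1 = x 0 ∧ face 0 x 2 = x 1 :=
  ⟨face_self 0 x, face_succAbove 0 x 0, face_succAbove 0 x 1⟩

theorem face_one_apply (x : Spx 1) : face 1 x 0 = x 0 ∧ face 1 x 1 = 0 ∧ face 1 x 2 = x 1 :=
  ⟨face_succAbove 1 x 0, face_self 1 x, face_succAbove 1 x 1⟩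

theorem face_two_apply (x : Spx 1) : face 2 x 0 = x 0 ∧ face 2 x 1 = x 1 ∧ face 2 x 2 = 0 :=
  ⟨face_succAbove 2 x 0, face_succAbove 2 x 1, face_self 2 x⟩

theorem spx2_ext {f g : C(Spx 1, Spx 2)} (h0 : ∀ x, f x 0 = g x 0) (h1 : ∀ x, f x 1 = g x 1)
    (h2 : ∀ x, f x 2 = g x 2) : f = g := by
  refine ContinuousMap.ext fun x => stdSimplex.ext (funext fun j => ?_)
  fin_cases j
  exacts [h0 x, h1 x, h2 x]

/-- The inner edges of the corner triangles are those of the middle one, with the same direction.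
This is why `middle` reverses the order of the coordinates: its orientation is then negative, which
accounts for its coefficient `-1` in `subdivTwo`. -/
theorem corner_face_eq_middle :
    (corner 0).comp (face 0) = middle.comp (face 2) ∧
    (corner 1).comp (face 1) = middle.comp (face 1) ∧
    (corner 2).comp (face 2) = middle.comp (face 0) := by
  refine ⟨?_, ?_, ?_⟩ <;> refine spx2_ext ?_ ?_ ?_ <;> intro x <;>
    have hx := stdSimplex.add_eq_one x <;>
    simp only [ContinuousMap.comp_apply, corner_apply, middle_apply, stdSimplex.vertex_coe,
      face_zero_apply, face_one_apply, face_two_apply, Fin.reduceRev,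
      Pi.single_apply] <;>
    simp <;> linarith

/-- The outer edges of the corner triangles are the halves of the sides. -/
theorem corner_face_eq_face :
    (corner (n := 2) 0).comp (face 1) = (face 1).comp (corner 0) ∧
    (corner (n := 2) 0).comp (face 2) = (face 2).comp (corner 0) ∧
    (corner (n := 2) 1).comp (face 0) = (face 0).comp (corner 0) ∧
    (corner (n := 2) 1).comp (face 2) = (face 2).comp (corner 1) ∧
    (corner (n := 2) 2).comp (face 0) = (face 0).comp (corner 1) ∧
    (corner (n := 2) 2).comp (face 1) = (face 1).comp (corner 1) := by
  refine ⟨?_, ?_, ?_, ?_, ?_, ?_⟩ <;> refine spx2_ext ?_ ?_ ?_ <;> intro x <;>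
    simp only [ContinuousMap.comp_apply, corner_apply, stdSimplex.vertex_coe,
      face_zero_apply, face_one_apply, face_two_apply, Pi.single_apply] <;>
    simp

theorem sbd_subdivTwo (c : SChain X 2) :
    sbd X 1 (subdivTwo X c) = subdivOne X (sbd X 1 c) := by
  have : (sbd X 1).comp (subdivTwo X) = (subdivOne X).comp (sbd X 1) := schain_ext fun σ => by
    obtain ⟨m0, m1, m2⟩ := corner_face_eq_middle
    obtain ⟨f1, f2, f3, f4, f5, f6⟩ := corner_face_eq_face
    rw [AddMonoidHom.comp_apply, AddMonoidHom.comp_apply, subdivTwo_sgl, map_sub, map_add, map_add,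
      sbd1, sbd1, sbd1, sbd1, sbd1, map_add, map_sub, subdivOne_sgl, subdivOne_sgl, subdivOne_sgl]
    simp only [ContinuousMap.comp_assoc, m0, m1, m2, f1, f2, f3, f4, f5, f6]
    abel
  exact DFunLike.congr_fun this c

theorem corner_vertex_self {n : ℕ} (i : Fin (n + 1)) :
    corner i (stdSimplex.vertex i) = stdSimplex.vertex i := by
  refine stdSimplex.ext (funext fun j => ?_)
  rw [corner_apply]
  ring

theorem corner_vertex_comm {n : ℕ} (i j : Fin (n + 1)) :
    corner i (stdSimplex.vertex j) = corner j (stdSimplex.vertex i) := by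
  refine stdSimplex.ext (funext fun k => ?_)
  rw [corner_apply, corner_apply, add_comm]

/-- Acyclic models: the homotopy is found once on the identity simplex, in a contractible space, and
transported by naturality. The right side is a cycle because the two halves meet at the midpoint and
keep the outer ends. -/
theorem exists_homotopy_one : ∃ t : SChain (Spx 1) 2,
    sbd _ 1 t = sgl (.id _) - subdivOne _ (sgl (.id _)) := by
  refine exists_sbd_eq ?_
  rw [subdivOne_sgl, map_sub, map_add, sbd0_pt, sbd0_pt, sbd0_pt]
  simp only [ContinuousMap.comp_apply, ContinuousMap.id_apply, corner_vertex_self]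
  rw [corner_vertex_comm 1 0]
  abel

/-- The chain homotopy from the identity to the subdivision, on `1`-chains. -/
def homotopyOne (X : Type) [TopologicalSpace X] : SChain X 1 →+ SChain X 2 :=
  slift fun σ => push 2 σ exists_homotopy_one.choose

theorem sbd_homotopyOne (c : SChain X 1) :
    sbd X 1 (homotopyOne X c) = c - subdivOne X c := by
  have : (sbd X 1).comp (homotopyOne X) = AddMonoidHom.id _ - subdivOne X :=
    schain_ext fun σ => by
      rw [AddMonoidHom.comp_apply, homotopyOne, slift_sgl, sbd_push, exists_homotopy_one.choose_spec,
        map_sub, ← subdiv_push, push_sgl]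
      rfl
  exact DFunLike.congr_fun this c

theorem homotopyOne_push (f : C(X, Y)) (c : SChain X 1) :
    homotopyOne Y (push 1 f c) = push 2 f (homotopyOne X c) := by
  have : (homotopyOne Y).comp (push 1 f) = (push 2 f).comp (homotopyOne X) :=
    schain_ext fun σ => by simp [homotopyOne, push_push]
  exact DFunLike.congr_fun this c

/-- The same in the next degree; the right side is a cycle because subdivision commutes with the
boundary and `homotopyOne` is a homotopy. -/
theorem exists_homotopy_two : ∃ t : SChain (Spx 2) 3,
    sbd _ 2 t = sgl (.id _) - subdivTwo _ (sgl (.id _)) - homotopyOne _ (sbd _ 1 (sgl (.id _))) := by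
  refine exists_sbd_eq ?_
  rw [map_sub, map_sub, sbd_subdivTwo, sbd_homotopyOne, sub_self]

theorem exists_sbd_eq_sub_subdivTwo (c : SChain X 2) :
    ∃ w, sbd X 2 w = c - subdivTwo X c - homotopyOne X (sbd X 1 c) := by
  obtain ⟨t, ht⟩ := exists_homotopy_two
  refine ⟨slift (fun σ => push 3 σ t) c, ?_⟩
  have : (sbd X 2).comp (slift (fun σ => push 3 σ t)) =
      AddMonoidHom.id _ - subdivTwo X - (homotopyOne X).comp (sbd X 1) :=
    schain_ext fun σ => by
      rw [AddMonoidHom.comp_apply, slift_sgl, sbd_push, ht,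
        map_sub, map_sub, ← subdiv_push, push_sgl, ← homotopyOne_push, ← sbd_push, push_sgl]
      rfl
  exact DFunLike.congr_fun this c

/-- Every `1`-cycle is homologous to a small one. -/
theorem exists_small_one {ι : Type} {U : ι → Set X} (hU : ∀ i, IsOpen (U i))
    (hcov : ∀ x, ∃ i, x ∈ U i) {c : SChain X 1} (hc : sbd X 0 c = 0) :
    ∃ c' ∈ smallChain 1 U, ∃ w, sbd X 1 w = c - c' :=
  exists_small_of_subdiv corner_lipschitz (fun c _ => ⟨_, sbd_homotopyOne c⟩) hU hcov hc

/-- Every `2`-cycle is homologous to a small one. -/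
theorem exists_small_two {ι : Type} {U : ι → Set X} (hU : ∀ i, IsOpen (U i))
    (hcov : ∀ x, ∃ i, x ∈ U i) {c : SChain X 2} (hc : sbd X 1 c = 0) :
    ∃ c' ∈ smallChain 2 U, ∃ w, sbd X 2 w = c - c' := by
  refine exists_small_of_subdiv (a := triangles) (ε := fun k => k.elim (-1) 1) ?_
    (fun c hc => ?_) hU hcov hc
  · rintro (_ | i)
    exacts [middle_lipschitz, corner_lipschitz i]
  · obtain ⟨w, hw⟩ := exists_sbd_eq_sub_subdivTwo c
    exact ⟨w, by rw [hw, hc, map_zero, sub_zero]⟩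

end SingChain

/-! ### Chains of subspaces and cycles on a wedge of circles -/

namespace SingChain

variable {X Y Z : Type} [TopologicalSpace X] [TopologicalSpace Y] [TopologicalSpace Z]

/-- The inclusion of a subspace. -/
def incl (A : Set X) : C(A, X) := ⟨Subtype.val, continuous_subtype_val⟩

/-- The inclusion of a subspace in a larger one. -/
def inclLE {A B : Set X} (h : A ⊆ B) : C(A, B) := ⟨Set.inclusion h, continuous_inclusion h⟩

open Classical in
/-- The projection of chains to the chains of a subspace. -/
def restr (A : Set X) (n : ℕ) : SChain X n →+ SChain A n := slift fun σ =>
  if h : ∀ x, σ x ∈ A then sgl ⟨fun x => ⟨σ x, h x⟩, σ.continuous.subtype_mk h⟩ else 0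

theorem restr_push_incl {A : Set X} {n : ℕ} (c : SChain A n) :
    restr A n (push n (incl A) c) = c := by
  have : (restr A n).comp (push n (incl A)) = AddMonoidHom.id _ := schain_ext fun σ => by
    have h : ∀ x, ((incl A).comp σ) x ∈ A := fun x => (σ x).2
    rw [AddMonoidHom.comp_apply, push_sgl, restr, slift_sgl, dif_pos h]
    rfl
  exact DFunLike.congr_fun this c

theorem push_incl_injective {A : Set X} {n : ℕ} : Function.Injective (push n (incl A)) :=
  Function.LeftInverse.injective restr_push_incl

/-- Restriction to `A` keeps or kills each simplex as a whole; those of `B` that are kept lie in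
both sets. -/
theorem exists_restr_push_incl {A B : Set X} {n : ℕ} (b : SChain B n) :
    ∃ e : SChain ↥(A ∩ B) n, restr A n (push n (incl B) b) =
      push n (inclLE Set.inter_subset_left) e := by
  induction b using schain_induction with
  | h0 => exact ⟨0, by simp⟩
  | hs σ =>
    rw [push_sgl, restr, slift_sgl]
    split_ifs with h
    · refine ⟨sgl ⟨fun x => ⟨σ x, h x, (σ x).2⟩, ?_⟩, ?_⟩
      · exact (continuous_subtype_val.comp σ.continuous).subtype_mk _
      · rw [push_sgl]; rfl
    · exact ⟨0, by simp⟩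
  | ha x y hx hy =>
    obtain ⟨d, hd⟩ := hx
    obtain ⟨e, he⟩ := hy
    exact ⟨d + e, by simp only [map_add, hd, he]⟩
  | hn x hx =>
    obtain ⟨d, hd⟩ := hx
    exact ⟨-d, by simp only [map_neg, hd]⟩

/-- A chain that lies in two subspaces lies in their intersection. -/
theorem exists_push_inter {A B : Set X} {n : ℕ} {a : SChain A n} {b : SChain B n}
    (h : push n (incl A) a = push n (incl B) b) :
    ∃ e : SChain ↥(A ∩ B) n, a = push n (inclLE Set.inter_subset_left) e ∧
      b = push n (inclLE Set.inter_subset_right) e := by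
  obtain ⟨e, he⟩ := exists_restr_push_incl (A := A) b
  have ha : a = push n (inclLE Set.inter_subset_left) e := by
    rw [← he, ← h, restr_push_incl]
  refine ⟨e, ha, push_incl_injective ?_⟩
  rw [← h, ha, push_push, push_push]
  rfl

/-- A small chain is a sum of chains of the members of the family. -/
theorem exists_eq_sum_of_small {n : ℕ} {ι : Type} [Fintype ι] {U : ι → Set X}
    {c : SChain X n} (hc : c ∈ smallChain n U) :
    ∃ d : ∀ i, SChain (U i) n, c = ∑ i, push n (incl (U i)) (d i) := by
  classical
  refine AddSubgroup.closure_induction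
    (p := fun c _ => ∃ d : ∀ i, SChain (U i) n, c = ∑ i, push n (incl (U i)) (d i)) ?_ ?_ ?_ ?_ hc
  · rintro _ ⟨σ, i, hi, rfl⟩
    refine ⟨Pi.single i (sgl ⟨fun x => ⟨σ x, hi ⟨x, rfl⟩⟩, σ.continuous.subtype_mk _⟩), ?_⟩
    rw [Finset.sum_eq_single i]
    · rw [Pi.single_eq_same, push_sgl]; rfl
    · intro j _ hj
      rw [Pi.single_eq_of_ne hj, map_zero]
    · exact fun h => absurd (Finset.mem_univ i) h
  · exact ⟨fun _ => 0, by simp⟩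
  · rintro _ _ _ _ ⟨d, rfl⟩ ⟨e, rfl⟩
    exact ⟨fun i => d i + e i, by simp [Finset.sum_add_distrib]⟩
  · rintro _ _ ⟨d, rfl⟩
    exact ⟨fun i => -d i, by simp⟩

/-! ### Cycles carried by a wedge of circles -/

/-- The sum of the coefficients of a chain. -/
def total (n : ℕ) : SChain X n →+ ℤ := slift fun _ => 1

theorem push_const {n : ℕ} (y : Y) (c : SChain X n) :
    push n (.const X y) c = total n c • sgl (.const _ y) := by
  have : push n (.const X y) =
      (zmultiplesHom _ (sgl (.const (Spx n) y) : SChain Y n)).comp (total n) :=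
    schain_ext fun σ => by
      rw [push_sgl, AddMonoidHom.comp_apply, total, slift_sgl, zmultiplesHom_apply, one_smul]
      rfl
  exact DFunLike.congr_fun this c

theorem sbd_const_two (x : X) :
    sbd X 1 (sgl (.const (Spx 2) x)) = sgl (.const (Spx 1) x) := by
  rw [sbd1]
  exact (sub_add_eq_add_sub _ _ _).trans (add_sub_cancel_right _ _)

variable {ι : Type} [Fintype ι] {e : ι → C(UnitAddCircle, X)} {κ : ι → C(X, UnitAddCircle)} {P : X}

/-- The map `κ i` undoes `e i` and collapses the other circles, so it isolates the `i`-th summand up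
to multiples of the constant simplex. -/
theorem push_retract_sum (h1 : ∀ i, (κ i).comp (e i) = .id _)
    (h2 : ∀ i j, i ≠ j → (κ i).comp (e j) = .const _ 0) {n : ℕ} (i : ι)
    (c : ι → SChain UnitAddCircle n) :
    ∃ k : ℤ, push n (κ i) (∑ j, push n (e j) (c j)) = c i + k • sgl (.const _ 0) := by
  classical
  refine ⟨∑ j ∈ Finset.univ.erase i, total n (c j), ?_⟩
  rw [map_sum, ← Finset.add_sum_erase _ _ (Finset.mem_univ i), push_push, h1, push_id,
    Finset.sum_smul]
  congr 1
  refine Finset.sum_congr rfl fun j hj => ?_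
  rw [push_push, h2 i j (Finset.ne_of_mem_erase hj).symm, push_const]

/-- By `push_retract_sum` the boundary of each `c i` is a multiple of a point; its augmentation is
zero, so each `c i` is a cycle of the circle. -/
theorem wedge_one (h1 : ∀ i, (κ i).comp (e i) = .id _)
    (h2 : ∀ i j, i ≠ j → (κ i).comp (e j) = .const _ 0)
    {c : ι → SChain UnitAddCircle 1} (hc : sbd X 0 (∑ j, push 1 (e j) (c j)) = 0) :
    ∃ (m : ι → ℤ) (w : _), sbd X 1 w =
      (∑ j, push 1 (e j) (c j)) - ∑ j, m j • sgl ((e j).comp circ) := by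
  have hb (i : ι) : sbd _ 0 (c i) = 0 := by
    obtain ⟨k, hk⟩ := push_retract_sum h1 h2 i fun j => sbd _ 0 (c j)
    simp only [← sbd_push, ← map_sum, hc, map_zero] at hk
    have h := congrArg aug hk
    rw [map_zero, map_add, aug_sbd, zero_add, map_zsmul, aug_sgl, smul_eq_mul, mul_one] at h
    rw [hk, ← h, zero_smul, add_zero]
  choose m w hw using fun i => exists_circle_one (hb i)
  refine ⟨m, ∑ j, push 2 (e j) (w j), ?_⟩
  rw [map_sum, ← Finset.sum_sub_distrib]
  refine Finset.sum_congr rfl fun j _ => ?_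
  rw [sbd_push, hw, map_sub, map_zsmul, push_sgl]

/-- Each `c i` is a cycle only up to a multiple of the constant `1`-simplex, which is the boundary
of the constant `2`-simplex. After this correction each summand bounds. What is left is a multiple
of the constant simplex at `P`; its boundary must vanish, and counting coefficients shows that the
multiple is zero. -/
theorem wedge_two (h1 : ∀ i, (κ i).comp (e i) = .id _)
    (h2 : ∀ i j, i ≠ j → (κ i).comp (e j) = .const _ 0) (hP : ∀ i, e i 0 = P)
    {c : ι → SChain UnitAddCircle 2} (hc : sbd X 1 (∑ j, push 2 (e j) (c j)) = 0) :
    ∃ w, sbd X 2 w = ∑ j, push 2 (e j) (c j) := by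
  have hb (i : ι) : ∃ k : ℤ, sbd _ 1 (c i) = k • sgl (.const _ 0) := by
    obtain ⟨k, hk⟩ := push_retract_sum h1 h2 i fun j => sbd _ 1 (c j)
    simp only [← sbd_push, ← map_sum, hc, map_zero] at hk
    exact ⟨-k, by rw [neg_smul]; exact eq_neg_of_add_eq_zero_left hk.symm⟩
  choose k hk using hb
  choose w hw using fun i => exists_circle_two (n := 0)
    (c := c i - k i • sgl (.const _ 0)) (by
      rw [map_sub, map_zsmul, hk, sbd_const_two, sub_self])
  have key : ∑ j, push 2 (e j) (c j) = sbd X 2 (∑ j, push 3 (e j) (w j)) +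
      (∑ j, k j) • sgl (.const _ P) := by
    rw [map_sum, Finset.sum_smul, ← Finset.sum_add_distrib]
    refine Finset.sum_congr rfl fun j _ => ?_
    rw [sbd_push, hw, map_sub, map_zsmul, push_sgl,
      show (e j).comp (.const (Spx 2) 0) = .const (Spx 2) P from
        ContinuousMap.ext fun _ => hP j, sub_add_cancel]
  have hsum : ∑ j, k j = 0 := by
    have h := congrArg (fun x => total 1 (sbd X 1 x)) key
    simp only [hc, map_add, map_zsmul, sbd_const_two, map_zero] at h
    rw [show sbd X 1 (sbd X 2 (∑ j, push 3 (e j) (w j))) = 0 from bd_bd _, map_zero, zero_add,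
      total, slift_sgl, smul_eq_mul, mul_one] at h
    exact h.symm
  exact ⟨_, by rw [key, hsum, zero_smul, add_zero]⟩

variable {W : Set X} {U : ι → Set W} {G : C(W, X)}

/-- On `U i` the map `G` takes values in the `i`-th circle, so it equals `e i ∘ κ i ∘ G` there. -/
theorem exists_sum_of_carried {n : ℕ} (h1 : ∀ i, (κ i).comp (e i) = .id _)
    (hG : ∀ i, ∀ x ∈ U i, G x ∈ Set.range (e i)) {z : SChain W n} (hz : z ∈ smallChain n U) :
    ∃ c : ι → SChain UnitAddCircle n, push n G z = ∑ i, push n (e i) (c i) := by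
  obtain ⟨d, rfl⟩ := exists_eq_sum_of_small hz
  refine ⟨fun i => push n (((κ i).comp G).comp (incl (U i))) (d i), ?_⟩
  rw [map_sum]
  refine Finset.sum_congr rfl fun i _ => ?_
  rw [push_push, push_push]
  congr 1
  congr 1
  ext x
  obtain ⟨t, ht⟩ := hG i x.1 x.2
  have : κ i (e i t) = t := DFunLike.congr_fun (h1 i) t
  change G x.1 = e i (κ i (G x.1))
  rw [← ht, this]

/-- A cycle of `W` is made small for the cover `U` and moved by `G`, homotopic to the inclusion,
onto the union of the circles; there `wedge_one` applies. -/
theorem carried_one (h1 : ∀ i, (κ i).comp (e i) = .id _)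
    (h2 : ∀ i j, i ≠ j → (κ i).comp (e j) = .const _ 0)
    (hU : ∀ i, IsOpen (U i)) (hcov : ∀ x, ∃ i, x ∈ U i)
    (hG : ∀ i, ∀ x ∈ U i, G x ∈ Set.range (e i)) (hGi : (incl W).Homotopic G)
    {z : SChain W 1} (hz : sbd W 0 z = 0) :
    ∃ (m : ι → ℤ) (w : _), sbd X 1 w =
      push 1 (incl W) z - ∑ j, m j • sgl ((e j).comp circ) := by
  obtain ⟨z', hz', w, hw⟩ := exists_small_one hU hcov hz
  obtain ⟨w1, hw1⟩ := exists_sbd_eq_push_sub hGi hz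
  obtain ⟨c, hc⟩ := exists_sum_of_carried h1 hG hz'
  have hz0 : sbd W 0 z' = 0 := by
    rw [← sub_sub_cancel z z', ← hw, map_sub, hz, zero_sub, neg_eq_zero]
    exact bd_bd _
  obtain ⟨m, w2, hw2⟩ := wedge_one h1 h2 (c := c) (by rw [← hc, sbd_push, hz0, map_zero])
  refine ⟨m, w1 + push 2 G w + w2, ?_⟩
  rw [map_add, map_add, hw1, hw2, sbd_push, hw, map_sub, ← hc]
  abel

theorem carried_two (h1 : ∀ i, (κ i).comp (e i) = .id _)
    (h2 : ∀ i j, i ≠ j → (κ i).comp (e j) = .const _ 0) (hP : ∀ i, e i 0 = P)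
    (hU : ∀ i, IsOpen (U i)) (hcov : ∀ x, ∃ i, x ∈ U i)
    (hG : ∀ i, ∀ x ∈ U i, G x ∈ Set.range (e i)) (hGi : (incl W).Homotopic G)
    {z : SChain W 2} (hz : sbd W 1 z = 0) :
    ∃ w, sbd X 2 w = push 2 (incl W) z := by
  obtain ⟨z', hz', w, hw⟩ := exists_small_two hU hcov hz
  obtain ⟨w1, hw1⟩ := exists_sbd_eq_push_sub hGi hz
  obtain ⟨c, hc⟩ := exists_sum_of_carried h1 hG hz'
  have hz0 : sbd W 1 z' = 0 := by
    rw [← sub_sub_cancel z z', ← hw, map_sub, hz, zero_sub, neg_eq_zero]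
    exact bd_bd _
  obtain ⟨w2, hw2⟩ := wedge_two h1 h2 hP (c := c) (by rw [← hc, sbd_push, hz0, map_zero])
  refine ⟨w1 + push 3 G w + w2, ?_⟩
  rw [map_add, map_add, hw1, hw2, sbd_push, hw, map_sub, ← hc]
  abel

end SingChain

/-! ### Pushing cycles off a two-dimensional cell -/

namespace SingChain

variable {X Y Z : Type} [TopologicalSpace X] [TopologicalSpace Y] [TopologicalSpace Z]

theorem exists_eq_add_of_small {n : ℕ} {O W : Set X} {c : SChain X n}
    (hc : c ∈ smallChain n fun b : Bool => cond b O W) :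
    ∃ (a : SChain O n) (b : SChain W n), c = push n (incl O) a + push n (incl W) b := by
  obtain ⟨d, rfl⟩ := exists_eq_sum_of_small hc
  exact ⟨d true, d false, Fintype.sum_bool _⟩

theorem push_inclLE_injective {A B : Set X} (h : A ⊆ B) {n : ℕ} :
    Function.Injective (push n (inclLE h)) := by
  intro x y hxy
  have := congrArg (push n (incl B)) hxy
  rw [push_push, push_push] at this
  exact push_incl_injective this

variable {D : Type} [TopologicalSpace D] [ContractibleSpace D] {q : C(D, X)}
  {β : C(UnitAddCircle, D)} {O W : Set X} {ρ : C(X, X)} {l : C(O, D)}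
  {η : C(↑(O ∩ W), UnitAddCircle)} {β' : C(UnitAddCircle, W)} {ρ' : C(W, W)}

/-- In the model, `q` is the characteristic map of a cell with boundary `β`, `O` is a smaller open
cell, `W` is a neighbourhood of the 1-skeleton, and `ρ` expands the cell so that `O ∩ W` lands on
the boundary; `l` and `η` are the lifts of `ρ` to the cell and to its boundary circle. Split a small
cycle as `a + b`. The boundary of `l_* a` lies on the circle and bounds a chain `s` there, so `l_*
a` can be replaced by `β_* s`, as the cell is contractible. The result lies in `W`. -/
theorem excise_one (hO : IsOpen O) (hW : IsOpen W) (hOW : O ∪ W = Set.univ)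
    (hρ : ρ.Homotopic (.id X)) (hl : q.comp l = ρ.comp (incl O))
    (hη : β.comp η = l.comp (inclLE Set.inter_subset_left))
    (hβ' : (incl W).comp β' = q.comp β) (hρ' : (incl W).comp ρ' = ρ.comp (incl W))
    {c : SChain X 1} (hc : sbd X 0 c = 0) :
    ∃ z : SChain W 1, sbd W 0 z = 0 ∧ ∃ w, sbd X 1 w = c - push 1 (incl W) z := by
  obtain ⟨c', hc', w0, hw0⟩ := exists_small_one (U := fun b : Bool => cond b O W)
    (by rintro (_ | _) <;> assumption) (fun x => by
      rcases (hOW ▸ Set.mem_univ x : x ∈ O ∪ W) with h | h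
      exacts [⟨true, h⟩, ⟨false, h⟩]) hc
  have hc0 : sbd X 0 c' = 0 := by
    rw [← sub_sub_cancel c c', ← hw0, map_sub, hc, zero_sub, neg_eq_zero]
    exact bd_bd _
  obtain ⟨a, b, rfl⟩ := exists_eq_add_of_small hc'
  obtain ⟨w1, hw1⟩ := exists_sbd_eq_push_sub hρ hc0
  rw [push_id] at hw1
  obtain ⟨e, he, -⟩ := exists_push_inter (a := sbd O 0 a) (b := -sbd W 0 b) (by
    rw [map_neg, ← sbd_push, ← sbd_push, ← add_eq_zero_iff_eq_neg, ← map_add, hc0])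
  obtain ⟨s, hs⟩ := exists_sbd_eq_of_aug (c := push 0 η e) (by
    rw [aug_push, ← aug_push (inclLE Set.inter_subset_left), ← he, aug_sbd])
  obtain ⟨w2, hw2⟩ := exists_sbd_eq (c := push 1 l a - push 1 β s) (by
    rw [map_sub, sbd_push, sbd_push, he, hs, push_push, push_push, hη, sub_self])
  have key : push 1 (incl W) (push 1 β' s + push 1 ρ' b) =
      push 1 ρ (push 1 (incl O) a + push 1 (incl W) b) - sbd X 1 (push 2 q w2) := by
    rw [sbd_push, hw2, map_add, map_add, map_sub, push_push, push_push, push_push, push_push,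
      push_push, push_push, hβ', hρ', hl]
    abel
  refine ⟨push 1 β' s + push 1 ρ' b, ?_, w0 - w1 + push 2 q w2, eq_sub_of_add_eq' ?_⟩
  · refine push_incl_injective ?_
    rw [← sbd_push, key, map_sub, map_zero, sbd_push, hc0, map_zero, zero_sub, neg_eq_zero]
    exact bd_bd _
  · rw [key, map_add (sbd X 1), map_sub (sbd X 1), hw0, hw1]
    abel

/-- As in `excise_one`, but the common boundary `e` is now a `1`-cycle, and its image on the circle
is homologous to `d` times the fundamental loop. The representative `f` of that loop is chosen to be
killed by the attaching map as a chain, so that `push 2 q F` is a cycle. Subtracting `d` copies of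
`F` leaves a part that can be moved to the boundary circle. -/
theorem excise_two (hO : IsOpen O) (hW : IsOpen W) (hOW : O ∪ W = Set.univ)
    (hρ : ρ.Homotopic (.id X)) (hl : q.comp l = ρ.comp (incl O))
    (hη : β.comp η = l.comp (inclLE Set.inter_subset_left))
    (hβ' : (incl W).comp β' = q.comp β) (hρ' : (incl W).comp ρ' = ρ.comp (incl W))
    {f : SChain UnitAddCircle 1} {v : _} (hf : sbd _ 1 v = f - sgl circ)
    (hf0 : push 1 (q.comp β) f = 0) {F : SChain D 2} (hF : sbd D 1 F = push 1 β f)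
    {c : SChain X 2} (hc : sbd X 1 c = 0) :
    ∃ (d : ℤ) (z : SChain W 2), sbd W 1 z = 0 ∧
      ∃ w, sbd X 2 w = c - d • push 2 q F - push 2 (incl W) z := by
  obtain ⟨c', hc', w0, hw0⟩ := exists_small_two (U := fun b : Bool => cond b O W)
    (by rintro (_ | _) <;> assumption) (fun x => by
      rcases (hOW ▸ Set.mem_univ x : x ∈ O ∪ W) with h | h
      exacts [⟨true, h⟩, ⟨false, h⟩]) hc
  have hc0 : sbd X 1 c' = 0 := by
    rw [← sub_sub_cancel c c', ← hw0, map_sub, hc, zero_sub, neg_eq_zero]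
    exact bd_bd _
  obtain ⟨a, b, rfl⟩ := exists_eq_add_of_small hc'
  obtain ⟨w1, hw1⟩ := exists_sbd_eq_push_sub hρ hc0
  rw [push_id] at hw1
  obtain ⟨e, he, -⟩ := exists_push_inter (a := sbd O 1 a) (b := -sbd W 1 b) (by
    rw [map_neg, ← sbd_push, ← sbd_push, ← add_eq_zero_iff_eq_neg, ← map_add, hc0])
  have he0 : sbd _ 0 e = 0 := by
    refine push_inclLE_injective Set.inter_subset_left ?_
    rw [← sbd_push, ← he, map_zero]
    exact bd_bd _
  obtain ⟨d, s, hs⟩ := exists_circle_one (c := push 1 η e) (by rw [sbd_push, he0, map_zero])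
  have hs' : push 1 η e = d • f + sbd _ 1 (s - d • v) := by
    rw [map_sub, map_zsmul, hf, hs, smul_sub]
    abel
  obtain ⟨w2, hw2⟩ := exists_sbd_eq (c := push 2 l a - d • F - push 2 β (s - d • v)) (by
    rw [map_sub, map_sub, map_zsmul, hF, sbd_push, sbd_push, he, push_push, ← hη, ← push_push, hs',
      map_add, map_zsmul]
    abel)
  have hqF : sbd X 1 (push 2 q F) = 0 := by
    rw [sbd_push, hF, push_push, hf0]
  have key : push 2 (incl W) (push 2 β' (s - d • v) + push 2 ρ' b) =
      push 2 ρ (push 2 (incl O) a + push 2 (incl W) b) - d • push 2 q F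
        - sbd X 2 (push 3 q w2) := by
    rw [sbd_push, hw2, map_add, map_add, map_sub (push 2 q), map_sub (push 2 q),
      map_zsmul (push 2 q), push_push, push_push, push_push, push_push,
      push_push, push_push, hβ', hρ', hl]
    abel
  refine ⟨d, push 2 β' (s - d • v) + push 2 ρ' b, ?_, w0 - w1 + push 3 q w2,
    eq_sub_of_add_eq' ?_⟩
  · refine push_incl_injective ?_
    rw [← sbd_push, key, map_sub, map_sub, map_zero, sbd_push, hc0, map_zero, map_zsmul, hqF,
      smul_zero, sub_zero, zero_sub, neg_eq_zero]
    exact bd_bd _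
  · rw [key, map_add (sbd X 2), map_sub (sbd X 2), hw0, hw1]
    abel

end SingChain

open SingChain

/-! ### Polar coordinates on the polygon and maps out of the surface -/

namespace Surface

/-- The closed unit disc. -/
abbrev Disc : Type := Metric.closedBall (0 : ℂ) 1

instance disc_contractible : ContractibleSpace Disc :=
  (convex_closedBall (0 : ℂ) 1).contractibleSpace ⟨0, by simp⟩

/-- The retraction of the line onto the unit interval. -/
def cl (t : ℝ) : ℝ := max 0 (min 1 t)

@[fun_prop] theorem continuous_cl : Continuous cl := by unfold cl; fun_prop

theorem cl_nonneg (t : ℝ) : 0 ≤ cl t := le_max_left _ _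

theorem cl_le_one (t : ℝ) : cl t ≤ 1 := max_le zero_le_one (min_le_left _ _)

theorem cl_of_le {t : ℝ} (h : t ≤ 0) : cl t = 0 := by
  rw [cl, min_eq_right (h.trans zero_le_one), max_eq_left h]

theorem cl_of_ge {t : ℝ} (h : 1 ≤ t) : cl t = 1 := by
  rw [cl, min_eq_left h, max_eq_right zero_le_one]

theorem cl_of_mem {t : ℝ} (h : t ∈ Set.Icc (0 : ℝ) 1) : cl t = t := by
  rw [cl, min_eq_right h.2, max_eq_right h.1]

theorem cl_one_sub (t : ℝ) : cl (1 - t) = 1 - cl t := by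
  rcases le_total t 0 with h | h
  · rw [cl_of_le h, cl_of_ge (by linarith), sub_zero]
  rcases le_total t 1 with h' | h'
  · rw [cl_of_mem ⟨h, h'⟩, cl_of_mem ⟨by linarith, by linarith⟩]
  · rw [cl_of_ge h', cl_of_le (by linarith), sub_self]

variable {g : ℕ}

theorem norm_polygonPoint (θ : ℝ) : ‖polygonPoint g θ‖ = 1 := by
  rw [polygonPoint, show (2 * Real.pi * Complex.I * ((θ / (4 * g) : ℝ) : ℂ)) =
    ((2 * Real.pi * (θ / (4 * g)) : ℝ) : ℂ) * Complex.I by push_cast; ring]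
  exact Complex.norm_exp_ofReal_mul_I _

theorem continuous_polygonPoint : Continuous (polygonPoint g) := by
  unfold polygonPoint
  fun_prop

theorem polygonPoint_eq_iff (hg : 0 < g) {θ θ' : ℝ} :
    polygonPoint g θ = polygonPoint g θ' ↔ ∃ n : ℤ, θ = θ' + n * (4 * g) := by
  have hg' : (0 : ℝ) < 4 * g := by positivity
  rw [polygonPoint, polygonPoint, Complex.exp_eq_exp_iff_exists_int]
  refine exists_congr fun n => ?_
  have h2 : (2 * Real.pi * Complex.I) ≠ 0 := Complex.two_pi_I_ne_zero
  rw [mul_comm (n : ℂ), ← mul_add, mul_right_inj' h2]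
  rw [← Complex.ofReal_intCast n, ← Complex.ofReal_add, Complex.ofReal_inj,
    div_eq_iff hg'.ne', add_mul, div_mul_cancel₀ _ hg'.ne']

/-- Polar coordinates on the disc, the angle being such that the `4g`-gon has sides of length `1`
and the radius being truncated. -/
def polar (g : ℕ) : C(ℝ × ℝ, Disc) :=
  ⟨fun p => ⟨(cl p.1 : ℂ) * polygonPoint g p.2, by
    rw [mem_closedBall_zero_iff, norm_mul, norm_polygonPoint, mul_one, Complex.norm_real,
      Real.norm_of_nonneg (cl_nonneg _)]
    exact cl_le_one _⟩, by
    have := @continuous_polygonPoint g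
    exact Continuous.subtype_mk (by fun_prop) _⟩

theorem coe_polar (r θ : ℝ) : (polar g (r, θ) : ℂ) = (cl r : ℂ) * polygonPoint g θ := rfl

theorem coe_polar_one (θ : ℝ) : (polar g (1, θ) : ℂ) = polygonPoint g θ := by
  rw [coe_polar, cl_of_ge le_rfl, Complex.ofReal_one, one_mul]

theorem norm_polar (r θ : ℝ) : ‖(polar g (r, θ) : ℂ)‖ = cl r := by
  rw [coe_polar, norm_mul, norm_polygonPoint, mul_one, Complex.norm_real,
      Real.norm_of_nonneg (cl_nonneg _)]

theorem polar_congr {r r' : ℝ} (h : cl r = cl r') (θ : ℝ) : polar g (r, θ) = polar g (r', θ) :=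
  Subtype.ext (by rw [coe_polar, coe_polar, h])

theorem polar_zero {r r' : ℝ} (h : r ≤ 0) (h' : r' ≤ 0) (θ θ' : ℝ) :
    polar g (r, θ) = polar g (r', θ') :=
  Subtype.ext (by rw [coe_polar, coe_polar, cl_of_le h, cl_of_le h']; simp)

theorem polar_period (hg : 0 < g) (r : ℝ) : polar g (r, 4 * g) = polar g (r, 0) :=
  Subtype.ext (by
    rw [coe_polar, coe_polar, (polygonPoint_eq_iff hg (θ := 4 * g) (θ' := 0)).2 ⟨1, by simp⟩])

/-- The domain of polar coordinates. -/
abbrev Rect (g : ℕ) : Type := Set.Icc (0 : ℝ) 1 × Set.Icc (0 : ℝ) (4 * g)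

theorem exists_polar (hg : 0 < g) (z : Disc) :
    ∃ p : Rect g, polar g (p.1, p.2) = z := by
  have hg' : (0 : ℝ) < 4 * g := by positivity
  have hz : ‖(z : ℂ)‖ ≤ 1 := mem_closedBall_zero_iff.1 z.2
  have key (θ : ℝ) (n : ℤ) (h : θ = (z : ℂ).arg / (2 * Real.pi) * (4 * g) + n * (4 * g)) :
      polar g (‖(z : ℂ)‖, θ) = z := by
    refine Subtype.ext ?_
    rw [coe_polar, cl_of_mem ⟨norm_nonneg _, hz⟩, (polygonPoint_eq_iff hg).2 ⟨n, h⟩, polygonPoint,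
      mul_div_assoc, div_self hg'.ne', mul_one]
    conv_rhs => rw [← Complex.norm_mul_exp_arg_mul_I (z : ℂ)]
    congr 2
    push_cast
    field_simp
  have h1 := Complex.neg_pi_lt_arg (z : ℂ)
  have h2 := Complex.arg_le_pi (z : ℂ)
  have hpi := Real.pi_pos
  have e : (z : ℂ).arg / (2 * Real.pi) * (2 * Real.pi) = (z : ℂ).arg :=
    div_mul_cancel₀ _ (by positivity)
  -- Negative arguments are increased by one full turn.
  rcases le_or_gt 0 (z : ℂ).arg with h | h
  · refine ⟨(⟨_, norm_nonneg _, hz⟩, ⟨(z : ℂ).arg / (2 * Real.pi) * (4 * g), by positivity, ?_⟩),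
      key _ 0 (by simp)⟩
    refine mul_le_of_le_one_left hg'.le ?_
    rw [div_le_one (by positivity)]
    linarith
  · refine ⟨(⟨_, norm_nonneg _, hz⟩,
      ⟨(z : ℂ).arg / (2 * Real.pi) * (4 * g) + (1 : ℤ) * (4 * g), ?_, ?_⟩), key _ 1 rfl⟩
    · rw [← add_mul]
      refine mul_nonneg ?_ hg'.le
      push_cast
      nlinarith
    · rw [← add_mul]
      refine mul_le_of_le_one_left hg'.le ?_
      push_cast
      nlinarith

theorem polar_eq (hg : 0 < g) {p p' : Rect g} (h : polar g (p.1, p.2) = polar g (p'.1, p'.2)) :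
    (p.1 : ℝ) = p'.1 ∧ ((p.1 : ℝ) = 0 ∨ (p.2 : ℝ) = p'.2 ∨ ((p.2 : ℝ) = 0 ∧ (p'.2 : ℝ) = 4 * g) ∨
      ((p.2 : ℝ) = 4 * g ∧ (p'.2 : ℝ) = 0)) := by
  have hg' : (0 : ℝ) < 4 * g := by positivity
  obtain ⟨⟨r, hr⟩, ⟨θ, hθ⟩⟩ := p
  obtain ⟨⟨r', hr'⟩, ⟨θ', hθ'⟩⟩ := p'
  dsimp only at h ⊢
  have hn : r = r' := by
    have := congrArg (fun z : Disc => ‖(z : ℂ)‖) h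
    rwa [norm_polar, norm_polar, cl_of_mem hr, cl_of_mem hr'] at this
  subst hn
  refine ⟨rfl, ?_⟩
  rcases eq_or_ne r 0 with h0 | h0
  · exact Or.inl h0
  right
  have h1 : polygonPoint g θ = polygonPoint g θ' := by
    have := congrArg Subtype.val h
    rw [coe_polar, coe_polar, cl_of_mem hr] at this
    exact mul_left_cancel₀ (by exact_mod_cast h0) this
  obtain ⟨n, hn⟩ := (polygonPoint_eq_iff hg).1 h1
  have hn1 : (n : ℝ) ≤ 1 := by
    by_contra hc
    have := mul_lt_mul_of_pos_right (not_le.1 hc) hg'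
    linarith [hθ.2, hθ'.1]
  have hn2 : (-1 : ℝ) ≤ n := by
    by_contra hc
    have := mul_lt_mul_of_pos_right (not_le.1 hc) hg'
    linarith [hθ.1, hθ'.2]
  have hn1' : n ≤ 1 := by exact_mod_cast hn1
  have hn2' : -1 ≤ n := by exact_mod_cast hn2
  obtain rfl | rfl | rfl : n = -1 ∨ n = 0 ∨ n = 1 := by omega
  · push_cast at hn
    right; left
    constructor <;> linarith [hθ.1, hθ'.2]
  · left; simpa using hn
  · push_cast at hn
    right; right
    constructor <;> linarith [hθ.2, hθ'.1]

variable {Y : Type} [TopologicalSpace Y]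

/-- A continuous function of polar coordinates that respects the identifications gives a continuous
function on the disc. -/
theorem exists_disc_map (hg : 0 < g) (Φ : C(ℝ × ℝ, Y))
    (h0 : ∀ θ ∈ Set.Icc (0 : ℝ) (4 * g), Φ (0, θ) = Φ (0, 0))
    (hp : ∀ r ∈ Set.Icc (0 : ℝ) 1, Φ (r, 4 * g) = Φ (r, 0)) :
    ∃ F : C(Disc, Y), ∀ r ∈ Set.Icc (0 : ℝ) 1, ∀ θ ∈ Set.Icc (0 : ℝ) (4 * g),
      F (polar g (r, θ)) = Φ (r, θ) := by
  let π : C(Rect g, Disc) := ⟨fun p => polar g (p.1, p.2), by fun_prop⟩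
  -- A continuous surjection from a compact space to a Hausdorff space is a quotient map.
  have hπ : Topology.IsQuotientMap π :=
    .of_surjective_continuous (exists_polar hg) π.continuous
  have key (p p' : Rect g) (h : π p = π p') : Φ (p.1, p.2) = Φ (p'.1, p'.2) := by
    obtain ⟨h1, h2⟩ := polar_eq hg h
    rw [← h1]
    rcases h2 with h2 | h2 | ⟨h2, h3⟩ | ⟨h2, h3⟩
    · rw [h2, h0 _ p.2.2, h0 _ p'.2.2]
    · rw [h2]
    · rw [h2, h3, hp _ p.1.2]
    · rw [h2, h3, hp _ p.1.2]
  let F : Disc → Y := fun z => Φ ((exists_polar hg z).choose.1, (exists_polar hg z).choose.2)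
  have hF (p : Rect g) : F (π p) = Φ (p.1, p.2) := key _ _ (exists_polar hg (π p)).choose_spec
  refine ⟨⟨F, hπ.continuous_iff.2 ?_⟩, fun r hr θ hθ => hF (⟨r, hr⟩, ⟨θ, hθ⟩)⟩
  rw [show F ∘ π = fun p : Rect g => Φ (p.1, p.2) from funext hF]
  fun_prop

/-- The projection of the disc to the surface. -/
def quo (g : ℕ) : C(Disc, GenusSurface g) := ⟨Quot.mk _, continuous_quot_mk⟩

theorem exists_quo_polar (hg : 0 < g) (x : GenusSurface g) :
    ∃ r ∈ Set.Icc (0 : ℝ) 1, ∃ θ ∈ Set.Icc (0 : ℝ) (4 * g), x = quo g (polar g (r, θ)) := by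
  obtain ⟨z, rfl⟩ := Quot.exists_rep x
  obtain ⟨p, rfl⟩ := exists_polar hg z
  exact ⟨_, p.1.2, _, p.2.2, rfl⟩

theorem side_mem {j i : ℕ} (hj : j < g) (hi : i < 2) {s : ℝ} (hs : s ∈ Set.Icc (0 : ℝ) 1) :
    ((4 * j + i : ℕ) + s) ∈ Set.Icc (0 : ℝ) (4 * g) ∧
      ((4 * j + i : ℕ) + 3 - s) ∈ Set.Icc (0 : ℝ) (4 * g) := by
  have h1 : ((4 * j + i : ℕ) : ℝ) + 3 ≤ 4 * g := by
    exact_mod_cast (by omega : 4 * j + i + 3 ≤ 4 * g)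
  have h2 : (0 : ℝ) ≤ ((4 * j + i : ℕ) : ℝ) := Nat.cast_nonneg _
  obtain ⟨h3, h4⟩ := hs
  exact ⟨⟨by linarith, by linarith⟩, ⟨by linarith, by linarith⟩⟩

theorem quo_side {j i : ℕ} (hj : j < g) (hi : i < 2) {s : ℝ} (hs : s ∈ Set.Icc (0 : ℝ) 1) :
    quo g (polar g (1, (4 * j + i : ℕ) + s)) = quo g (polar g (1, (4 * j + i : ℕ) + 3 - s)) :=
  Quot.sound ⟨j, hj, i, hi, s, hs, coe_polar_one _, coe_polar_one _⟩

/-- A continuous function of polar coordinates that respects the identifications gives a continuous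
function on the surface. -/
theorem exists_surface_map (hg : 0 < g) (Φ : C(ℝ × ℝ, Y))
    (h0 : ∀ θ ∈ Set.Icc (0 : ℝ) (4 * g), Φ (0, θ) = Φ (0, 0))
    (hp : ∀ r ∈ Set.Icc (0 : ℝ) 1, Φ (r, 4 * g) = Φ (r, 0))
    (hs : ∀ j < g, ∀ i < 2, ∀ s ∈ Set.Icc (0 : ℝ) 1,
      Φ (1, (4 * j + i : ℕ) + s) = Φ (1, (4 * j + i : ℕ) + 3 - s)) :
    ∃ F : C(GenusSurface g, Y), ∀ r ∈ Set.Icc (0 : ℝ) 1, ∀ θ ∈ Set.Icc (0 : ℝ) (4 * g),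
      F (quo g (polar g (r, θ))) = Φ (r, θ) := by
  obtain ⟨F, hF⟩ := exists_disc_map hg Φ h0 hp
  refine ⟨⟨Quot.lift F ?_, continuous_quot_lift _ F.continuous⟩, hF⟩
  rintro z w ⟨j, hj, i, hi, s, hs', hz, hw⟩
  obtain ⟨m1, m2⟩ := side_mem hj hi hs'
  have e1 : z = polar g (1, (4 * j + i : ℕ) + s) := Subtype.ext (hz.trans (coe_polar_one _).symm)
  have e2 : w = polar g (1, (4 * j + i : ℕ) + 3 - s) :=
    Subtype.ext (hw.trans (coe_polar_one _).symm)
  rw [e1, e2, hF 1 ⟨zero_le_one, le_rfl⟩ _ m1, hF 1 ⟨zero_le_one, le_rfl⟩ _ m2, hs j hj i hi s hs']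

/-! ### Stretching the sides -/

/-- The function that contracts a neighbourhood of every vertex and stretches the rest of every
side. -/
def stretch (g : ℕ) (θ : ℝ) : ℝ := ∑ k ∈ Finset.range (4 * g), cl (2 * (θ - k) - 1 / 2)

@[fun_prop] theorem continuous_stretch : Continuous (stretch g) := by
  unfold stretch
  fun_prop

/-- On side `k` the earlier summands have reached `1` and the later ones are still `0`. The
surviving summand is constant on the first and the last quarter of the side. -/
theorem stretch_side {k : ℕ} (hk : k < 4 * g) {s : ℝ} (hs : s ∈ Set.Icc (0 : ℝ) 1) :
    stretch g (k + s) = k + cl (2 * s - 1 / 2) := by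
  obtain ⟨m, hm⟩ := Nat.exists_eq_add_of_lt hk
  obtain ⟨hs0, hs1⟩ := hs
  rw [stretch, hm, show k + m + 1 = k + 1 + m by omega, Finset.sum_range_add, Finset.sum_range_succ]
  have h1 : ∑ x ∈ Finset.range k, cl (2 * ((k : ℝ) + s - x) - 1 / 2) =
      ∑ x ∈ Finset.range k, (1 : ℝ) := by
    refine Finset.sum_congr rfl fun x hx => cl_of_ge ?_
    have : (x : ℝ) + 1 ≤ k := by exact_mod_cast Finset.mem_range.1 hx
    linarith
  have h2 : ∑ x ∈ Finset.range m, cl (2 * ((k : ℝ) + s - ((k + 1 + x : ℕ) : ℝ)) - 1 / 2) =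
      ∑ x ∈ Finset.range m, (0 : ℝ) := by
    refine Finset.sum_congr rfl fun x _ => cl_of_le ?_
    push_cast
    have : (0 : ℝ) ≤ x := Nat.cast_nonneg x
    linarith
  rw [h1, h2, add_sub_cancel_left]
  simp

theorem stretch_zero (hg : 0 < g) : stretch g 0 = 0 := by
  have := stretch_side (g := g) (k := 0) (by omega) (s := 0) ⟨le_rfl, zero_le_one⟩
  rw [Nat.cast_zero, add_zero, zero_add] at this
  rw [this, cl_of_le (by norm_num)]

theorem stretch_end (hg : 0 < g) : stretch g (4 * g) = 4 * g := by
  have := stretch_side (g := g) (k := 4 * g - 1) (by omega) (s := 1) ⟨zero_le_one, le_rfl⟩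
  rw [Nat.cast_sub (by omega)] at this
  push_cast at this
  rw [cl_of_ge (by norm_num), sub_add_cancel] at this
  exact this

/-- The radius is expanded by `1 + 3t`, which at `t = 1` brings everything with radius at least `1 /
4` to the boundary. The parameter `c` turns the stretching of the sides on or off. Stretching
commutes with the reversal of a side, so the deformation respects the gluing throughout. -/
theorem exists_deform (hg : 0 < g) {c : ℝ} (hc : c ∈ Set.Icc (0 : ℝ) 1) :
    ∃ F : C(GenusSurface g, GenusSurface g), (ContinuousMap.id _).Homotopic F ∧
      ∀ r ∈ Set.Icc (0 : ℝ) 1, ∀ θ ∈ Set.Icc (0 : ℝ) (4 * g),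
        F (quo g (polar g (r, θ))) =
          quo g (polar g (4 * r, (1 - c) * θ + c * stretch g θ)) := by
  let Ψ : C((ℝ × ℝ) × unitInterval, GenusSurface g) :=
    (quo g).comp ((polar g).comp ⟨fun p => ((1 + 3 * p.2) * p.1.1,
      (1 - c * p.2) * p.1.2 + c * p.2 * stretch g p.1.2), by fun_prop⟩)
  have hΨ (r θ : ℝ) (t : unitInterval) : Ψ ((r, θ), t) = quo g (polar g ((1 + 3 * t) * r,
      (1 - c * t) * θ + c * t * stretch g θ)) := rfl
  -- The whole homotopy descends at once, as a map from the surface to the space of paths.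
  obtain ⟨F, hF⟩ := exists_surface_map hg Ψ.curry
    (fun θ _ => ContinuousMap.ext fun t => by
      rw [ContinuousMap.curry_apply, ContinuousMap.curry_apply, hΨ, hΨ]
      exact congrArg _ (polar_zero (by simp) (by simp) _ _))
    (fun r _ => ContinuousMap.ext fun t => by
      rw [ContinuousMap.curry_apply, ContinuousMap.curry_apply, hΨ, hΨ, stretch_zero hg,
        stretch_end hg, ← add_mul, sub_add_cancel, one_mul, mul_zero, mul_zero, add_zero,
        polar_period hg])
    (fun j hj i hi s hs => ContinuousMap.ext fun t => by
      have hs' : 1 - s ∈ Set.Icc (0 : ℝ) 1 := ⟨by linarith [hs.2], by linarith [hs.1]⟩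
      have e1 := stretch_side (g := g) (k := 4 * j + i) (by omega) hs
      have e2 := stretch_side (g := g) (k := 4 * j + i + 2) (by omega) hs'
      have e3 : cl (2 * (1 - s) - 1 / 2) = 1 - cl (2 * s - 1 / 2) := by
        rw [← cl_one_sub]
        congr 1
        ring
      have e4 : ((4 * j + i : ℕ) : ℝ) + 3 - s = ((4 * j + i + 2 : ℕ) : ℝ) + (1 - s) := by
        push_cast
        ring
      have hr : cl ((1 + 3 * (t : ℝ)) * 1) = cl 1 := by
        rw [cl_of_ge le_rfl, cl_of_ge (by linarith [t.2.1])]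
      have hct : c * t ∈ Set.Icc (0 : ℝ) 1 :=
        ⟨mul_nonneg hc.1 t.2.1, mul_le_one₀ hc.2 t.2.1 t.2.2⟩
      have hm : (1 - c * t) * s + c * t * cl (2 * s - 1 / 2) ∈ Set.Icc (0 : ℝ) 1 :=
        convex_Icc (0 : ℝ) 1 hs ⟨cl_nonneg _, cl_le_one _⟩ (sub_nonneg.2 hct.2) hct.1 (by ring)
      rw [ContinuousMap.curry_apply, ContinuousMap.curry_apply, hΨ, hΨ, e4, e1, e2, e3,
        polar_congr hr, polar_congr hr]
      refine Eq.trans ?_ ((quo_side hj hi hm).trans ?_) <;> congr 3 <;> push_cast <;> ring)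
  have hF' (t : unitInterval) (r : ℝ) (hr : r ∈ Set.Icc (0 : ℝ) 1) (θ : ℝ)
      (hθ : θ ∈ Set.Icc (0 : ℝ) (4 * g)) : F (quo g (polar g (r, θ))) t =
        quo g (polar g ((1 + 3 * t) * r, (1 - c * t) * θ + c * t * stretch g θ)) :=
    DFunLike.congr_fun (hF r hr θ hθ) t
  refine ⟨⟨fun x => F x 1, by fun_prop⟩, ⟨⟨⟨fun p => F p.2 p.1, by fun_prop⟩, fun x => ?_,
    fun x => rfl⟩⟩, fun r hr θ hθ => ?_⟩
  · obtain ⟨r, hr, θ, hθ, rfl⟩ := exists_quo_polar hg x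
    refine (hF' 0 r hr θ hθ).trans ?_
    simp
  · refine (hF' 1 r hr θ hθ).trans ?_
    simp only [Set.Icc.coe_one, mul_one]
    norm_num

/-! ### The coordinate functions of the sides -/

/-- The function of the angle that runs once through the unit interval on the side with number `n`
and back on the side with number `n + 2`. -/
def sideFn (n : ℕ) (θ : ℝ) : ℝ := cl (θ - n) - cl (θ - (n + 2))

@[fun_prop] theorem continuous_sideFn (n : ℕ) : Continuous (sideFn n) := by
  unfold sideFn
  fun_prop

theorem sideFn_nat (n m : ℕ) :
    sideFn n m = if n + 1 ≤ m ∧ m ≤ n + 2 then 1 else 0 := by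
  rw [sideFn]
  rcases le_or_gt m n with h | h
  · have : (m : ℝ) ≤ n := by exact_mod_cast h
    rw [cl_of_le (by linarith), cl_of_le (by linarith), if_neg (by omega), sub_zero]
  · have h' : (n : ℝ) + 1 ≤ m := by exact_mod_cast h
    rw [cl_of_ge (by linarith)]
    rcases le_or_gt m (n + 2) with h2 | h2
    · have : (m : ℝ) ≤ n + 2 := by exact_mod_cast h2
      rw [cl_of_le (by linarith), if_pos ⟨h, h2⟩, sub_zero]
    · have : (n : ℝ) + 2 + 1 ≤ m := by exact_mod_cast h2
      rw [cl_of_ge (by linarith), if_neg (by omega), sub_self]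

theorem sideFn_self (n : ℕ) {s : ℝ} (hs : s ∈ Set.Icc (0 : ℝ) 1) :
    sideFn n (n + s) = s ∧ sideFn n (n + 3 - s) = s := by
  obtain ⟨h0, h1⟩ := hs
  constructor
  · rw [sideFn, add_sub_cancel_left, cl_of_mem ⟨h0, h1⟩, cl_of_le (by linarith), sub_zero]
  · rw [sideFn, cl_of_ge (by linarith), show (n : ℝ) + 3 - s - (n + 2) = 1 - s by ring, cl_one_sub,
      cl_of_mem ⟨h0, h1⟩]
    ring

/-- On the sides of other pairs, the function is constant, with an integral value. -/
theorem sideFn_other {n k : ℕ} (h : k ≠ n) (h' : k ≠ n + 2) {s : ℝ} (hs : s ∈ Set.Icc (0 : ℝ) 1) :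
    ∃ z : ℤ, sideFn n (k + s) = z := by
  obtain ⟨h0, h1⟩ := hs
  have key (a : ℕ) (ha : k ≠ a) : ∃ z : ℤ, cl (k + s - a) = z := by
    rcases lt_or_gt_of_ne ha with h | h
    · have : (k : ℝ) + 1 ≤ a := by exact_mod_cast h
      exact ⟨0, by rw [cl_of_le (by linarith)]; simp⟩
    · have : (a : ℝ) + 1 ≤ k := by exact_mod_cast h
      exact ⟨1, by rw [cl_of_ge (by linarith)]; simp⟩
  obtain ⟨z, hz⟩ := key n h
  obtain ⟨z', hz'⟩ := key (n + 2) h'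
  exact ⟨z - z', by push_cast at hz'; rw [sideFn, hz, hz']; push_cast; rfl⟩

theorem coe_intCast (z : ℤ) : ((z : ℝ) : UnitAddCircle) = 0 :=
  AddCircle.coe_eq_zero_iff (1 : ℝ) |>.2 ⟨z, by simp⟩

/-- The number of the side with a given label. -/
def sideNo (l : Fin g × Fin 2) : ℕ := 4 * l.1 + l.2

theorem sideNo_lt (l : Fin g × Fin 2) : sideNo l + 3 ≤ 4 * g := by
  have h1 := l.1.2
  have h2 := l.2.2
  unfold sideNo
  omega

theorem sideNo_ne {l m : Fin g × Fin 2} (h : l ≠ m) :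
    sideNo m ≠ sideNo l ∧ sideNo m ≠ sideNo l + 2 ∧ sideNo m + 2 ≠ sideNo l := by
  obtain ⟨⟨a, ha⟩, ⟨b, hb⟩⟩ := l
  obtain ⟨⟨c, hc⟩, ⟨d, hd⟩⟩ := m
  have : ¬ (a = c ∧ b = d) := by
    rintro ⟨rfl, rfl⟩
    exact h rfl
  simp only [sideNo]
  omega

/-- The value of the coordinate function of a side on another side. -/
theorem sideFn_ne {l m : Fin g × Fin 2} (h : l ≠ m) {s : ℝ} (hs : s ∈ Set.Icc (0 : ℝ) 1) :
    (sideFn (sideNo l) (sideNo m + s) : UnitAddCircle) = 0 ∧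
      (sideFn (sideNo l) (sideNo m + 3 - s) : UnitAddCircle) = 0 := by
  obtain ⟨h1, h2, h3⟩ := sideNo_ne h
  constructor
  · obtain ⟨z, hz⟩ := sideFn_other h1 h2 hs
    rw [hz, coe_intCast]
  · obtain ⟨z, hz⟩ := sideFn_other (n := sideNo l) (k := sideNo m + 2) h3 (by omega)
      (s := 1 - s) ⟨by linarith [hs.2], by linarith [hs.1]⟩
    rw [show (sideNo m : ℝ) + 3 - s = ((sideNo m + 2 : ℕ) : ℝ) + (1 - s) by push_cast; ring, hz,
      coe_intCast]

theorem sideFn_zero (n : ℕ) : sideFn n 0 = 0 := by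
  have := sideFn_nat n 0
  rw [Nat.cast_zero] at this
  rw [this, if_neg (by omega)]

theorem sideFn_end (l : Fin g × Fin 2) : sideFn (sideNo l) (4 * g) = 0 := by
  have := sideFn_nat (sideNo l) (4 * g)
  push_cast at this
  rw [this, if_neg (by have := sideNo_lt l; omega)]

theorem exists_coord (hg : 0 < g) (l : Fin g × Fin 2) :
    ∃ F : C(GenusSurface g, UnitAddCircle), ∀ r ∈ Set.Icc (0 : ℝ) 1,
      ∀ θ ∈ Set.Icc (0 : ℝ) (4 * g),
        F (quo g (polar g (r, θ))) = ((r * sideFn (sideNo l) θ : ℝ) : UnitAddCircle) := by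
  refine exists_surface_map hg
    (lineProj.comp ⟨fun p => p.1 * sideFn (sideNo l) p.2, by fun_prop⟩) ?_ ?_ ?_
  · intro θ _
    simp
  · intro r _
    simp [sideFn_zero, sideFn_end]
  · intro j hj i hi s hs
    let m : Fin g × Fin 2 := (⟨j, hj⟩, ⟨i, hi⟩)
    simp only [ContinuousMap.comp_apply, ContinuousMap.coe_mk, lineProj_apply, one_mul]
    change ((sideFn (sideNo l) (sideNo m + s) : ℝ) : UnitAddCircle) =
      (sideFn (sideNo l) (sideNo m + 3 - s) : ℝ)
    by_cases h : l = m
    · rw [h, (sideFn_self _ hs).1, (sideFn_self _ hs).2]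
    · rw [(sideFn_ne h hs).1, (sideFn_ne h hs).2]

/-- The coordinate function of a side: it is a map from the surface to the circle of degree one on
this side, and it is constant on the other sides. -/
def coord (hg : 0 < g) (l : Fin g × Fin 2) : C(GenusSurface g, UnitAddCircle) :=
  (exists_coord hg l).choose

theorem coord_apply (hg : 0 < g) (l : Fin g × Fin 2) {r θ : ℝ} (hr : r ∈ Set.Icc (0 : ℝ) 1)
    (hθ : θ ∈ Set.Icc (0 : ℝ) (4 * g)) :
    coord hg l (quo g (polar g (r, θ))) = ((r * sideFn (sideNo l) θ : ℝ) : UnitAddCircle) :=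
  (exists_coord hg l).choose_spec r hr θ hθ

theorem exists_discCoord (hg : 0 < g) (l : Fin g × Fin 2) :
    ∃ F : C(Disc, ℝ), ∀ r ∈ Set.Icc (0 : ℝ) 1, ∀ θ ∈ Set.Icc (0 : ℝ) (4 * g),
      F (polar g (r, θ)) = r * sideFn (sideNo l) θ := by
  refine exists_disc_map hg ⟨fun p => p.1 * sideFn (sideNo l) p.2, by fun_prop⟩ ?_ ?_
  · intro θ _
    simp
  · intro r _
    simp [sideFn_zero, sideFn_end]

/-- The lift to the line of the coordinate function of a side, on the disc. -/
def discCoord (hg : 0 < g) (l : Fin g × Fin 2) : C(Disc, ℝ) := (exists_discCoord hg l).choose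

theorem discCoord_apply (hg : 0 < g) (l : Fin g × Fin 2) {r θ : ℝ} (hr : r ∈ Set.Icc (0 : ℝ) 1)
    (hθ : θ ∈ Set.Icc (0 : ℝ) (4 * g)) :
    discCoord hg l (polar g (r, θ)) = r * sideFn (sideNo l) θ :=
  (exists_discCoord hg l).choose_spec r hr θ hθ

theorem lineProj_discCoord (hg : 0 < g) (l : Fin g × Fin 2) :
    lineProj.comp (discCoord hg l) = (coord hg l).comp (quo g) := by
  ext z
  obtain ⟨p, rfl⟩ := exists_polar hg z
  rw [ContinuousMap.comp_apply, ContinuousMap.comp_apply, discCoord_apply hg l p.1.2 p.2.2,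
    coord_apply hg l p.1.2 p.2.2]
  rfl

/-! ### The loops given by the sides -/

theorem quo_vertex {k : ℕ} (hk : k ≤ 4 * g) :
    quo g (polar g (1, k)) = quo g (polar g (1, 0)) := by
  -- The gluings of one block identify `4j ~ 4j+3`, `4j+1 ~ 4j+2`, `4j+1 ~ 4j+4` and `4j+2 ~ 4j+3`.
  -- So its five vertices coincide, and consecutive blocks share a vertex.
  have step {j i a b : ℕ} (hj : j < g) (hi : i < 2) (ha : a = 4 * j + i) (hb : b = a + 3) :
      quo g (polar g (1, a)) = quo g (polar g (1, b)) ∧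
        quo g (polar g (1, (a + 1 : ℕ))) = quo g (polar g (1, (a + 2 : ℕ))) := by
    subst ha hb
    have h0 := quo_side hj hi (s := 0) ⟨le_rfl, zero_le_one⟩
    have h1 := quo_side hj hi (s := 1) ⟨zero_le_one, le_rfl⟩
    rw [add_zero, sub_zero] at h0
    rw [add_sub_assoc, show (3 : ℝ) - 1 = 2 by norm_num] at h1
    constructor
    · rw [Nat.cast_add _ 3]
      exact h0
    · rw [Nat.cast_add _ 1, Nat.cast_add _ 2]
      simpa using h1
  have all {j : ℕ} (hj : j < g) (b : ℕ) (hb : b ≤ 4) :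
      quo g (polar g (1, (4 * j + b : ℕ))) = quo g (polar g (1, (4 * j : ℕ))) := by
    have h0 := step hj (i := 0) (by omega) rfl rfl
    have h1 := step hj (i := 1) (by omega) rfl rfl
    simp only [add_zero, add_assoc, Nat.reduceAdd] at h0 h1
    interval_cases b
    · rfl
    · exact h0.2.trans (h1.2.trans h0.1.symm)
    · exact h1.2.trans h0.1.symm
    · exact h0.1.symm
    · exact h1.1.symm.trans (h0.2.trans (h1.2.trans h0.1.symm))
  have base (j : ℕ) (hj : j ≤ g) :
      quo g (polar g (1, (4 * j : ℕ))) = quo g (polar g (1, 0)) := by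
    induction j with
    | zero => simp
    | succ j ih => exact (all hj 4 le_rfl).trans (ih (by omega))
  rcases eq_or_lt_of_le hk with rfl | hk'
  · exact base g le_rfl
  · have := all (j := k / 4) (by omega) (k % 4) (by omega)
    rw [Nat.div_add_mod] at this
    exact this.trans (base _ (by omega))

theorem exists_loop (l : Fin g × Fin 2) :
    ∃ γ : C(UnitAddCircle, GenusSurface g), ∀ s ∈ Set.Icc (0 : ℝ) 1,
      γ (s : UnitAddCircle) = quo g (polar g (1, sideNo l + s)) := by
  have h := sideNo_lt l
  let f : ℝ → GenusSurface g := fun s => quo g (polar g (1, sideNo l + s))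
  have hf : f 0 = f (0 + 1) := by
    have h0 := quo_vertex (g := g) (k := sideNo l) (by omega)
    have h1 := quo_vertex (g := g) (k := sideNo l + 1) (by omega)
    push_cast at h1
    simp only [f, add_zero, zero_add, h0, h1]
  have hc : Continuous f := by fun_prop
  refine ⟨⟨AddCircle.liftIco 1 0 f, AddCircle.liftIco_continuous hf hc.continuousOn⟩, ?_⟩
  intro s hs
  rcases hs.2.lt_or_eq with h1 | rfl
  · exact AddCircle.liftIco_coe_apply (f := f) ⟨hs.1, by simpa using h1⟩
  · have e : ((1 : ℝ) : UnitAddCircle) = ((0 : ℝ) : UnitAddCircle) := AddCircle.coe_period 1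
    rw [e]
    refine (AddCircle.liftIco_coe_apply (f := f) (by simp)).trans (hf.trans ?_)
    simp only [f, zero_add]

/-- The loop on the surface given by a side. -/
def sideLoop (l : Fin g × Fin 2) : C(UnitAddCircle, GenusSurface g) :=
  (exists_loop l).choose

theorem sideLoop_apply (l : Fin g × Fin 2) {s : ℝ} (hs : s ∈ Set.Icc (0 : ℝ) 1) :
    sideLoop l s = quo g (polar g (1, sideNo l + s)) :=
  (exists_loop l).choose_spec s hs

theorem exists_coe (t : UnitAddCircle) : ∃ s ∈ Set.Icc (0 : ℝ) 1, (s : UnitAddCircle) = t := by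
  obtain ⟨s, hs, rfl⟩ := AddCircle.eq_coe_Ico t
  exact ⟨s, ⟨hs.1, hs.2.le⟩, rfl⟩

theorem sideLoop_zero (l : Fin g × Fin 2) :
    sideLoop l 0 = quo g (polar g (1, 0)) := by
  have := sideLoop_apply l (s := 0) ⟨le_rfl, zero_le_one⟩
  rw [add_zero, quo_vertex (by have := sideNo_lt l; omega)] at this
  exact this

theorem side_mem' (l : Fin g × Fin 2) {s : ℝ} (hs : s ∈ Set.Icc (0 : ℝ) 1) :
    (sideNo l : ℝ) + s ∈ Set.Icc (0 : ℝ) (4 * g) :=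
  (side_mem l.1.2 l.2.2 hs).1

theorem coord_sideLoop_self (hg : 0 < g) (l : Fin g × Fin 2) :
    (coord hg l).comp (sideLoop l) = .id _ := by
  ext t
  obtain ⟨s, hs, rfl⟩ := exists_coe t
  rw [ContinuousMap.comp_apply, sideLoop_apply l hs,
    coord_apply hg l ⟨zero_le_one, le_rfl⟩ (side_mem' l hs), one_mul, (sideFn_self _ hs).1]
  rfl

theorem coord_sideLoop_ne (hg : 0 < g) (l m : Fin g × Fin 2) (h : l ≠ m) :
    (coord hg l).comp (sideLoop m) = .const _ 0 := by
  ext t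
  obtain ⟨s, hs, rfl⟩ := exists_coe t
  rw [ContinuousMap.comp_apply, sideLoop_apply m hs,
    coord_apply hg l ⟨zero_le_one, le_rfl⟩ (side_mem' m hs), one_mul, (sideFn_ne h hs).1]
  rfl

/-- The boundary of the polygon is covered by the side loops. -/
theorem exists_sideLoop (hg : 0 < g) {θ : ℝ} (hθ : θ ∈ Set.Icc (0 : ℝ) (4 * g)) :
    ∃ l : Fin g × Fin 2, ∃ s ∈ Set.Icc (0 : ℝ) 1,
      quo g (polar g (1, θ)) = quo g (polar g (1, sideNo l + s)) := by
  obtain ⟨k, hk, s, hs, rfl⟩ : ∃ k < 4 * g, ∃ s ∈ Set.Icc (0 : ℝ) 1, θ = (k : ℝ) + s := by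
    rcases hθ.2.lt_or_eq with h | h
    · refine ⟨⌊θ⌋₊, (Nat.floor_lt hθ.1).2 (by exact_mod_cast h), θ - ⌊θ⌋₊,
        ⟨by linarith [Nat.floor_le hθ.1], by linarith [Nat.lt_floor_add_one θ]⟩, by ring⟩
    · refine ⟨4 * g - 1, by omega, 1, ⟨zero_le_one, le_rfl⟩, ?_⟩
      rw [Nat.cast_sub (by omega), h]
      push_cast
      ring
  by_cases hk' : k % 4 < 2
  · refine ⟨(⟨k / 4, by omega⟩, ⟨k % 4, hk'⟩), s, hs, ?_⟩
    rw [sideNo, Nat.div_add_mod]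
  · refine ⟨(⟨k / 4, by omega⟩, ⟨k % 4 - 2, by omega⟩), 1 - s,
      ⟨by linarith [hs.2], by linarith [hs.1]⟩, ?_⟩
    have e := quo_side (g := g) (j := k / 4) (i := k % 4 - 2) (by omega) (by omega) (s := 1 - s)
      ⟨by linarith [hs.2], by linarith [hs.1]⟩
    have hk2 : (4 * (k / 4) + (k % 4 - 2) : ℕ) + 2 = k := by omega
    have hk3 : ((4 * (k / 4) + (k % 4 - 2) : ℕ) : ℝ) + 2 = k := by exact_mod_cast hk2
    rw [sideNo]
    refine Eq.trans ?_ e.symm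
    rw [← hk3]
    congr 3
    ring

/-! ### The decomposition of the surface into a disc and a neighbourhood of the sides -/

theorem exists_radius (hg : 0 < g) :
    ∃ N : C(GenusSurface g, ℝ), ∀ r ∈ Set.Icc (0 : ℝ) 1, ∀ θ ∈ Set.Icc (0 : ℝ) (4 * g),
      N (quo g (polar g (r, θ))) = r :=
  exists_surface_map hg ⟨Prod.fst, continuous_fst⟩ (fun _ _ => rfl) (fun _ _ => rfl)
    (fun _ _ _ _ _ _ => rfl)

/-- For `r ≤ 1 / 2` this is the expansion by `4`, now with values in the disc. The factor `1 - r`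
sends the whole rim to the centre, so that the map is defined on all of the surface. -/
theorem exists_expand (hg : 0 < g) :
    ∃ M : C(GenusSurface g, Disc), ∀ r ∈ Set.Icc (0 : ℝ) 1, ∀ θ ∈ Set.Icc (0 : ℝ) (4 * g),
      M (quo g (polar g (r, θ))) = polar g (4 * min r (1 - r), θ) :=
  exists_surface_map hg ((polar g).comp ⟨fun p => (4 * min p.1 (1 - p.1), p.2), by fun_prop⟩)
    (fun θ _ => polar_zero (by simp) (by simp) _ _) (fun r _ => polar_period hg _)
    (fun j _ i _ s _ => polar_zero (by simp) (by simp) _ _)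

/-- The boundary of the disc. -/
def rim : C(UnitAddCircle, Disc) :=
  ⟨fun t => ⟨(AddCircle.toCircle t : ℂ), by simp [Circle.norm_coe]⟩, by
    exact Continuous.subtype_mk (continuous_subtype_val.comp AddCircle.continuous_toCircle) _⟩

theorem rim_coe (hg : 0 < g) (s : ℝ) : rim (s : UnitAddCircle) = polar g (1, 4 * g * s) := by
  refine Subtype.ext ?_
  rw [coe_polar_one, polygonPoint, mul_div_cancel_left₀ _ (by positivity)]
  change ((AddCircle.toCircle (s : UnitAddCircle) : Circle) : ℂ) = _
  rw [AddCircle.toCircle_apply_mk, Circle.coe_exp]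
  push_cast
  ring_nf

theorem exists_rim {z : Disc} (hz : ‖(z : ℂ)‖ = 1) :
    rim ((AddCircle.homeomorphCircle one_ne_zero).symm ⟨z, mem_sphere_zero_iff_norm.2 hz⟩) = z := by
  refine Subtype.ext ?_
  change ((AddCircle.toCircle _ : Circle) : ℂ) = _
  rw [← AddCircle.homeomorphCircle_apply one_ne_zero]
  exact congrArg Subtype.val (Homeomorph.apply_symm_apply _ _)

theorem polar_one_of_le {r : ℝ} (h : 1 ≤ r) (θ : ℝ) : polar g (r, θ) = polar g (1, θ) :=
  polar_congr (by rw [cl_of_ge h, cl_of_ge le_rfl]) θ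

/-- The hypothesis puts `s` within `1 / 4` of an integer, where the stretched parameter has already
reached an end of the side. -/
theorem sideLoop_eq_zero_of_norm_lt (l : Fin g × Fin 2) {s : ℝ}
    (h : ‖(s : UnitAddCircle)‖ < 1 / 4) :
    sideLoop l (cl (2 * s - 1 / 2) : ℝ) = quo g (polar g (1, 0)) := by
  rw [UnitAddCircle.norm_eq, abs_lt] at h
  rcases le_or_gt (round s) 0 with h0 | h0
  · have : ((round s : ℤ) : ℝ) ≤ 0 := by exact_mod_cast h0
    rw [cl_of_le (by linarith [h.2])]
    exact sideLoop_zero l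
  · have : (1 : ℝ) ≤ ((round s : ℤ) : ℝ) := by exact_mod_cast h0
    rw [cl_of_ge (by linarith [h.1]), AddCircle.coe_period]
    exact sideLoop_zero l

/-- The sets are `O = {r < 1/2}` and `W = {r > 1/4}`. The map `ρ` expands by `4` and so retracts `W`
to the sides; `ρ₁` also stretches the sides, and its restriction to `W` serves as `G`. -/
theorem exists_data (hg : 0 < g) : ∃ (O W : Set (GenusSurface g))
    (ρ : C(GenusSurface g, GenusSurface g)) (l : C(O, Disc)) (η : C(↑(O ∩ W), UnitAddCircle))
    (β' : C(UnitAddCircle, W)) (ρ' : C(W, W)) (U : Fin g × Fin 2 → Set W)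
    (G : C(W, GenusSurface g)),
    (IsOpen O ∧ IsOpen W ∧ O ∪ W = Set.univ ∧ ρ.Homotopic (.id _) ∧
      (quo g).comp l = ρ.comp (incl O) ∧ rim.comp η = l.comp (inclLE Set.inter_subset_left) ∧
      (incl W).comp β' = (quo g).comp rim ∧ (incl W).comp ρ' = ρ.comp (incl W)) ∧
    ((∀ i, IsOpen (U i)) ∧ (∀ x, ∃ i, x ∈ U i) ∧
      (∀ i, ∀ x ∈ U i, G x ∈ Set.range (sideLoop i)) ∧ (incl W).Homotopic G) := by
  obtain ⟨N, hN⟩ := exists_radius hg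
  obtain ⟨M, hM⟩ := exists_expand hg
  obtain ⟨ρ, hρi, hρ⟩ := exists_deform hg (c := 0) (by simp)
  obtain ⟨ρ₁, hρi₁, hρ₁⟩ := exists_deform hg (c := 1) (by simp)
  simp only [sub_zero, one_mul, zero_mul, add_zero] at hρ
  simp only [sub_self, one_mul, zero_mul, zero_add] at hρ₁
  let O : Set (GenusSurface g) := {x | N x < 1 / 2}
  let W : Set (GenusSurface g) := {x | 1 / 4 < N x}
  have hMρ (x : GenusSurface g) (hx : x ∈ O) : quo g (M x) = ρ x := by
    obtain ⟨r, hr, θ, hθ, rfl⟩ := exists_quo_polar hg x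
    have : r < 1 / 2 := hN r hr θ hθ ▸ hx
    rw [hM r hr θ hθ, hρ r hr θ hθ, min_eq_left (by linarith)]
  have hM1 (x : GenusSurface g) (hx : x ∈ O) (hx' : x ∈ W) : ‖(M x : ℂ)‖ = 1 := by
    obtain ⟨r, hr, θ, hθ, rfl⟩ := exists_quo_polar hg x
    have h1 : r < 1 / 2 := hN r hr θ hθ ▸ hx
    have h2 : 1 / 4 < r := hN r hr θ hθ ▸ hx'
    rw [hM r hr θ hθ, min_eq_left (by linarith), norm_polar, cl_of_ge (by linarith)]
  have hside (x : GenusSurface g) (hx : x ∈ W) :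
      ∃ m, ∃ s ∈ Set.Icc (0 : ℝ) 1, ρ x = sideLoop m s ∧
        ρ₁ x = sideLoop m (cl (2 * s - 1 / 2) : ℝ) ∧ N (ρ x) = 1 := by
    obtain ⟨r, hr, θ, hθ, rfl⟩ := exists_quo_polar hg x
    have h2 : 1 / 4 < r := hN r hr θ hθ ▸ hx
    have h1 : (1 : ℝ) ∈ Set.Icc (0 : ℝ) 1 := ⟨zero_le_one, le_rfl⟩
    have h4 : (1 : ℝ) ≤ 4 * r := by linarith
    obtain ⟨m, s, hs, e⟩ := exists_sideLoop hg hθ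
    refine ⟨m, s, hs, ?_, ?_, ?_⟩
    · rw [sideLoop_apply m hs, ← e, hρ r hr θ hθ, polar_one_of_le h4]
    · have := congrArg ρ₁ e
      rw [hρ₁ 1 h1 θ hθ, hρ₁ 1 h1 _ (side_mem' m hs), polar_one_of_le (r := 4 * 1) (by norm_num),
        polar_one_of_le (r := 4 * 1) (by norm_num),
        stretch_side (by have := sideNo_lt m; omega) hs] at this
      rw [sideLoop_apply m ⟨cl_nonneg _, cl_le_one _⟩, ← this, hρ₁ r hr θ hθ,
        polar_one_of_le h4]
    · rw [hρ r hr θ hθ, polar_one_of_le h4, hN 1 h1 θ hθ]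
  have hβW (t : UnitAddCircle) : quo g (rim t) ∈ W := by
    obtain ⟨s, hs, rfl⟩ := exists_coe t
    rw [rim_coe hg]
    change 1 / 4 < N _
    rw [hN 1 ⟨zero_le_one, le_rfl⟩ _ ⟨by have := hs.1; positivity,
      mul_le_of_le_one_right (by positivity) hs.2⟩]
    norm_num
  have hρW (x : W) : ρ x ∈ W := by
    obtain ⟨m, s, -, -, -, h⟩ := hside x x.2
    change 1 / 4 < N _
    rw [h]
    norm_num
  refine ⟨O, W, ρ, M.comp (incl O),
    ⟨fun x => (AddCircle.homeomorphCircle one_ne_zero).symm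
      ⟨M x, mem_sphere_zero_iff_norm.2 (hM1 x x.2.1 x.2.2)⟩,
      (Homeomorph.continuous _).comp (Continuous.subtype_mk (continuous_subtype_val.comp
        (M.continuous.comp continuous_subtype_val)) _)⟩,
    ⟨fun t => ⟨quo g (rim t), hβW t⟩, ((quo g).comp rim).continuous.subtype_mk hβW⟩,
    ⟨fun x => ⟨ρ x, hρW x⟩, (ρ.comp (incl W)).continuous.subtype_mk hρW⟩,
    -- The set `U l` asks that the image under `ρ` be near the vertex in all coordinates but `l`. A
    -- point of any other side that satisfies this is collapsed to the vertex by the stretching, so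
    -- `G` maps `U l` to the `l`-th loop.
    fun l => {x | ∀ m, m ≠ l → ‖coord hg m (ρ x)‖ < 1 / 4}, ρ₁.comp (incl W),
    ⟨?_, ?_, ?_, hρi.symm, ?_, ?_, rfl, rfl⟩, ⟨?_, ?_, ?_, ?_⟩⟩
  · exact isOpen_lt (by fun_prop) (by fun_prop)
  · exact isOpen_lt (by fun_prop) (by fun_prop)
  · refine Set.eq_univ_of_forall fun x => ?_
    rcases lt_or_ge (N x) (1 / 2) with h | h
    · exact Or.inl h
    · exact Or.inr (lt_of_lt_of_le (by norm_num) h)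
  · ext x
    exact hMρ x x.2
  · ext x : 1
    exact exists_rim (hM1 x x.2.1 x.2.2)
  · intro l
    simp only [Set.ofPred_forall]
    exact isOpen_iInter_of_finite fun m => isOpen_iInter_of_finite fun _ =>
      isOpen_lt (by fun_prop) (by fun_prop)
  · intro x
    obtain ⟨m, s, hs, h, -⟩ := hside x x.2
    refine ⟨m, fun m' hm' => ?_⟩
    rw [h, ← ContinuousMap.comp_apply, coord_sideLoop_ne hg _ _ hm', ContinuousMap.const_apply,
      norm_zero]
    norm_num
  · intro l x hx
    obtain ⟨m, s, hs, h, h', -⟩ := hside x x.2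
    change ρ₁ x ∈ _
    by_cases hm : m = l
    · exact ⟨_, hm ▸ h'.symm⟩
    · have := hx m hm
      rw [h, ← ContinuousMap.comp_apply, coord_sideLoop_self] at this
      rw [h', sideLoop_eq_zero_of_norm_lt m this]
      exact ⟨0, sideLoop_zero l⟩
  · exact hρi₁.comp (.refl (incl W))

theorem chain_one (hg : 0 < g) {c : SChain (GenusSurface g) 1} (hc : sbd _ 0 c = 0) :
    ∃ (m : Fin g × Fin 2 → ℤ) (w : _), sbd _ 1 w =
      c - ∑ j, m j • sgl ((sideLoop j).comp circ) := by
  obtain ⟨O, W, ρ, l, η, β', ρ', U, G, ⟨hO, hW, hOW, hρ, hl, hη, hβ', hρ'⟩, hU, hcov, hG, hGi⟩ :=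
    exists_data hg
  obtain ⟨z, hz, w, hw⟩ := excise_one hO hW hOW hρ hl hη hβ' hρ' hc
  obtain ⟨m, w', hw'⟩ := carried_one (coord_sideLoop_self hg) (coord_sideLoop_ne hg) hU hcov hG hGi
    hz
  exact ⟨m, w + w', by rw [map_add, hw, hw']; abel⟩

theorem chain_two (hg : 0 < g) {f : SChain UnitAddCircle 1} {v : _}
    (hf : sbd _ 1 v = f - sgl circ) (hf0 : push 1 ((quo g).comp rim) f = 0) {F : SChain Disc 2}
    (hF : sbd Disc 1 F = push 1 rim f) {c : SChain (GenusSurface g) 2} (hc : sbd _ 1 c = 0) :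
    ∃ (d : ℤ) (w : _), sbd _ 2 w = c - d • push 2 (quo g) F := by
  obtain ⟨O, W, ρ, l, η, β', ρ', U, G, ⟨hO, hW, hOW, hρ, hl, hη, hβ', hρ'⟩, hU, hcov, hG, hGi⟩ :=
    exists_data hg
  obtain ⟨d, z, hz, w, hw⟩ := excise_two hO hW hOW hρ hl hη hβ' hρ' hf hf0 hF hc
  obtain ⟨w', hw'⟩ := carried_two (coord_sideLoop_self hg) (coord_sideLoop_ne hg)
    (sideLoop_zero) hU hcov hG hGi hz
  exact ⟨d, w + w', by rw [map_add, hw, hw']; abel⟩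

/-! ### The fundamental cycle of the surface -/

/-- The singular simplex of the line given by a segment. -/
def segment (a b : ℝ) : C(Spx 1, ℝ) :=
  ⟨fun x => a + x 1 * (b - a), by
    have : Continuous fun x : Spx 1 => x 1 := (continuous_apply 1).comp continuous_subtype_val
    exact continuous_const.add (this.mul continuous_const)⟩

theorem segment_zero (a b : ℝ) : segment a b (stdSimplex.vertex 0) = a := by
  change a + (stdSimplex.vertex 0 : Spx 1) 1 * (b - a) = a
  rw [vertex_of_ne (by decide), zero_mul, add_zero]

theorem segment_one (a b : ℝ) : segment a b (stdSimplex.vertex 1) = b := by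
  change a + (stdSimplex.vertex 1 : Spx 1) 1 * (b - a) = b
  rw [vertex_self]
  ring

/-- The arc of the circle from the point with number `a` to the point with number `b`, of the `4g`
points of a regular subdivision. -/
def arc (g a b : ℕ) : C(Spx 1, UnitAddCircle) := lineProj.comp (segment (a / (4 * g)) (b / (4 * g)))

theorem wind_arc (a b : ℕ) : wind (.id _) (sgl (arc g a b)) = (b - a : ℝ) / (4 * g) := by
  rw [wind_sgl (.id _) (F := segment (a / (4 * g)) (b / (4 * g))) rfl, segment_zero, segment_one,
    sub_div]

theorem rim_arc (hg : 0 < g) (a b : ℕ) (x : Spx 1) :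
    rim (arc g a b x) = polar g (1, a + x 1 * (b - a)) := by
  change rim ((a / (4 * g) + x 1 * (b / (4 * g) - a / (4 * g)) : ℝ) : UnitAddCircle) = _
  rw [rim_coe hg]
  congr 2
  field_simp

/-- The boundary of the polygon, subdivided in such a way that sides that are glued together
cancel. -/
def sides (g : ℕ) : SChain UnitAddCircle 1 :=
  ∑ l : Fin g × Fin 2, (sgl (arc g (sideNo l) (sideNo l + 1)) -
    sgl (arc g (sideNo l + 3) (sideNo l + 2)))

theorem sbd_arc (a b : ℕ) : sbd _ 0 (sgl (arc g a b)) =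
    sgl (pt ((b / (4 * g) : ℝ) : UnitAddCircle)) - sgl (pt ((a / (4 * g) : ℝ) : UnitAddCircle)) := by
  rw [sbd0_pt, arc, ContinuousMap.comp_apply, ContinuousMap.comp_apply, segment_zero, segment_one]
  rfl

theorem sbd_sides (hg : 0 < g) : sbd _ 0 (sides g) = 0 := by
  let V (k : ℕ) : SChain UnitAddCircle 0 := sgl (pt ((k / (4 * g) : ℝ) : UnitAddCircle))
  have hV : V (4 * g) = V 0 := by
    have : ((4 * g : ℕ) / (4 * g) : ℝ) = 1 := by
      push_cast
      exact div_self (by positivity)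
    simp only [V, this, Nat.cast_zero, zero_div, AddCircle.coe_period]
    rfl
  -- The four arcs of one handle have the boundary of a path from vertex `4j` to vertex `4j + 4`;
  -- the sum over `j` telescopes.
  have h (j : Fin g) : ∑ i : Fin 2, sbd _ 0 (sgl (arc g (sideNo (j, i)) (sideNo (j, i) + 1)) -
      sgl (arc g (sideNo (j, i) + 3) (sideNo (j, i) + 2))) =
        V (4 * (j + 1 : ℕ)) - V (4 * (j : ℕ)) := by
    rw [Fin.sum_univ_two, map_sub, map_sub, sbd_arc, sbd_arc, sbd_arc, sbd_arc]
    change V (4 * j + 0 + 1) - V (4 * j + 0) - (V (4 * j + 0 + 2) - V (4 * j + 0 + 3)) +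
      (V (4 * j + 1 + 1) - V (4 * j + 1) - (V (4 * j + 1 + 2) - V (4 * j + 1 + 3))) =
      V (4 * j + 4) - V (4 * j)
    simp only [add_zero, add_assoc, Nat.reduceAdd]
    abel
  rw [sides, map_sum, Fintype.sum_prod_type, Finset.sum_congr rfl fun j _ => h j,
    Fin.sum_univ_eq_sum_range (fun j => V (4 * (j + 1)) - V (4 * j)),
    Finset.sum_range_sub fun j => V (4 * j), hV, mul_zero, sub_self]

theorem wind_sides (hg : 0 < g) : wind (.id _) (sides g) = 1 := by
  have h : ∀ l : Fin g × Fin 2, wind (.id _) (sgl (arc g (sideNo l) (sideNo l + 1)) -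
      sgl (arc g (sideNo l + 3) (sideNo l + 2))) = (1 : ℝ) / (2 * g) := fun l => by
    rw [map_sub, wind_arc, wind_arc]
    push_cast
    field_simp
    ring
  rw [sides, map_sum, Finset.sum_congr rfl fun l _ => h l, Finset.sum_const, Finset.card_univ,
    Fintype.card_prod, Fintype.card_fin, Fintype.card_fin, nsmul_eq_mul]
  push_cast
  field_simp

/-- The chain `sides g` is homologous to some multiple of the loop, and the winding number shows
that the multiple is one. -/
theorem exists_sides_sub (hg : 0 < g) : ∃ v, sbd _ 1 v = sides g - sgl circ := by
  obtain ⟨m, v, hv⟩ := exists_circle_one (sbd_sides hg)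
  have h1 : wind (.id _) (sgl circ) = 1 := by
    have := windH_circleClass
    rwa [circleClass_eq, windH_scls] at this
  have h2 := congrArg (wind (.id _)) hv
  rw [wind_sbd, map_sub, wind_sides hg, map_zsmul, h1, zsmul_one] at h2
  have hm : m = 1 := by exact_mod_cast (sub_eq_zero.1 h2.symm).symm
  exact ⟨v, by rw [hv, hm, one_zsmul]⟩

/-- The second arc of each pair is traversed backwards, with sign `-1`, so glued sides become
literally the same simplex and cancel as chains, not merely up to homology. -/
theorem push_sides (hg : 0 < g) : push 1 ((quo g).comp rim) (sides g) = 0 := by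
  rw [sides, map_sum]
  refine Finset.sum_eq_zero fun l _ => ?_
  rw [map_sub, push_sgl, push_sgl, sub_eq_zero]
  congr 1
  ext x
  have hx : x 1 ∈ Set.Icc (0 : ℝ) 1 := ⟨x.2.1 1, stdSimplex.le_one x 1⟩
  have := quo_side l.1.2 l.2.2 hx
  rw [ContinuousMap.comp_apply, ContinuousMap.comp_apply, ContinuousMap.comp_apply,
    ContinuousMap.comp_apply, rim_arc hg, rim_arc hg]
  convert this using 3
  · rw [sideNo]
    push_cast
    ring_nf
  · rw [sideNo]
    push_cast
    ring_nf

theorem exists_discChain (hg : 0 < g) : ∃ F, sbd Disc 1 F = push 1 rim (sides g) :=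
  exists_sbd_eq (by rw [sbd_push, sbd_sides hg, map_zero])

/-- A chain of the disc whose boundary is the boundary of the polygon. -/
def discChain (hg : 0 < g) : SChain Disc 2 := (exists_discChain hg).choose

theorem sbd_discChain (hg : 0 < g) : sbd Disc 1 (discChain hg) = push 1 rim (sides g) :=
  (exists_discChain hg).choose_spec

theorem fundamental_cyc (hg : 0 < g) : sbd _ 1 (push 2 (quo g) (discChain hg)) = 0 := by
  rw [sbd_push, sbd_discChain, push_push, push_sides hg]

/-- The fundamental class of the surface. -/
def surfaceClass (hg : 0 < g) : singH 2 (GenusSurface g) :=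
  scls _ 1 ⟨push 2 (quo g) (discChain hg), fundamental_cyc hg⟩

theorem exists_eq_zsmul_surfaceClass (hg : 0 < g) (x : singH 2 (GenusSurface g)) :
    ∃ d : ℤ, x = d • surfaceClass hg := by
  obtain ⟨c, rfl⟩ := scls_surjective 1 x
  obtain ⟨v, hv⟩ := exists_sides_sub hg
  obtain ⟨d, w, hw⟩ := chain_two hg hv (push_sides hg) (sbd_discChain hg) c.2
  refine ⟨d, ?_⟩
  rw [surfaceClass, ← map_zsmul, ← sub_eq_zero, ← map_sub]
  exact scls_eq_zero_iff.2 ⟨w, hw⟩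

theorem loopClass_eq_sum (hg : 0 < g) (γ : C(UnitAddCircle, GenusSurface g)) :
    ∃ m : Fin g × Fin 2 → ℤ, loopClass γ = ∑ l, m l • loopClass (sideLoop l) := by
  obtain ⟨m, w, hw⟩ := chain_one hg (c := push 1 γ (sgl circ)) (by
    rw [sbd_push, circ_cyc, map_zero])
  refine ⟨m, ?_⟩
  simp only [loopClass, circleClass_eq, singMap_scls]
  simp only [← map_zsmul (scls (GenusSurface g) 0)]
  rw [← map_sum, ← sub_eq_zero, ← map_sub]
  refine scls_eq_zero_iff.2 ⟨w, hw.trans ?_⟩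
  rw [AddSubgroup.coe_sub, AddSubgroup.val_finsetSum]
  simp only [← push_sgl]
  rfl

/-- On the disc the coordinates lift to real functions, so `cup_of_lift` reduces the cup product to
the boundary of the polygon, where only values at the vertices enter. -/
theorem cup_term (hg : 0 < g) (l m : Fin g × Fin 2) :
    cupH (coord hg l) (coord hg m) (surfaceClass hg) = ∑ k : Fin g × Fin 2,
      (sideFn (sideNo l) (sideNo k : ℕ) *
        (sideFn (sideNo m) (sideNo k + 1 : ℕ) - sideFn (sideNo m) (sideNo k : ℕ)) -
      sideFn (sideNo l) (sideNo k + 3 : ℕ) *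
        (sideFn (sideNo m) (sideNo k + 2 : ℕ) - sideFn (sideNo m) (sideNo k + 3 : ℕ))) := by
  have val (n : Fin g × Fin 2) (a b : ℕ) (ha : a ≤ 4 * g) (hb : b ≤ 4 * g) :
      discCoord hg n (rim (arc g a b (stdSimplex.vertex 0))) = sideFn (sideNo n) a ∧
      discCoord hg n (rim (arc g a b (stdSimplex.vertex 1))) = sideFn (sideNo n) b := by
    rw [rim_arc hg, rim_arc hg, vertex_of_ne (by decide), vertex_self, zero_mul, add_zero, one_mul,
      add_sub_cancel, discCoord_apply hg n ⟨zero_le_one, le_rfl⟩ ⟨by positivity, by exact_mod_cast ha⟩,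
      discCoord_apply hg n ⟨zero_le_one, le_rfl⟩ ⟨by positivity, by exact_mod_cast hb⟩, one_mul,
      one_mul]
    exact ⟨rfl, rfl⟩
  rw [surfaceClass, cupH_scls]
  change cup _ _ (push 2 (quo g) (discChain hg)) = _
  rw [cup_push, ← lineProj_discCoord, ← lineProj_discCoord, cup_of_lift, sbd_discChain, sides,
    map_sum, map_sum]
  refine Finset.sum_congr rfl fun k _ => ?_
  have hk := sideNo_lt k
  rw [map_sub, map_sub, push_sgl, push_sgl, slift_sgl, slift_sgl]
  simp only [ContinuousMap.comp_apply]
  rw [(val l _ _ _ _).1, (val m _ _ _ _).1, (val m _ _ _ _).2, (val l _ _ _ _).1, (val m _ _ _ _).1,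
    (val m _ _ _ _).2] <;> omega

theorem label_eq_iff (l m : Fin g × Fin 2) : l = m ↔ (l.1 : ℕ) = m.1 ∧ (l.2 : ℕ) = m.2 := by
  rw [Prod.ext_iff, Fin.ext_iff, Fin.ext_iff]

/-- The coordinate of side `4j` equals `1` only at the vertices `4j + 1` and `4j + 2`. Among the
initial points of the arcs in `sides` this singles out the arc of the label `(j, 1)`, whose ends are
these two vertices. -/
theorem cupH_zero_left (hg : 0 < g) (j : Fin g) (m : Fin g × Fin 2) :
    cupH (coord hg (j, 0)) (coord hg m) (surfaceClass hg) = if m = (j, 1) then 1 else 0 := by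
  have h1 (k : Fin g × Fin 2) : sideFn (sideNo (j, 0)) (sideNo k : ℕ) =
      if k = (j, 1) then 1 else 0 := by
    rw [sideFn_nat]
    refine if_congr ?_ rfl rfl
    rw [label_eq_iff]
    simp only [sideNo, Fin.coe_ofNat_eq_mod]
    have := k.2.2
    omega
  have h2 (k : Fin g × Fin 2) : sideFn (sideNo (j, 0)) (sideNo k + 3 : ℕ) = 0 := by
    rw [sideFn_nat, if_neg]
    simp only [sideNo, Fin.coe_ofNat_eq_mod]
    have := k.2.2
    omega
  rw [cup_term]
  simp only [h1, h2, zero_mul, sub_zero, ite_mul, one_mul, Finset.sum_ite_eq',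
    Finset.mem_univ, if_true]
  rw [sideFn_nat, sideFn_nat]
  have := m.2.2
  clear h1 h2
  split_ifs <;> simp only [label_eq_iff, sideNo, Fin.coe_ofNat_eq_mod] at * <;>
    first | omega | norm_num

/-- The coordinate of side `4j + 1` equals `1` only at `4j + 2` and `4j + 3`. The only arc in
`sides` that starts there is the reversed one of the label `(j, 0)`, whence the sign. -/
theorem cupH_one_left (hg : 0 < g) (j : Fin g) (m : Fin g × Fin 2) :
    cupH (coord hg (j, 1)) (coord hg m) (surfaceClass hg) = if m = (j, 0) then -1 else 0 := by
  have h1 (k : Fin g × Fin 2) : sideFn (sideNo (j, 1)) (sideNo k + 3 : ℕ) =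
      if k = (j, 0) then 1 else 0 := by
    rw [sideFn_nat]
    refine if_congr ?_ rfl rfl
    rw [label_eq_iff]
    simp only [sideNo, Fin.coe_ofNat_eq_mod]
    have := k.2.2
    omega
  have h2 (k : Fin g × Fin 2) : sideFn (sideNo (j, 1)) (sideNo k : ℕ) = 0 := by
    rw [sideFn_nat, if_neg]
    simp only [sideNo, Fin.coe_ofNat_eq_mod]
    have := k.2.2
    omega
  rw [cup_term]
  simp only [h1, h2, zero_mul, zero_sub, ite_mul, one_mul, Finset.sum_neg_distrib,
    Finset.sum_ite_eq', Finset.mem_univ, if_true]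
  rw [sideFn_nat, sideFn_nat]
  have := m.2.2
  clear h1 h2
  split_ifs <;> simp only [label_eq_iff, sideNo, Fin.coe_ofNat_eq_mod] at * <;>
    first | omega | norm_num

/-! ### Maps from the torus to the surface -/

theorem cupH_coord_torus (hg : 0 < g) (f : C(Torus, GenusSurface g)) (l m : Fin g × Fin 2) :
    cupH (coord hg l) (coord hg m) (singMap 2 f torusClass) =
      windH (coord hg l) (loopClass (f.comp ⟨fun s => (s, 0), by fun_prop⟩)) *
        windH (coord hg m) (loopClass (f.comp ⟨fun s => (0, s), by fun_prop⟩)) -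
      windH (coord hg l) (loopClass (f.comp ⟨fun s => (0, s), by fun_prop⟩)) *
        windH (coord hg m) (loopClass (f.comp ⟨fun s => (s, 0), by fun_prop⟩)) := by
  simp only [loopClass]
  rw [cupH_singMap, cupH_torusClass, windH_singMap, windH_singMap, windH_singMap, windH_singMap]
  rfl

/-- Maps from the torus to a surface of genus at least `2` have degree zero. -/
theorem singMap_torusClass_eq_zero (hg : 2 ≤ g) (f : C(Torus, GenusSurface g)) :
    singMap 2 f torusClass = 0 := by
  have hg0 : 0 < g := by omega
  obtain ⟨d, hd⟩ := exists_eq_zsmul_surfaceClass hg0 (singMap 2 f torusClass)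
  have key (l m : Fin g × Fin 2) := (cupH_coord_torus hg0 f l m).symm
  simp only [hd, map_zsmul] at key
  let j : Fin g := ⟨0, hg0⟩
  let k : Fin g := ⟨1, hg⟩
  have hjk : j ≠ k := fun h => absurd (congrArg Fin.val h) (by simp [j, k])
  have h1 := key (j, 0) (j, 1)
  have h2 := key (k, 0) (k, 1)
  have h3 := key (j, 0) (k, 0)
  have h4 := key (j, 0) (k, 1)
  have h5 := key (j, 1) (k, 0)
  have h6 := key (j, 1) (k, 1)
  rw [cupH_zero_left, if_pos rfl, zsmul_one] at h1 h2
  rw [cupH_zero_left, if_neg (by simp), zsmul_zero] at h3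
  rw [cupH_zero_left, if_neg (by simp [hjk.symm]), zsmul_zero] at h4
  rw [cupH_one_left, if_neg (by simp [hjk.symm]), zsmul_zero] at h5
  rw [cupH_one_left, if_neg (by simp), zsmul_zero] at h6
  have hd2 : (d : ℝ) * d = 0 := by
    set A := fun l => windH (coord hg0 l) (loopClass (f.comp ⟨fun s => (s, 0), by fun_prop⟩))
    set B := fun l => windH (coord hg0 l) (loopClass (f.comp ⟨fun s => (0, s), by fun_prop⟩))
    change A (j, 0) * B (j, 1) - B (j, 0) * A (j, 1) = d at h1
    change A (k, 0) * B (k, 1) - B (k, 0) * A (k, 1) = d at h2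
    change A (j, 0) * B (k, 0) - B (j, 0) * A (k, 0) = 0 at h3
    change A (j, 1) * B (k, 1) - B (j, 1) * A (k, 1) = 0 at h6
    change A (j, 0) * B (k, 1) - B (j, 0) * A (k, 1) = 0 at h4
    change A (j, 1) * B (k, 0) - B (j, 1) * A (k, 0) = 0 at h5
    nth_rewrite 1 [← h1]
    rw [← h2]
    -- Plücker relation: the product of the minors of the two handles is a combination of products
    -- of mixed minors, all of which vanish.
    linear_combination (A (j, 1) * B (k, 1) - B (j, 1) * A (k, 1)) * h3 -
      (A (j, 1) * B (k, 0) - B (j, 1) * A (k, 0)) * h4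
  have : d = 0 := by simpa using hd2
  rw [hd, this, zero_zsmul]

/-- Two integral vectors with vanishing minors are multiples of one vector. -/
theorem exists_common_multiple {ι : Type*} {n m : ι → ℤ} (h : ∀ i j, n i * m j = m i * n j) :
    ∃ (p q : ℤ) (w : ι → ℤ), (∀ i, n i = p * w i) ∧ ∀ i, m i = q * w i := by
  by_cases h0 : ∀ i, n i = 0 ∧ m i = 0
  · exact ⟨0, 0, 0, fun i => by simp [h0 i], fun i => by simp [h0 i]⟩
  push Not at h0
  obtain ⟨i₀, hi⟩ := h0
  have hd : ((n i₀).gcd (m i₀) : ℤ) ≠ 0 := by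
    intro hd
    rw [Nat.cast_eq_zero, Int.gcd_eq_zero_iff] at hd
    exact hi hd.1 hd.2
  obtain ⟨p, hp⟩ := Int.gcd_dvd_left (n i₀) (m i₀)
  obtain ⟨q, hq⟩ := Int.gcd_dvd_right (n i₀) (m i₀)
  have hb := Int.gcd_eq_gcd_ab (n i₀) (m i₀)
  set d : ℤ := ((n i₀).gcd (m i₀) : ℤ)
  set a := (n i₀).gcdA (m i₀)
  set b := (n i₀).gcdB (m i₀)
  have h1 : p * a + q * b = 1 := mul_left_cancel₀ hd (by
    rw [mul_one]
    conv_rhs => rw [hb, hp, hq]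
    ring)
  have h2 (i : ι) : p * m i = q * n i := mul_left_cancel₀ hd (by
    have := h i₀ i
    rw [hp, hq] at this
    linarith)
  -- The choice is forced: if `n = p w` and `m = q w`, then `a n + b m = (p a + q b) w = w` by the
  -- Bézout relation.
  exact ⟨p, q, fun i => a * n i + b * m i,
    fun i => by linear_combination (-n i) * h1 - b * h2 i,
    fun i => by linear_combination (-m i) * h1 + a * h2 i⟩

theorem windH_coord_sum (hg : 0 < g) (m : Fin g × Fin 2 → ℤ) (k : Fin g × Fin 2) :
    windH (coord hg k) (∑ l, m l • loopClass (sideLoop l)) = m k := by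
  rw [map_sum, Finset.sum_eq_single k]
  · rw [map_zsmul, loopClass, windH_singMap, coord_sideLoop_self, windH_circleClass, zsmul_one]
  · intro l _ hl
    rw [map_zsmul, loopClass, windH_singMap, coord_sideLoop_ne hg k l hl.symm]
    have : windH (ContinuousMap.const UnitAddCircle (0 : UnitAddCircle)) circleClass = 0 := by
      have := windH_singMap (.id _) (ContinuousMap.const UnitAddCircle (0 : UnitAddCircle))
        circleClass
      rw [singMap_const, map_zero] at this
      exact this.symm
    rw [this, zsmul_zero]
  · simp

/-- The two loops given by a map from the torus to the surface are multiples of one class. -/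
theorem exists_common_class (hg : 2 ≤ g) (f : C(Torus, GenusSurface g)) :
    ∃ (u : singH 1 (GenusSurface g)) (p q : ℤ),
      loopClass (f.comp ⟨fun s => (s, 0), by fun_prop⟩) = p • u ∧
        loopClass (f.comp ⟨fun s => (0, s), by fun_prop⟩) = q • u := by
  have hg0 : 0 < g := by omega
  obtain ⟨n, hn⟩ := loopClass_eq_sum hg0 (f.comp ⟨fun s => (s, 0), by fun_prop⟩)
  obtain ⟨m, hm⟩ := loopClass_eq_sum hg0 (f.comp ⟨fun s => (0, s), by fun_prop⟩)
  -- The minors are cup products evaluated on the image of `[T²]`, which is zero.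
  have hnm (i j : Fin g × Fin 2) : n i * m j = m i * n j := by
    have := cupH_coord_torus hg0 f i j
    rw [singMap_torusClass_eq_zero hg, map_zero, hn, hm, windH_coord_sum, windH_coord_sum,
      windH_coord_sum, windH_coord_sum] at this
    exact_mod_cast (sub_eq_zero.1 this.symm)
  obtain ⟨p, q, w, hp, hq⟩ := exists_common_multiple hnm
  refine ⟨∑ l, w l • loopClass (sideLoop l), p, q, ?_, ?_⟩
  · rw [hn, Finset.smul_sum]
    exact Finset.sum_congr rfl fun l _ => by rw [hp, mul_smul]
  · rw [hm, Finset.smul_sum]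
    exact Finset.sum_congr rfl fun l _ => by rw [hq, mul_smul]

/-- Of the four terms of `singMap_prodMk_torusClass`, the one of `f` alone vanishes and the one of
`h` alone is a multiple of the fibre class. The two mixed terms have proportional first factors, so
they merge into one product by bilinearity. -/
theorem exists_eq_homCross_add (hg : 2 ≤ g) (f : C(Torus, GenusSurface g)) (h : C(Torus, Torus)) :
    ∃ (u : singH 1 (GenusSurface g)) (v : singH 1 Torus) (k : ℤ),
      singMap 2 (f.prodMk h) torusClass = homCross u v + k • fiberClass (f 0) := by
  obtain ⟨u, p, q, hp, hq⟩ := exists_common_class hg f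
  obtain ⟨k, hk⟩ := singMap_torus_torus h
  refine ⟨u, p • loopClass (h.comp ⟨fun s => (0, s), by fun_prop⟩) -
    q • loopClass (h.comp ⟨fun s => (s, 0), by fun_prop⟩), k, ?_⟩
  have e1 : singMap 2 (f.prodMk (.const _ (h 0))) torusClass = 0 := by
    have : f.prodMk (.const _ (h 0)) =
        ((ContinuousMap.id _).prodMk (.const _ (h 0))).comp f := rfl
    rw [this, ← singMap_comp, singMap_torusClass_eq_zero hg, map_zero]
  have e2 : singMap 2 ((ContinuousMap.const Torus (f 0)).prodMk h) torusClass =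
      k • fiberClass (f 0) := by
    have : (ContinuousMap.const Torus (f 0)).prodMk h =
        ((ContinuousMap.const Torus (f 0)).prodMk (.id _)).comp h := rfl
    rw [this, ← singMap_comp, hk, map_zsmul, fiberClass]
  rw [singMap_prodMk_torusClass, e1, e2, hp, hq, map_sub, map_zsmul, map_zsmul, map_zsmul,
    map_zsmul, AddMonoidHom.zsmul_apply, AddMonoidHom.zsmul_apply]
  abel

theorem fiberClass_congr {S : Type} [TopologicalSpace S] [PathConnectedSpace S] (p p' : S) :
    fiberClass p = fiberClass p' := by
  have h : (ContinuousMap.const Torus p).Homotopic (.const Torus p') :=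
    ContinuousMap.homotopic_const_iff.2 (PathConnectedSpace.joined p p')
  exact DFunLike.congr_fun (singMap_homotopic (h.prodMk (.refl _))) torusClass

end Surface

end

/-! ### Transport to a surface homeomorphic to the standard one -/

theorem mainTheorem2 (g : ℕ) (hg : 2 ≤ g) (S : Type) [TopologicalSpace S]
    (hS : Nonempty (S ≃ₜ GenusSurface g)) (p : S) (φ : C(Torus, S × Torus)) :
    ∃ (u : singH 1 S) (v : singH 1 Torus) (n : ℤ),
      singMap 2 φ torusClass = homCross u v + n • (-fiberClass p) := by
  obtain ⟨e⟩ := hS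
  let i : C(GenusSurface g, S) := ⟨e.symm, e.symm.continuous⟩
  let f : C(Torus, GenusSurface g) := ⟨fun x => e (φ x).1, by fun_prop⟩
  let h : C(Torus, Torus) := ContinuousMap.snd.comp φ
  -- Path connectedness, inherited from the disc, makes the fibre class independent of the point.
  have hc : PathConnectedSpace S :=
    (e.symm.surjective.comp Quot.mk_surjective :
      Function.Surjective (i.comp (Surface.quo g))).pathConnectedSpace (i.comp (Surface.quo g)).continuous
  obtain ⟨u, v, k, huv⟩ := Surface.exists_eq_homCross_add hg f h
  refine ⟨singMap 1 i u, v, -k, ?_⟩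
  have hφ : φ = (i.prodMap (.id Torus)).comp (f.prodMk h) := by
    ext x : 1
    exact Prod.ext (e.symm_apply_apply _).symm rfl
  have hF : singMap 2 (i.prodMap (.id Torus)) (fiberClass (f 0)) = fiberClass (i (f 0)) :=
    SingChain.singMap_comp _ _ _
  rw [hφ, ← SingChain.singMap_comp, huv, map_add, SingChain.singMap_homCross, SingChain.singMap_id, map_zsmul, hF,
    Surface.fiberClass_congr (i (f 0)) p, neg_zsmul, zsmul_neg, neg_neg]
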